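/- Let $k\ge 3$, $m\ge 4$ and $0<\alpha<1$. For a $k$-uniform hypergraph $\mathcal H$ on $n$ vertices let $\mathcal A_\alpha(\mathcal H)=\alpha\mathcal D(\mathcal H)+(1-\alpha)\mathcal A(\mathcal H)$, where $\mathcal D(\mathcal H)$ is the diagonal tensor of the vertex degrees and $\mathcal A(\mathcal H)$ is the adjacency tensor (order $k$, dimension $n$, with entry $\frac{1}{(k-1)!}$ at $(i_1,\dots,i_k)$ if $\{i_1,\dots,i_k\}$ is a hyperedge and $0$ otherwise). The $d$-th order trace of a tensor $\mathcal T=(t_{i_1\cdots i_k})$ of order $k$ and dimension $n$ is $$\mathrm{Tr}_d(\mathcal T)=(k-1)^{n-1}\sum_{d_1+\cdots+d_n=d}\ \prod_{i=1}^n\frac{1}{(d_i(k-1))!}\Big(\sum_{\beta\in[n]^{k-1}}t_{i\beta}\frac{\partial}{\partial a_{i\beta}}\Big)^{d_i}\mathrm{tr}\big(A^{d(k-1)}\big),$$ where $A=(a_{ij})$ is an $n\times n$ matrix of indeterminates, the $d_i$ are nonnegative integers and $\frac{\partial}{\partial a_{i\beta}}=\frac{\partial}{\partial a_{ii_2}}\cdots\frac{\partial}{\partial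 a_{ii_k}}$ for $\beta=i_2\cdots i_k$. For $k$-uniform hypergraphs $\mathcal H_1,\mathcal H_2$ with the same number $n$ of vertices write $\mathcal H_1\prec_\alpha\mathcal H_2$ if for some $1\le d\le n(k-1)^{n-1}-1$ one has $\mathrm{Tr}_t(\mathcal A_\alpha(\mathcal H_1))=\mathrm{Tr}_t(\mathcal A_\alpha(\mathcal H_2))$ for all $0\le t<d$ and $\mathrm{Tr}_d(\mathcal A_\alpha(\mathcal H_1))<\mathrm{Tr}_d(\mathcal A_\alpha(\mathcal H_2))$; write $\mathcal H_1=_\alpha\mathcal H_2$ if these traces agree for all $0\le t\le n(k-1)^{n-1}-1$; and write $\mathcal H_1\preceq_\alpha\mathcal H_2$ if $\mathcal H_1\prec_\alpha\mathcal H_2$ or $\mathcal H_1=_\alpha\mathcal H_2$ ($S_\alpha$-order). A $k$-uniform hypertree is a finite connected $k$-uniform hypergraph without (Berge) cycles. Let $P_m^{(k)}$ be the $k$-uniform hyperpath with $m$ hyperedges, i.e. the hypergraph obtained from the path with edges $e_1,\dots,e_m$ (in this order) by adding $k-2$ new vertices to each edge $e_i$, giving the hyperedge $e_i^{(k)}$.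 Let $F_{m,k}$ be obtained from $P_{m-1}^{(k)}$ by attaching, at a vertex of degree one of its second hyperedge $e_2^{(k)}$, a pendant hyperedge (consisting of that vertex and $k-1$ new vertices). Then, among all $k$-uniform hypertrees with $m$ hyperedges, $F_{m,k}$ is the second in $S_\alpha$-order. That is: $P_m^{(k)}$ and $F_{m,k}$ are $k$-uniform hypertrees with $m$ hyperedges, $P_m^{(k)}\prec_\alpha F_{m,k}$, and every $k$-uniform hypertree $T$ with $m$ hyperedges that is not isomorphic to $P_m^{(k)}$ satisfies $F_{m,k}\preceq_\alpha T$, with $F_{m,k}=_\alpha T$ if and only if $T\cong F_{m,k}$. -/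

import Mathlib

noncomputable section

/-- A real tensor of order `k` (`k ≥ 1`) with indices in `ι`. The entry `a_{i i₂ ⋯ iₖ}` is `A i β`,
where `i` is the first index and `β = (i₂, …, iₖ)` lists the other `k - 1` indices. -/
abbrev HTensor (k : ℕ) (ι : Type*) : Type _ := ι → (Fin (k - 1) → ι) → ℝ

namespace HTensor

/-- The partial derivative `∂/∂a_{ij}`, `p = (i, j)`, as a linear operator on the polynomials in
the entries of an auxiliary matrix `(a_{ij})`. -/
def partialOp {ι : Type*} (p : ι × ι) : Module.End ℝ (MvPolynomial (ι × ι) ℝ) :=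
  (MvPolynomial.pderiv p).toLinearMap

/-- The differential operator `∑_β A_{iβ} ∂/∂a_{iβ}`, where `β` runs over all `(k-1)`-tuples of
indices and `∂/∂a_{iβ} = ∂/∂a_{i i₂} ⋯ ∂/∂a_{i iₖ}` for `β = (i₂, …, iₖ)`. -/
def rowOp {k : ℕ} {ι : Type*} [Fintype ι] (A : HTensor k ι) (i : ι) :
    Module.End ℝ (MvPolynomial (ι × ι) ℝ) :=
  ∑ β : Fin (k - 1) → ι, A i β • (List.ofFn fun t => partialOp (i, β t)).prod

theorem commute_partialOp {ι : Type*} (p q : ι × ι) : Commute (partialOp p) (partialOp q) := by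
  classical
  let D (r : ι × ι) : Derivation ℝ (MvPolynomial (ι × ι) ℝ) (MvPolynomial (ι × ι) ℝ) :=
    MvPolynomial.pderiv r
  have h : ⁅D p, D q⁆ = 0 := by
    apply MvPolynomial.derivation_ext
    intro r
    simp [D, Derivation.commutator_apply, MvPolynomial.pderiv_X, Pi.single_apply, apply_ite]
  apply LinearMap.ext
  intro f
  have := DFunLike.congr_fun h f
  rw [Derivation.commutator_apply] at this
  exact sub_eq_zero.mp this

theorem commute_rowOp {k : ℕ} {ι : Type*} [Fintype ι] (A : HTensor k ι) (i j : ι) :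
    Commute (rowOp A i) (rowOp A j) := by
  refine Commute.sum_left _ _ _ fun β _ => Commute.sum_right _ _ _ fun γ _ => ?_
  refine Commute.smul_left (Commute.smul_right ?_ _) _
  refine Commute.list_prod_left _ _ fun x hx => Commute.list_prod_right _ _ fun y hy => ?_
  obtain ⟨s, rfl⟩ := (List.mem_ofFn' _ _).mp hx
  obtain ⟨t, rfl⟩ := (List.mem_ofFn' _ _).mp hy
  exact commute_partialOp _ _

/-- The `d`-th order trace of a tensor of order `k` and dimension `n`,
`Tr_d(A) = (k-1)^{n-1} ∑_{d₁+⋯+dₙ=d} ∏ᵢ 1/(dᵢ(k-1))! (∑_β A_{iβ} ∂/∂a_{iβ})^{dᵢ} tr(M^{d(k-1)})`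
with `M = (a_{ij})` the `n × n` matrix of indeterminates. Each summand is a polynomial of degree
`0`, which is read off by its constant coefficient. -/
def trace {k : ℕ} {ι : Type*} [Fintype ι] [DecidableEq ι] (A : HTensor k ι) (d : ℕ) : ℝ :=
  ((k : ℝ) - 1) ^ (Fintype.card ι - 1) *
    ∑ c ∈ Finset.piAntidiag (Finset.univ : Finset ι) d,
      MvPolynomial.constantCoeff
        ((Finset.univ.noncommProd
            (fun i => (1 / ((c i * (k - 1)).factorial : ℝ)) • rowOp A i ^ c i)
            (fun i _ j _ _ => (((commute_rowOp A i j).pow_pow _ _).smul_left _).smul_right _))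
          (Matrix.trace (Matrix.mvPolynomialX ι ι ℝ ^ (d * (k - 1)))))

end HTensor

namespace Hypergraph

/-- Every hyperedge has exactly `k` vertices. -/
def IsUniform {U : Type*} (H : Hypergraph U) (k : ℕ) : Prop :=
  ∀ e ∈ H.edgeSet, e.encard = k

/-- The number of hyperedges that contain the vertex `v`. -/
def degree {U : Type*} (H : Hypergraph U) (v : U) : ℕ :=
  {e ∈ H.edgeSet | v ∈ e}.ncard

/-- The bipartite incidence graph: a vertex is joined to the hyperedges that contain it. -/
def incidenceGraph {U : Type*} (H : Hypergraph U) :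
    SimpleGraph (↥H.vertexSet ⊕ ↥H.edgeSet) where
  Adj
    | .inl v, .inr e => (v : U) ∈ (e : Set U)
    | .inr e, .inl v => (v : U) ∈ (e : Set U)
    | _, _ => False
  symm := ⟨by rintro (v | e) (w | f) h <;> exact h⟩
  loopless := ⟨by rintro (v | e) h <;> exact h⟩

/-- `H` is a `k`-uniform hypertree with `m` hyperedges: it is `k`-uniform, connected and without
(Berge) cycles. Walks and cycles `v₁ e₁ v₂ e₂ ⋯` of `H` are those of its incidence graph. -/
structure IsUniformHypertree {U : Type*} (H : Hypergraph U) (k m : ℕ) : Prop where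
  uniform : H.IsUniform k
  card_edges : H.edgeSet.encard = m
  isTree : H.incidenceGraph.IsTree

/-- Isomorphism of hypergraphs. -/
def IsIsomorphic {U W : Type*} (H : Hypergraph U) (K : Hypergraph W) : Prop :=
  ∃ φ : ↥H.vertexSet ≃ ↥K.vertexSet, ∀ s : Set ↥H.vertexSet,
    (Subtype.val '' s : Set U) ∈ H.edgeSet ↔ (Subtype.val '' (φ '' s) : Set W) ∈ K.edgeSet

/-- The diagonal tensor of vertex degrees, of order `k`. -/
def degreeTensor {U : Type*} (H : Hypergraph U) (k : ℕ) : HTensor k ↥H.vertexSet :=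
  open Classical in fun i β => if ∀ t, β t = i then (H.degree i : ℝ) else 0

/-- The adjacency tensor of a `k`-uniform hypergraph: the entry at `(i₁, …, iₖ)` is `1/(k-1)!` if
`{i₁, …, iₖ}` is a hyperedge and `0` otherwise. -/
def adjacencyTensor {U : Type*} (H : Hypergraph U) (k : ℕ) : HTensor k ↥H.vertexSet :=
  open Classical in fun i β =>
    if insert (i : U) (Set.range fun t => (β t : U)) ∈ H.edgeSet then 1 / ((k - 1).factorial : ℝ) else 0

/-- The tensor `𝒜_a(H) = a 𝒟(H) + (1 - a) 𝒜(H)`. -/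
def alphaTensor {U : Type*} (H : Hypergraph U) (k : ℕ) (a : ℝ) : HTensor k ↥H.vertexSet :=
  a • H.degreeTensor k + (1 - a) • H.adjacencyTensor k

/-- The `d`-th order spectral moment `Tr_d(𝒜_a(H))` of a finite `k`-uniform hypergraph. -/
def alphaMoment {U : Type*} [Finite U] (H : Hypergraph U) (k : ℕ) (a : ℝ) (d : ℕ) : ℝ :=
  open Classical in
  letI : Fintype ↥H.vertexSet := Fintype.ofFinite _
  (H.alphaTensor k a).trace d

/-- `H ≺_a K`: the two `k`-uniform hypergraphs have the same number `n` of vertices, and for some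
`1 ≤ d ≤ n(k-1)^{n-1} - 1` their moments agree below order `d` and that of `H` is smaller at
order `d`. -/
def AlphaLT {U W : Type*} [Finite U] [Finite W] (k : ℕ) (a : ℝ)
    (H : Hypergraph U) (K : Hypergraph W) : Prop :=
  H.vertexSet.ncard = K.vertexSet.ncard ∧
    ∃ d : ℕ, 1 ≤ d ∧ d ≤ H.vertexSet.ncard * (k - 1) ^ (H.vertexSet.ncard - 1) - 1 ∧
      (∀ t < d, H.alphaMoment k a t = K.alphaMoment k a t) ∧
      H.alphaMoment k a d < K.alphaMoment k a d

/-- `H =_a K`: the two `k`-uniform hypergraphs have the same number `n` of vertices and the same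
moments of orders `0, 1, …, n(k-1)^{n-1} - 1`. -/
def AlphaEq {U W : Type*} [Finite U] [Finite W] (k : ℕ) (a : ℝ)
    (H : Hypergraph U) (K : Hypergraph W) : Prop :=
  H.vertexSet.ncard = K.vertexSet.ncard ∧
    ∀ t < H.vertexSet.ncard * (k - 1) ^ (H.vertexSet.ncard - 1),
      H.alphaMoment k a t = K.alphaMoment k a t

/-- `H ⪯_a K`. -/
def AlphaLE {U W : Type*} [Finite U] [Finite W] (k : ℕ) (a : ℝ)
    (H : Hypergraph U) (K : Hypergraph W) : Prop :=
  AlphaLT k a H K ∨ AlphaEq k a H K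

/-- The `i`-th hyperedge (counted from `0`) of the `k`-uniform hyperpath with `m` hyperedges: the
`i`-th edge of the path on the vertices `0, …, m`, enlarged by `k - 2` new vertices. -/
def hyperpathEdge (k m : ℕ) (i : Fin m) : Set (Fin (m + 1) ⊕ Fin m × Fin (k - 2)) :=
  {Sum.inl i.castSucc, Sum.inl i.succ} ∪ Set.range fun j => Sum.inr (i, j)

/-- The `k`-uniform hyperpath with `m` hyperedges (`k ≥ 2`). -/
def hyperpath (k m : ℕ) : Hypergraph (Fin (m + 1) ⊕ Fin m × Fin (k - 2)) where
  vertexSet := Set.univ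
  edgeSet := Set.range (hyperpathEdge k m)
  subset_vertexSet_of_mem_edgeSet' := fun e _ => Set.subset_univ e

/-- The hypergraph obtained from `H` by attaching a pendant hyperedge at the vertex `v`: the new
hyperedge consists of `v` and `k - 1` new vertices. -/
def attachPendant {U : Type*} (k : ℕ) (H : Hypergraph U) (v : U) (hv : v ∈ H.vertexSet) :
    Hypergraph (U ⊕ Fin (k - 1)) where
  vertexSet := Sum.inl '' H.vertexSet ∪ Set.range Sum.inr
  edgeSet := insert (insert (Sum.inl v) (Set.range Sum.inr)) (Set.image Sum.inl '' H.edgeSet)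
  subset_vertexSet_of_mem_edgeSet' := by
    rintro e (rfl | ⟨f, hf, rfl⟩)
    · exact Set.insert_subset (Or.inl ⟨v, hv, rfl⟩) Set.subset_union_right
    · exact (Set.image_mono (H.subset_vertexSet_of_mem_edgeSet hf)).trans Set.subset_union_left

/-- The hypertree `F_{m,k}`: the hyperpath with `m - 1` hyperedges and a pendant hyperedge attached
at a cored vertex (a vertex of degree one) of its second hyperedge. -/
def hypertreeF (k m : ℕ) (hk : 3 ≤ k) (hm : 4 ≤ m) :
    Hypergraph ((Fin (m - 1 + 1) ⊕ Fin (m - 1) × Fin (k - 2)) ⊕ Fin (k - 1)) :=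
  attachPendant k (hyperpath k (m - 1)) (Sum.inr (⟨1, by omega⟩, ⟨0, by omega⟩)) (Set.mem_univ _)

end Hypergraph

end

/-!
The operator that defines `Tr_d` is adjoint, for the apolar pairing, to multiplication by the row
polynomials of the tensor. This makes `Tr_d(𝒜_a)` a sum over the multisets of row terms (loops at a
vertex, and hyperedges entered from a vertex), each weighted by the number of Eulerian closed walks
on its arcs. In a hypertree an Eulerian multiset uses all rows of a hyperedge equally often, and the
hyperedges that it uses form a subtree.

Hence `Tr_0` and `Tr_1` do not depend on the hypertree, and `Tr_2` compares the sums of the squares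
of the vertex degrees, so that a vertex of degree at least three already makes it larger than it is
for `P_m` and `F_m`. If all degrees are at most two, then the traces of order less than `3k` split
into contributions of single vertices, single hyperedges and pairs of adjacent hyperedges, which
depend only on the degrees in the line graph, and this is a tree that determines the hypertree. The
contribution of a hyperedge with `δ` vertices of degree two is affine in `δ` up to order `k + 1` and
convex at order `k + 2`. Therefore `Tr_{k+2}` singles out the line graphs with the smallest excess
`∑ (deg - 2)⁺`: excess `0` is the path, and excess `1` means one branch vertex, of degree three.
Among the line graphs with excess `1`, the first difference is at order `2k + 2`, where a mixed
second difference of the contributions of pairs is positive, so that the trace decreases with the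
number of leaves next to the branch vertex. Two such leaves force it to be that of `F_m`.
-/

namespace HypertreeOrder

open MvPolynomial HTensor Hypergraph

section ApolarPairing

variable {R σ : Type*} [CommSemiring R]

/-- The product of the factorials of the exponents of a monomial. -/
def expFactorial (s : σ →₀ ℕ) : ℕ := s.prod fun _ m => m.factorial

theorem expFactorial_pos (s : σ →₀ ℕ) : 0 < expFactorial s :=
  Finset.prod_pos fun _ _ => Nat.factorial_pos _

theorem expFactorial_mapDomain {τ : Type*} {f : σ → τ} (hf : Function.Injective f) (s : σ →₀ ℕ) :
    expFactorial (s.mapDomain f) = expFactorial s :=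
  Finsupp.prod_mapDomain_index_inj hf

theorem expFactorial_add_single (s : σ →₀ ℕ) (p : σ) :
    expFactorial (s + Finsupp.single p 1) = (s p + 1) * expFactorial s := by
  classical
  have expand (u : σ →₀ ℕ) (hu : u.support ⊆ insert p s.support) :
      expFactorial u = ∏ q ∈ insert p s.support, (u q).factorial :=
    Finsupp.prod_of_support_subset _ hu _ (by simp)
  have hsupp : (s + Finsupp.single p 1).support ⊆ insert p s.support :=
    Finsupp.support_add.trans <| Finset.union_subset (Finset.subset_insert _ _) <|
      Finsupp.support_single_subset.trans (by simp)
  rw [expand s (Finset.subset_insert _ _), expand _ hsupp,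
    ← Finset.mul_prod_erase _ _ (Finset.mem_insert_self p _),
    ← Finset.mul_prod_erase (insert p s.support) (fun q => (s q).factorial)
      (Finset.mem_insert_self p _), ← mul_assoc]
  congr 1
  · simp [Nat.factorial_succ]
  · refine Finset.prod_congr rfl fun q hq => ?_
    simp [(Finset.ne_of_mem_erase hq).symm]

/-- The apolar pairing `(P, Q) ↦ (P(∂) Q)(0)` of polynomials, for which different monomials are
orthogonal. It turns the differential operators in the trace into polynomials. -/
noncomputable def apolarPairing : MvPolynomial σ R →ₗ[R] MvPolynomial σ R →ₗ[R] R :=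
  (basisMonomials σ R).constr R fun s => (expFactorial s : R) • lcoeff R s

theorem apolarPairing_monomial (s : σ →₀ ℕ) (c : R) (Q : MvPolynomial σ R) :
    apolarPairing (monomial s c) Q = c * (expFactorial s * coeff s Q) := by
  have h : monomial s c = c • basisMonomials σ R s := by simp [smul_monomial]
  rw [h, map_smul, apolarPairing, Module.Basis.constr_basis]
  simp

theorem apolarPairing_one (Q : MvPolynomial σ R) : apolarPairing 1 Q = constantCoeff Q := by
  rw [← C_1, C_apply, apolarPairing_monomial]
  simp [expFactorial, constantCoeff_eq]

theorem apolarPairing_pderiv (P Q : MvPolynomial σ R) (p : σ) :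
    apolarPairing P (pderiv p Q) = apolarPairing (P * X p) Q := by
  induction P using MvPolynomial.induction_on' with
  | monomial s c =>
    rw [X, monomial_mul, apolarPairing_monomial, apolarPairing_monomial, coeff_pderiv,
      expFactorial_add_single]
    push_cast
    ring
  | add P P' h h' => rw [map_add, add_mul, map_add, LinearMap.add_apply, h, h',
      LinearMap.add_apply]

/-- The pairs `(D, P)` of a linear operator on polynomials and a polynomial such that `D` is
adjoint to the multiplication by `P`, that is, `D` acts as the differential operator `P(∂)`. -/
def adjointPairs (σ R : Type*) [CommSemiring R] :
    Subalgebra R (Module.End R (MvPolynomial σ R) × MvPolynomial σ R) where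
  carrier := {p | ∀ P Q, apolarPairing P (p.1 Q) = apolarPairing (P * p.2) Q}
  mul_mem' {p q} hp hq P Q := by
    simp only [Prod.fst_mul, Prod.snd_mul, Module.End.mul_apply]
    rw [hp, hq, mul_assoc]
  add_mem' {p q} hp hq P Q := by simp [mul_add, hp P Q, hq P Q]
  algebraMap_mem' r P Q := by simp [Algebra.algebraMap_eq_smul_one]

theorem mem_adjointPairs {D : Module.End R (MvPolynomial σ R)} {P : MvPolynomial σ R} :
    (D, P) ∈ adjointPairs σ R ↔
      ∀ P' Q, apolarPairing P' (D Q) = apolarPairing (P' * P) Q := Iff.rfl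

theorem noncommProd_mem_adjointPairs {κ : Type*} (s : Finset κ)
    {D : κ → Module.End R (MvPolynomial σ R)} {P : κ → MvPolynomial σ R}
    (comm : (s : Set κ).Pairwise (Function.onFun Commute D))
    (h : ∀ i ∈ s, (D i, P i) ∈ adjointPairs σ R) :
    (s.noncommProd D comm, ∏ i ∈ s, P i) ∈ adjointPairs σ R := by
  have comm' : (s : Set κ).Pairwise (Function.onFun Commute fun i => (D i, P i)) :=
    fun i hi j hj hij => Prod.ext (comm hi hj hij) (mul_comm _ _)
  have hprod : s.noncommProd (fun i => (D i, P i)) comm' = (s.noncommProd D comm, ∏ i ∈ s, P i) :=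
    Prod.ext (Finset.map_noncommProd s _ comm' (MonoidHom.fst _ _))
      ((Finset.map_noncommProd s _ comm' (MonoidHom.snd _ _)).trans
        (Finset.noncommProd_eq_prod _ _))
  exact hprod ▸ (adjointPairs σ R).toSubmonoid.noncommProd_mem s _ comm' h

end ApolarPairing

section RowPoly

variable {k : ℕ} {ι : Type*} [Fintype ι]

/-- The polynomial `∑_β A_{iβ} x_{iβ}` in the entries of a matrix of indeterminates, obtained from
the differential operator `rowOp A i` by replacing derivatives with variables. -/
noncomputable def rowPoly (A : HTensor k ι) (i : ι) : MvPolynomial (ι × ι) ℝ :=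
  ∑ β : Fin (k - 1) → ι, A i β • ∏ t, X (i, β t)

theorem rowOp_rowPoly_mem_adjointPairs (A : HTensor k ι) (i : ι) :
    (rowOp A i, rowPoly A i) ∈ adjointPairs (ι × ι) ℝ := by
  have hlist (β : Fin (k - 1) → ι) :
      ((List.ofFn fun t => partialOp (i, β t)).prod, ∏ t, X (i, β t)) ∈ adjointPairs (ι × ι) ℝ := by
    let l : List (Module.End ℝ (MvPolynomial (ι × ι) ℝ) × MvPolynomial (ι × ι) ℝ) :=
      List.ofFn fun t => (partialOp (i, β t), X (i, β t))
    have hmem : l.prod ∈ adjointPairs (ι × ι) ℝ := list_prod_mem <| by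
      simp only [l, List.forall_mem_ofFn_iff]
      exact fun t => mem_adjointPairs.mpr fun P Q => apolarPairing_pderiv P Q _
    have hfst := map_list_prod (MonoidHom.fst _ _) l
    have hsnd := map_list_prod (MonoidHom.snd _ _) l
    simp only [MonoidHom.coe_fst, MonoidHom.coe_snd, l, List.map_ofFn, Function.comp_def,
      List.prod_ofFn (f := fun t => X (i, β t))] at hfst hsnd
    rwa [← hfst, ← hsnd]
  have hsum := sum_mem (S := adjointPairs (ι × ι) ℝ) (t := Finset.univ) fun β _ =>
    (adjointPairs (ι × ι) ℝ).smul_mem (hlist β) (A i β)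
  convert hsum using 1
  exact Prod.ext (by simp [rowOp, Prod.fst_sum]) (by simp [rowPoly, Prod.snd_sum])

theorem trace_eq_sum_apolarPairing [DecidableEq ι] (A : HTensor k ι) (d : ℕ) :
    A.trace d = ((k : ℝ) - 1) ^ (Fintype.card ι - 1) *
      ∑ c ∈ Finset.piAntidiag (Finset.univ : Finset ι) d,
        apolarPairing (∏ i, (1 / ((c i * (k - 1)).factorial : ℝ)) • rowPoly A i ^ c i)
          (Matrix.trace (Matrix.mvPolynomialX ι ι ℝ ^ (d * (k - 1)))) := by
  rw [trace]
  congr 1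
  refine Finset.sum_congr rfl fun c _ => ?_
  have hrow (i : ι) : ((1 / ((c i * (k - 1)).factorial : ℝ)) • rowOp A i ^ c i,
      (1 / ((c i * (k - 1)).factorial : ℝ)) • rowPoly A i ^ c i) ∈ adjointPairs (ι × ι) ℝ :=
    (adjointPairs (ι × ι) ℝ).smul_mem (pow_mem (rowOp_rowPoly_mem_adjointPairs A i) (c i)) _
  rw [← apolarPairing_one]
  refine (mem_adjointPairs.mp (noncommProd_mem_adjointPairs _ _ fun i _ => hrow i) _ _).trans ?_
  rw [one_mul]

end RowPoly

/-- `EulerTrail i μ j`: some walk from `i` to `j` traverses every arc `p` exactly `μ p` times. -/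
inductive EulerTrail {ι : Type*} (i : ι) : (ι × ι →₀ ℕ) → ι → Prop
  | nil : EulerTrail i 0 i
  | snoc {μ : ι × ι →₀ ℕ} {l : ι} (j : ι) (h : EulerTrail i μ l) :
      EulerTrail i (μ + Finsupp.single (l, j) 1) j

namespace EulerTrail

variable {ι : Type*} {i j l : ι} {μ ν : ι × ι →₀ ℕ}

theorem arc (i j : ι) : EulerTrail i (Finsupp.single (i, j) 1) j := by
  simpa using EulerTrail.snoc j (EulerTrail.nil (i := i))

theorem trans (h : EulerTrail i μ j) (h' : EulerTrail j ν l) : EulerTrail i (μ + ν) l := by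
  induction h' with
  | nil => simpa using h
  | snoc l' _ ih => rw [← add_assoc]; exact ih.snoc l'

theorem loops (i : ι) (n : ℕ) : EulerTrail i (Finsupp.single (i, i) n) i := by
  induction n with
  | zero => simpa using EulerTrail.nil (i := i)
  | succ n ih => rw [Finsupp.single_add]; exact ih.snoc i

theorem insert_closed {w : ι} (h : EulerTrail i μ j) (hw : w = i ∨ ∃ u, μ (w, u) ≠ 0)
    (h' : EulerTrail w ν w) : EulerTrail i (μ + ν) j := by
  classical
  induction h with
  | nil =>
    obtain rfl : w = i := by simpa using hw
    simpa using h'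
  | @snoc μ l j h ih =>
    rw [add_right_comm]
    by_cases hw' : w = i ∨ ∃ u, μ (w, u) ≠ 0
    · exact (ih hw').snoc j
    · push Not at hw'
      obtain ⟨u, hu⟩ := hw.resolve_left hw'.1
      rw [Finsupp.add_apply, hw'.2 u, zero_add, Finsupp.single_apply] at hu
      obtain ⟨rfl, rfl⟩ : l = w ∧ j = u := by simpa using hu
      exact (h.trans h').snoc j

theorem insert_closed_sum {κ : Type*} (s : Finset κ) (w : κ → ι) (ν : κ → ι × ι →₀ ℕ)
    (h : EulerTrail i μ j) (hw : ∀ c ∈ s, w c = i ∨ ∃ u, μ (w c, u) ≠ 0)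
    (h' : ∀ c ∈ s, EulerTrail (w c) (ν c) (w c)) : EulerTrail i (μ + ∑ c ∈ s, ν c) j := by
  classical
  induction s using Finset.induction_on with
  | empty => simpa using h
  | insert c s hc ih =>
    rw [Finset.sum_insert hc, add_comm (ν c), ← add_assoc]
    refine insert_closed (ih (fun a ha => hw a (Finset.mem_insert_of_mem ha))
      (fun a ha => h' a (Finset.mem_insert_of_mem ha))) ?_ (h' c (Finset.mem_insert_self _ _))
    refine (hw c (Finset.mem_insert_self _ _)).imp_right fun ⟨u, hu⟩ => ⟨u, ?_⟩
    rw [Finsupp.add_apply]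
    omega

theorem balanced [Fintype ι] [DecidableEq ι] (h : EulerTrail i μ j) (v : ι) :
    ∑ u, μ (v, u) + (if v = j then 1 else 0) = ∑ u, μ (u, v) + (if v = i then 1 else 0) := by
  induction h with
  | nil => simp
  | @snoc μ l j _ ih =>
    have hout : ∑ u, (Finsupp.single (l, j) 1 : ι × ι →₀ ℕ) (v, u) = if v = l then 1 else 0 := by
      simp only [Finsupp.single_apply, Prod.mk.injEq, eq_comm (a := l)]
      split_ifs with h <;> simp [h]
    have hin : ∑ u, (Finsupp.single (l, j) 1 : ι × ι →₀ ℕ) (u, v) = if v = j then 1 else 0 := by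
      simp only [Finsupp.single_apply, Prod.mk.injEq, eq_comm (a := j)]
      split_ifs with h <;> simp [h]
    simp only [Finsupp.add_apply, Finset.sum_add_distrib, hout, hin]
    omega

theorem mem_iff_mem {S : Set ι} (h : EulerTrail i μ j)
    (hS : ∀ p, μ p ≠ 0 → (p.1 ∈ S ↔ p.2 ∈ S)) :
    (j ∈ S ↔ i ∈ S) ∧ ∀ p, μ p ≠ 0 → (p.1 ∈ S ↔ i ∈ S) := by
  classical
  induction h with
  | nil => simp
  | @snoc μ l j _ ih =>
    obtain ⟨hend, harcs⟩ := ih fun p hp => hS p (by rw [Finsupp.add_apply]; omega)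
    have hlast : l ∈ S ↔ j ∈ S := hS (l, j) (by simp)
    refine ⟨hlast.symm.trans hend, fun p hp => ?_⟩
    by_cases hp' : μ p = 0
    · rw [Finsupp.add_apply, hp', zero_add, Finsupp.single_apply] at hp
      obtain rfl : (l, j) = p := by simpa using hp
      exact hend
    · exact harcs p hp'

theorem exists_start (h : EulerTrail i μ j) (hμ : μ ≠ 0) : ∃ u, μ (i, u) ≠ 0 := by
  classical
  suffices (μ = 0 ∧ j = i) ∨ ∃ u, μ (i, u) ≠ 0 from this.resolve_left fun h => hμ h.1
  clear hμ
  induction h with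
  | nil => exact Or.inl ⟨rfl, rfl⟩
  | @snoc μ l j _ ih =>
    rcases ih with ⟨rfl, rfl⟩ | ⟨u, hu⟩
    · exact Or.inr ⟨j, by simp⟩
    · exact Or.inr ⟨u, by rw [Finsupp.add_apply]; omega⟩

end EulerTrail

section CompleteArcs

variable {ι : Type*} [DecidableEq ι]

/-- The arcs of the complete digraph without loops on `s`, each once. -/
noncomputable def completeArcs (s : Finset ι) : ι × ι →₀ ℕ :=
  ∑ i ∈ s, ∑ j ∈ s.erase i, Finsupp.single (i, j) 1

theorem completeArcs_insert {s : Finset ι} {v : ι} (hv : v ∉ s) :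
    completeArcs (insert v s) = completeArcs s +
      ∑ j ∈ s, (Finsupp.single (j, v) 1 + Finsupp.single (v, j) 1) := by
  have hrow : ∀ i ∈ s, ∑ j ∈ (insert v s).erase i, Finsupp.single (i, j) 1 =
      ∑ j ∈ s.erase i, Finsupp.single (i, j) 1 + (Finsupp.single (i, v) 1 : ι × ι →₀ ℕ) := by
    intro i hi
    have hne : v ≠ i := fun h => hv (h ▸ hi)
    rw [Finset.erase_insert_of_ne hne, Finset.sum_insert (by simp [hv]), add_comm]
  rw [completeArcs, Finset.sum_insert hv, Finset.erase_insert hv, Finset.sum_congr rfl hrow,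
    Finset.sum_add_distrib, Finset.sum_add_distrib, completeArcs]
  abel

theorem completeArcs_apply_ne_zero {s : Finset ι} {i j : ι}
    (hi : i ∈ s) (hj : j ∈ s) (hij : i ≠ j) : completeArcs s (i, j) ≠ 0 := by
  rw [completeArcs, Finsupp.finsetSum_apply]
  refine (Finset.sum_pos' (fun _ _ => Nat.zero_le _) ⟨i, hi, ?_⟩).ne'
  rw [Finsupp.finsetSum_apply]
  exact Finset.sum_pos' (fun _ _ => Nat.zero_le _) ⟨j, by simp [hj, hij.symm], by simp⟩

theorem degree_completeArcs (s : Finset ι) : (completeArcs s).degree = s.card * (s.card - 1) := by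
  rw [completeArcs, map_sum, Finset.sum_const_nat (m := s.card - 1)]
  intro i hi
  rw [map_sum, Finset.sum_congr rfl fun j _ => Finsupp.degree_single _ _]
  simp [Finset.card_erase_of_mem hi]

theorem eulerTrail_completeArcs {s : Finset ι} {r : ι} (hr : r ∈ s) :
    EulerTrail r (completeArcs s) r := by
  rw [← Finset.insert_erase hr]
  induction s.erase r using Finset.induction_on with
  | empty => simpa [completeArcs] using EulerTrail.nil (i := r)
  | insert v t _ ih =>
    rw [Finset.insert_comm]
    by_cases hvr : v ∈ insert r t
    · rwa [Finset.insert_eq_of_mem hvr]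
    rw [completeArcs_insert hvr]
    refine ih.insert_closed_sum _ (fun j => j) _ (fun j hj => ?_)
      fun j _ => (EulerTrail.arc j v).trans (EulerTrail.arc v j)
    refine or_iff_not_imp_left.mpr fun hjr => ⟨r, ?_⟩
    exact completeArcs_apply_ne_zero hj (Finset.mem_insert_self r t) hjr

end CompleteArcs

section WalkCount

theorem mapDomain_prodMap_apply_of_notMem_range {ι κ : Type*} {f : ι → κ} (μ : ι × ι →₀ ℕ) {l : κ}
    (hl : l ∉ Set.range f) (j : κ) : μ.mapDomain (Prod.map f f) (l, j) = 0 :=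
  Finsupp.mapDomain_of_notMem_range _ _ fun ⟨p, hp⟩ => hl ⟨p.1, congrArg Prod.fst hp⟩

variable {ι κ : Type*} [Fintype ι] [DecidableEq ι] [Fintype κ] [DecidableEq κ]

/-- The number of walks of length `N` from `i` to `j` that traverse every arc `p` exactly `μ p`
times, as a coefficient of the generating function of walks. -/
noncomputable def walkCount (N : ℕ) (i j : ι) (μ : ι × ι →₀ ℕ) : ℕ :=
  coeff μ ((Matrix.mvPolynomialX ι ι ℕ ^ N) i j)

theorem coeff_mvPolynomialX_pow (R : Type*) [CommSemiring R] (N : ℕ) (i j : ι) (μ : ι × ι →₀ ℕ) :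
    coeff μ ((Matrix.mvPolynomialX ι ι R ^ N) i j) = walkCount N i j μ := by
  have hX : Matrix.mvPolynomialX ι ι R =
      (Matrix.mvPolynomialX ι ι ℕ).map (MvPolynomial.map (Nat.castRingHom R)) := by
    ext1
    simp
  rw [hX, ← Matrix.map_pow, Matrix.map_apply, coeff_map]
  rfl

theorem walkCount_zero (i j : ι) (μ : ι × ι →₀ ℕ) :
    walkCount 0 i j μ = if i = j ∧ μ = 0 then 1 else 0 := by
  rw [walkCount, pow_zero, Matrix.one_apply]
  by_cases h : i = j
  · simp [h, coeff_one, eq_comm]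
  · simp [h]

theorem walkCount_succ (N : ℕ) (i j : ι) (μ : ι × ι →₀ ℕ) :
    walkCount (N + 1) i j μ = ∑ l, if (l, j) ∈ μ.support then
      walkCount N i l (μ - Finsupp.single (l, j) 1) else 0 := by
  rw [walkCount, pow_succ, Matrix.mul_apply, coeff_sum]
  refine Finset.sum_congr rfl fun l _ => ?_
  rw [Matrix.mvPolynomialX_apply, coeff_mul_X']
  rfl

theorem eulerTrail_of_walkCount_ne_zero {N : ℕ} {i j : ι} {μ : ι × ι →₀ ℕ}
    (h : walkCount N i j μ ≠ 0) : EulerTrail i μ j ∧ μ.degree = N := by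
  induction N generalizing j μ with
  | zero =>
    rw [walkCount_zero] at h
    obtain ⟨rfl, rfl⟩ : i = j ∧ μ = 0 := by simpa using h
    exact ⟨EulerTrail.nil, map_zero _⟩
  | succ N ih =>
    rw [walkCount_succ] at h
    obtain ⟨l, -, hl⟩ := Finset.exists_ne_zero_of_sum_ne_zero h
    obtain ⟨hlast, hinit⟩ : (l, j) ∈ μ.support ∧
        walkCount N i l (μ - Finsupp.single (l, j) 1) ≠ 0 := by
      simpa only [ne_eq, ite_eq_right_iff, Classical.not_imp] using hl
    obtain ⟨htrail, hdegree⟩ := ih hinit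
    have hμ := Finsupp.sub_add_single_one_cancel (Finsupp.mem_support_iff.mp hlast)
    refine ⟨hμ ▸ htrail.snoc j, ?_⟩
    rw [← hμ, map_add, hdegree, Finsupp.degree_single]

theorem walkCount_pos {i j : ι} {μ : ι × ι →₀ ℕ} (h : EulerTrail i μ j) :
    0 < walkCount μ.degree i j μ := by
  induction h with
  | nil => simp [walkCount_zero]
  | @snoc μ l j _ ih =>
    rw [map_add, Finsupp.degree_single, walkCount_succ]
    refine Finset.sum_pos' (fun _ _ => Nat.zero_le _) ⟨l, Finset.mem_univ _, ?_⟩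
    rwa [if_pos (by simp), add_tsub_cancel_right]

theorem walkCount_mapDomain {f : ι → κ} (hf : Function.Injective f) (N : ℕ) (i j : ι)
    (μ : ι × ι →₀ ℕ) :
    walkCount N (f i) (f j) (μ.mapDomain (Prod.map f f)) = walkCount N i j μ := by
  have hff : Function.Injective (Prod.map f f) := hf.prodMap hf
  induction N generalizing j μ with
  | zero =>
    rw [walkCount_zero, walkCount_zero]
    refine if_congr (and_congr hf.eq_iff ?_) rfl rfl
    rw [← Finsupp.mapDomain_zero (f := Prod.map f f), (Finsupp.mapDomain_injective hff).eq_iff]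
  | succ N ih =>
    rw [walkCount_succ, walkCount_succ]
    refine (Fintype.sum_of_injective f hf _ _ (fun l hl => ?_) fun l => ?_).symm
    · rw [if_neg (by simp [mapDomain_prodMap_apply_of_notMem_range μ hl])]
    have hmem : (f l, f j) ∈ (μ.mapDomain (Prod.map f f)).support ↔ (l, j) ∈ μ.support := by
      rw [Finsupp.mem_support_iff, Finsupp.mem_support_iff,
        show (f l, f j) = Prod.map f f (l, j) from rfl, Finsupp.mapDomain_apply hff]
    refine if_ctx_congr hmem.symm (fun h => ?_) fun _ => rfl
    conv_rhs => rw [← Finsupp.sub_add_single_one_cancel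
      (Finsupp.mem_support_iff.mp (hmem.mp h)), Finsupp.mapDomain_add, Finsupp.mapDomain_single,
      Prod.map_apply, add_tsub_cancel_right, ih]

/-- The number of closed walks of length `N` with a marked start that traverse every arc `p`
exactly `μ p` times. -/
noncomputable def closedWalkCount (N : ℕ) (μ : ι × ι →₀ ℕ) : ℕ := ∑ i, walkCount N i i μ

theorem coeff_trace_mvPolynomialX_pow (R : Type*) [CommSemiring R] (N : ℕ) (μ : ι × ι →₀ ℕ) :
    coeff μ (Matrix.trace (Matrix.mvPolynomialX ι ι R ^ N)) = closedWalkCount N μ := by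
  rw [Matrix.trace, coeff_sum, closedWalkCount, Nat.cast_sum]
  exact Finset.sum_congr rfl fun i _ => coeff_mvPolynomialX_pow R N i i μ

theorem closedWalkCount_pos {i : ι} {μ : ι × ι →₀ ℕ} {N : ℕ} (h : EulerTrail i μ i)
    (hN : μ.degree = N) : 0 < closedWalkCount N μ :=
  Finset.sum_pos' (fun _ _ => Nat.zero_le _) ⟨i, Finset.mem_univ _, hN ▸ walkCount_pos h⟩

theorem exists_eulerTrail {N : ℕ} {μ : ι × ι →₀ ℕ} (h : closedWalkCount N μ ≠ 0) :
    ∃ i, EulerTrail i μ i := by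
  obtain ⟨i, -, hi⟩ := Finset.exists_ne_zero_of_sum_ne_zero h
  exact ⟨i, (eulerTrail_of_walkCount_ne_zero hi).1⟩

theorem sum_out_eq_sum_in {N : ℕ} {μ : ι × ι →₀ ℕ} (h : closedWalkCount N μ ≠ 0) (v : ι) :
    ∑ u, μ (v, u) = ∑ u, μ (u, v) := by
  obtain ⟨i, hi⟩ := exists_eulerTrail h
  exact Nat.add_right_cancel (hi.balanced v)

theorem mem_iff_mem_of_closedWalkCount_ne_zero {N : ℕ} {μ : ι × ι →₀ ℕ}
    (h : closedWalkCount N μ ≠ 0) {S : Set ι} (hS : ∀ p, μ p ≠ 0 → (p.1 ∈ S ↔ p.2 ∈ S))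
    {p q : ι × ι} (hp : μ p ≠ 0) (hq : μ q ≠ 0) : p.1 ∈ S ↔ q.1 ∈ S := by
  obtain ⟨i, hi⟩ := exists_eulerTrail h
  rw [(hi.mem_iff_mem hS).2 p hp, (hi.mem_iff_mem hS).2 q hq]

theorem closedWalkCount_mapDomain {f : ι → κ} (hf : Function.Injective f) {N : ℕ} (hN : N ≠ 0)
    (μ : ι × ι →₀ ℕ) : closedWalkCount N (μ.mapDomain (Prod.map f f)) = closedWalkCount N μ := by
  refine (Fintype.sum_of_injective f hf _ _ (fun i hi => ?_)
    fun i => (walkCount_mapDomain hf N i i μ).symm).symm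
  by_contra h
  obtain ⟨htrail, rfl⟩ := eulerTrail_of_walkCount_ne_zero h
  obtain ⟨u, hu⟩ := htrail.exists_start fun h0 => hN (by simp [h0])
  exact hu (mapDomain_prodMap_apply_of_notMem_range μ hi u)

end WalkCount

section RowTerms

variable {V E : Type*} [DecidableEq V]

/-- The row polynomial of a vertex `i` has one term for the loops at `i` (`none`) and one for every
hyperedge through `i`. These are the arcs of that term: `k - 1` loops at `i`, or one arc from `i` to
each other element of the hyperedge. -/
noncomputable def rowTermArcs (k : ℕ) (edge : E → Finset V) : V × Option E → (V × V →₀ ℕ)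
  | (i, none) => Finsupp.single (i, i) (k - 1)
  | (i, some e) => ∑ j ∈ (edge e).erase i, Finsupp.single (i, j) 1

/-- The coefficient of a row term: `x i` for the loops at `i`, and `y` for a hyperedge through
`i`. -/
noncomputable def rowTermWeight (edge : E → Finset V) (x : V → ℝ) (y : ℝ) : V × Option E → ℝ
  | (i, none) => x i
  | (i, some e) => if i ∈ edge e then y else 0

variable [Fintype V] [Fintype E]

/-- A configuration `n` takes every row term `p` with multiplicity `n p`. These are its arcs. -/
noncomputable def configArcs (k : ℕ) (edge : E → Finset V) (n : V × Option E → ℕ) : V × V →₀ ℕ :=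
  ∑ p, n p • rowTermArcs k edge p

/-- The coefficient with which a configuration contributes to the trace. -/
noncomputable def configCoeff (k : ℕ) (edge : E → Finset V) (n : V × Option E → ℕ) : ℝ :=
  (∏ i, ((∑ o, n (i, o)).factorial : ℝ) / (((∑ o, n (i, o)) * (k - 1)).factorial : ℝ)) *
    (∏ p, 1 / ((n p).factorial : ℝ)) *
      (expFactorial (configArcs k edge n) *
        closedWalkCount ((∑ p, n p) * (k - 1)) (configArcs k edge n))

/-- The contribution of a configuration to the trace. -/
noncomputable def configTerm (k : ℕ) (edge : E → Finset V) (x : V → ℝ) (y : ℝ)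
    (n : V × Option E → ℕ) : ℝ :=
  configCoeff k edge n * ∏ p, rowTermWeight edge x y p ^ n p

end RowTerms

section PowerOfSum

variable {R σ κ : Type*}

theorem prod_monomial [CommSemiring R] (s : Finset κ) (f : κ → σ →₀ ℕ) (g : κ → R) :
    ∏ i ∈ s, monomial (f i) (g i) = monomial (∑ i ∈ s, f i) (∏ i ∈ s, g i) := by
  classical
  induction s using Finset.induction_on with
  | empty => simp
  | insert i s hi ih =>
    rw [Finset.prod_insert hi, ih, monomial_mul, Finset.sum_insert hi, Finset.prod_insert hi]

theorem multinomial_eq_factorial_mul_prod [Field R] [CharZero R] (s : Finset κ) (m : κ → ℕ) :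
    (Nat.multinomial s m : R) =
      (∑ o ∈ s, m o).factorial * ∏ o ∈ s, 1 / ((m o).factorial : R) := by
  have hne : ∏ o ∈ s, ((m o).factorial : R) ≠ 0 :=
    Finset.prod_ne_zero_iff.mpr fun o _ => by exact_mod_cast (m o).factorial_ne_zero
  rw [← Nat.multinomial_spec, Finset.prod_div_distrib, Finset.prod_const_one]
  push_cast
  field_simp

theorem sum_monomial_pow [Field R] [CharZero R] [Fintype κ] [DecidableEq κ]
    (f : κ → σ →₀ ℕ) (w : κ → R) (c : ℕ) :
    (∑ o, monomial (f o) (w o)) ^ c = ∑ m ∈ Finset.piAntidiag Finset.univ c,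
      monomial (∑ o, m o • f o)
        ((c.factorial * ∏ o, 1 / ((m o).factorial : R)) * ∏ o, w o ^ m o) := by
  rw [Finset.sum_pow_eq_sum_piAntidiag]
  refine Finset.sum_congr rfl fun m hm => ?_
  simp only [monomial_pow]
  rw [prod_monomial, ← map_natCast (C (R := R) (σ := σ)), C_mul_monomial,
    multinomial_eq_factorial_mul_prod, (Finset.mem_piAntidiag.mp hm).1]

end PowerOfSum

section TraceExpansion

variable {V E : Type*} [Fintype V] [DecidableEq V]

theorem sum_piAntidiag_piFinset_piAntidiag {ι κ M : Type*} [Fintype ι] [DecidableEq ι] [Fintype κ]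
    [DecidableEq κ] [AddCommMonoid M] (d : ℕ) (f : (ι × κ → ℕ) → M) :
    ∑ c ∈ Finset.piAntidiag (Finset.univ : Finset ι) d,
        ∑ n ∈ Fintype.piFinset fun i => Finset.piAntidiag (Finset.univ : Finset κ) (c i),
          f (Function.uncurry n) =
      ∑ n ∈ Finset.piAntidiag (Finset.univ : Finset (ι × κ)) d, f n := by
  rw [Finset.sum_sigma']
  refine Finset.sum_nbij' (fun a => Function.uncurry a.2)
    (fun n => ⟨fun i => ∑ o, n (i, o), Function.curry n⟩) ?_ ?_ ?_ (fun _ _ => rfl)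
    fun _ _ => rfl
  · rintro ⟨c, n⟩ h
    obtain ⟨hc, hn⟩ : ∑ i, c i = d ∧ ∀ i, ∑ o, n i o = c i := by
      simpa using h
    simp [Fintype.sum_prod_type, hn, hc]
  · intro n h
    have hd : ∑ i, ∑ o, n (i, o) = d := by
      simpa only [Finset.mem_piAntidiag, Fintype.sum_prod_type, Finset.mem_univ, implies_true,
        and_true] using h
    simp only [Finset.mem_sigma, Finset.mem_piAntidiag, Fintype.mem_piFinset, Finset.mem_univ,
      implies_true, and_true]
    exact ⟨hd, fun _ => rfl⟩
  · rintro ⟨c, n⟩ h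
    simp only [Finset.mem_sigma, Finset.mem_piAntidiag, Fintype.mem_piFinset] at h
    have hc : (fun i => ∑ o, n i o) = c := funext fun i => (h.2 i).1
    simp only [Function.uncurry_apply_pair, hc, Function.curry_uncurry]

variable [Fintype E] [DecidableEq E]

theorem prod_rowPoly_pow_eq_sum_monomial {k : ℕ} {A : HTensor k V} {edge : E → Finset V}
    {x : V → ℝ} {y : ℝ}
    (hA : ∀ i, rowPoly A i =
      ∑ o, monomial (rowTermArcs k edge (i, o)) (rowTermWeight edge x y (i, o))) (c : V → ℕ) :
    ∏ i, (1 / ((c i * (k - 1)).factorial : ℝ)) • rowPoly A i ^ c i =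
      ∑ n ∈ Fintype.piFinset fun i => Finset.piAntidiag (Finset.univ : Finset (Option E)) (c i),
        monomial (configArcs k edge (Function.uncurry n))
          ((∏ i, ((∑ o, n i o).factorial : ℝ) / (((∑ o, n i o) * (k - 1)).factorial : ℝ)) *
            (∏ p, 1 / ((Function.uncurry n p).factorial : ℝ)) *
              ∏ p, rowTermWeight edge x y p ^ Function.uncurry n p) := by
  simp only [hA, sum_monomial_pow, Finset.smul_sum, smul_monomial, smul_eq_mul]
  rw [Finset.prod_univ_sum]
  refine Finset.sum_congr rfl fun n hn => ?_
  rw [prod_monomial]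
  congr 1
  · rw [configArcs, Fintype.sum_prod_type]
    rfl
  · rw [Fintype.prod_prod_type, Fintype.prod_prod_type, ← Finset.prod_mul_distrib,
      ← Finset.prod_mul_distrib]
    refine Finset.prod_congr rfl fun i _ => ?_
    rw [(Finset.mem_piAntidiag.mp (Fintype.mem_piFinset.mp hn i)).1]
    simp only [Function.uncurry_apply_pair]
    ring

theorem trace_eq_sum_configTerm {k : ℕ} {A : HTensor k V} {edge : E → Finset V} {x : V → ℝ}
    {y : ℝ} (hA : ∀ i, rowPoly A i =
      ∑ o, monomial (rowTermArcs k edge (i, o)) (rowTermWeight edge x y (i, o))) (d : ℕ) :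
    A.trace d = ((k : ℝ) - 1) ^ (Fintype.card V - 1) *
      ∑ n ∈ Finset.piAntidiag Finset.univ d, configTerm k edge x y n := by
  rw [trace_eq_sum_apolarPairing, ← sum_piAntidiag_piFinset_piAntidiag]
  congr 1
  refine Finset.sum_congr rfl fun c hc => ?_
  rw [prod_rowPoly_pow_eq_sum_monomial hA, map_sum, LinearMap.sum_apply]
  refine Finset.sum_congr rfl fun n hn => ?_
  have hd : ∑ p, Function.uncurry n p = d := by
    rw [Fintype.sum_prod_type, ← (Finset.mem_piAntidiag.mp hc).1]
    exact Finset.sum_congr rfl fun i _ =>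
      (Finset.mem_piAntidiag.mp (Fintype.mem_piFinset.mp hn i)).1
  rw [apolarPairing_monomial, coeff_trace_mvPolynomialX_pow, configTerm, configCoeff, hd]
  simp only [Function.uncurry_apply_pair]
  ring

end TraceExpansion

section EdgeVerts

variable {U : Type*} [Finite U] {H : Hypergraph U}

/-- The vertices of a hyperedge, as a finset of `H.vertexSet`. -/
noncomputable def edgeVerts (H : Hypergraph U) (e : ↥H.edgeSet) : Finset ↥H.vertexSet :=
  (Set.toFinite {v : ↥H.vertexSet | (v : U) ∈ (e : Set U)}).toFinset

@[simp]
theorem mem_edgeVerts {e : ↥H.edgeSet} {v : ↥H.vertexSet} :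
    v ∈ edgeVerts H e ↔ (v : U) ∈ (e : Set U) := by
  simp [edgeVerts]

theorem image_edgeVerts (e : ↥H.edgeSet) :
    Subtype.val '' (edgeVerts H e : Set ↥H.vertexSet) = (e : Set U) := by
  ext u
  simp only [Set.mem_image, Finset.mem_coe, mem_edgeVerts]
  exact ⟨fun ⟨_, hv, h⟩ => h ▸ hv,
    fun hu => ⟨⟨u, H.subset_vertexSet_of_mem_edgeSet e.2 hu⟩, hu, rfl⟩⟩

theorem edgeVerts_injective : Function.Injective (edgeVerts H) := by
  intro e e' h
  rw [Subtype.ext_iff, ← image_edgeVerts, h, image_edgeVerts]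

theorem card_edgeVerts {k : ℕ} (h : H.IsUniform k) (e : ↥H.edgeSet) : (edgeVerts H e).card = k := by
  have hencard := h e e.2
  rw [← image_edgeVerts, Subtype.val_injective.encard_image,
    Set.encard_coe_eq_coe_finsetCard] at hencard
  exact_mod_cast hencard

theorem insert_range_eq_iff [DecidableEq ↥H.vertexSet] {n : ℕ} (i : ↥H.vertexSet)
    (β : Fin n → ↥H.vertexSet) (e : ↥H.edgeSet) :
    insert (i : U) (Set.range fun t => (β t : U)) = e ↔
      insert i (Finset.univ.image β) = edgeVerts H e := by
  rw [← image_edgeVerts, ← Finset.coe_inj, ← Subtype.val_injective.image_injective.eq_iff,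
    Finset.coe_insert, Set.image_insert_eq, Finset.coe_image, Finset.coe_univ, Set.image_univ,
    ← Set.range_comp]
  rfl

theorem exists_equiv_of_subset_image {V : Type*} [DecidableEq V] {s : Finset V} {n : ℕ}
    (hs : s.card = n) {β : Fin n → V} (h : s ⊆ Finset.univ.image β) :
    ∃ f : Fin n ≃ ↥s, ∀ t, (f t : V) = β t := by
  have himage : s = Finset.univ.image β :=
    Finset.eq_of_subset_of_card_le h (Finset.card_image_le.trans (by simp [hs]))
  have hinj : Function.Injective β := by
    rw [← Set.injOn_univ, ← Finset.coe_univ, ← Finset.card_image_iff, ← himage, hs]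
    simp
  have hmem : ∀ t, β t ∈ s := fun t => himage ▸ Finset.mem_image_of_mem β (Finset.mem_univ t)
  have hbij : Function.Bijective fun t => (⟨β t, hmem t⟩ : ↥s) :=
    (Fintype.bijective_iff_injective_and_card _).mpr
      ⟨fun t t' h => hinj (congrArg Subtype.val h), by rw [Fintype.card_coe, hs, Fintype.card_fin]⟩
  exact ⟨Equiv.ofBijective _ hbij, fun _ => rfl⟩

theorem sum_filter_insert_image_eq {V M : Type*} [Fintype V] [DecidableEq V] [AddCommMonoid M]
    {s : Finset V} {n : ℕ} {i : V} (hi : i ∈ s) (hs : (s.erase i).card = n)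
    (f : (Fin n → V) → M) :
    ∑ β : Fin n → V with insert i (Finset.univ.image β) = s, f β =
      ∑ g : Fin n ≃ ↥(s.erase i), f fun t => g t := by
  symm
  refine Finset.sum_bij (fun g _ => fun t => (g t : V)) (fun g _ => ?_) (fun g _ g' _ h => ?_)
    (fun β hβ => ?_) fun _ _ => rfl
  · have himage : Finset.univ.image (fun t => (g t : V)) = s.erase i := by
      ext
      simp only [Finset.mem_image, Finset.mem_univ, true_and]
      exact ⟨fun ⟨t, ht⟩ => ht ▸ (g t).2, fun hv => ⟨g.symm ⟨_, hv⟩, by simp⟩⟩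
    rw [Finset.mem_filter, himage, Finset.insert_erase hi]
    exact ⟨Finset.mem_univ _, rfl⟩
  · ext t
    exact congrFun h t
  · have hsub : s.erase i ⊆ Finset.univ.image β := by
      rw [← (Finset.mem_filter.mp hβ).2]
      exact Finset.erase_insert_subset i _
    obtain ⟨g, hg⟩ := exists_equiv_of_subset_image hs hsub
    exact ⟨g, Finset.mem_univ _, funext hg⟩

theorem sum_filter_insert_image_eq_prod_X {R V : Type*} [CommSemiring R] [Fintype V]
    [DecidableEq V] {s : Finset V} {n : ℕ} {i : V} (hi : i ∈ s) (hs : (s.erase i).card = n) :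
    ∑ β : Fin n → V with insert i (Finset.univ.image β) = s,
        ∏ t, (X (i, β t) : MvPolynomial (V × V) R) =
      monomial (∑ j ∈ s.erase i, Finsupp.single (i, j) 1) (n.factorial : R) := by
  have hcard : Fintype.card (Fin n ≃ ↥(s.erase i)) = n.factorial := by
    rw [Fintype.card_equiv (Fintype.equivOfCardEq (by
      rw [Fintype.card_coe, hs, Fintype.card_fin])), Fintype.card_fin]
  have hprod : ∀ g : Fin n ≃ ↥(s.erase i), ∏ t, (X (i, (g t : V)) : MvPolynomial (V × V) R) =
      monomial (∑ j ∈ s.erase i, Finsupp.single (i, j) 1) 1 := by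
    intro g
    simp only [X]
    rw [prod_monomial, g.sum_comp fun j : ↥(s.erase i) =>
      (Finsupp.single (i, (j : V)) 1 : V × V →₀ ℕ), Finset.prod_const_one,
      Finset.sum_coe_sort (s.erase i) fun j => (Finsupp.single (i, j) 1 : V × V →₀ ℕ)]
  rw [sum_filter_insert_image_eq hi hs, Finset.sum_congr rfl fun g _ => hprod g, Finset.sum_const,
    Finset.card_univ, hcard, ← map_nsmul, nsmul_one]

theorem alphaTensor_apply {k : ℕ} (a : ℝ) [DecidableEq ↥H.vertexSet] [Fintype ↥H.edgeSet]
    (i : ↥H.vertexSet) (β : Fin (k - 1) → ↥H.vertexSet) :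
    H.alphaTensor k a i β = (if β = fun _ => i then a * H.degree i else 0) +
      ∑ e, if insert i (Finset.univ.image β) = edgeVerts H e then
        (1 - a) / ((k - 1).factorial : ℝ) else 0 := by
  simp only [alphaTensor, degreeTensor, adjacencyTensor, Pi.add_apply, Pi.smul_apply, smul_eq_mul]
  congr 1
  · simp [funext_iff]
  by_cases h : insert (i : U) (Set.range fun t => (β t : U)) ∈ H.edgeSet
  · rw [if_pos h, Finset.sum_eq_single ⟨_, h⟩]
    · rw [if_pos ((insert_range_eq_iff i β ⟨_, h⟩).mp rfl)]
      ring
    · intro e _ he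
      exact if_neg fun h' => he (Subtype.ext ((insert_range_eq_iff i β e).mpr h').symm)
    · simp
  · rw [if_neg h, mul_zero, Finset.sum_eq_zero]
    intro e _
    exact if_neg fun h' => h (((insert_range_eq_iff i β e).mpr h') ▸ e.2)

variable [Fintype ↥H.vertexSet] [DecidableEq ↥H.vertexSet] {k : ℕ}

theorem sum_edge_smul_prod_X_eq_monomial (hH : H.IsUniform k) (x : ↥H.vertexSet → ℝ) (y : ℝ)
    (i : ↥H.vertexSet) (e : ↥H.edgeSet) :
    ∑ β : Fin (k - 1) → ↥H.vertexSet, (if insert i (Finset.univ.image β) = edgeVerts H e then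
        y / ((k - 1).factorial : ℝ) else 0) • ∏ t, X (i, β t) =
      monomial (rowTermArcs k (edgeVerts H) (i, some e))
        (rowTermWeight (edgeVerts H) x y (i, some e)) := by
  simp only [ite_smul, zero_smul, ← Finset.sum_filter, ← Finset.smul_sum]
  by_cases hi : i ∈ edgeVerts H e
  · have hcard : ((edgeVerts H e).erase i).card = k - 1 := by
      rw [Finset.card_erase_of_mem hi, card_edgeVerts hH]
    rw [sum_filter_insert_image_eq_prod_X hi hcard, smul_monomial, smul_eq_mul,
      div_mul_cancel₀ _ (by positivity)]
    simp only [rowTermArcs, rowTermWeight, if_pos hi]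
  · have hne : ∀ β : Fin (k - 1) → ↥H.vertexSet,
        insert i (Finset.univ.image β) ≠ edgeVerts H e :=
      fun β h => hi (h ▸ Finset.mem_insert_self _ _)
    rw [Finset.filter_false_of_mem fun β _ => hne β]
    simp [rowTermWeight, hi]

variable [Fintype ↥H.edgeSet]

theorem rowPoly_alphaTensor (hH : H.IsUniform k) (a : ℝ) (i : ↥H.vertexSet) :
    rowPoly (H.alphaTensor k a) i = ∑ o, monomial (rowTermArcs k (edgeVerts H) (i, o))
      (rowTermWeight (edgeVerts H) (fun v => a * H.degree v) (1 - a) (i, o)) := by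
  simp only [rowPoly, alphaTensor_apply, add_smul, Finset.sum_smul, Finset.sum_add_distrib]
  rw [Finset.sum_comm, Fintype.sum_option,
    Finset.sum_congr rfl fun e _ => sum_edge_smul_prod_X_eq_monomial hH _ _ i e]
  congr 1
  simp only [ite_smul, zero_smul, Finset.sum_ite_eq', Finset.mem_univ, if_true, rowTermArcs,
    rowTermWeight, Finset.prod_const, Finset.card_univ, Fintype.card_fin, X, monomial_pow,
    smul_monomial]
  simp

theorem alphaMoment_eq_sum_configTerm [DecidableEq ↥H.edgeSet] (hH : H.IsUniform k) (a : ℝ)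
    (d : ℕ) :
    H.alphaMoment k a d = ((k : ℝ) - 1) ^ (Fintype.card ↥H.vertexSet - 1) *
      ∑ n ∈ Finset.piAntidiag Finset.univ d,
        configTerm k (edgeVerts H) (fun v => a * H.degree v) (1 - a) n := by
  rw [← trace_eq_sum_configTerm (rowPoly_alphaTensor hH a), alphaMoment]
  congr
  · exact Subsingleton.elim _ _
  · exact Subsingleton.elim _ _

end EdgeVerts

/-- A family of finite sets is flow-free if no nonzero integer weighting of its incidences has sum
zero on every set and at every point. The edges of a hypertree have this property. -/
def IsFlowFree {V E : Type*} [Fintype V] [Fintype E] (edge : E → Finset V) : Prop :=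
  ∀ x : V → E → ℤ, (∀ v e, v ∉ edge e → x v e = 0) → (∀ e, ∑ v, x v e = 0) →
    (∀ v, ∑ e, x v e = 0) → ∀ v e, x v e = 0

/-- The hyperedges that occur in a configuration. -/
def configEdges {V E : Type*} [Fintype V] [Fintype E] (n : V × Option E → ℕ) : Finset E :=
  Finset.univ.filter fun e => ∃ i, n (i, some e) ≠ 0

theorem mem_configEdges {V E : Type*} [Fintype V] [Fintype E] {n : V × Option E → ℕ} {e : E} :
    e ∈ configEdges n ↔ ∃ i, n (i, some e) ≠ 0 := by
  simp [configEdges]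

section Configurations

variable {V E : Type*} [DecidableEq V] {k : ℕ} {edge : E → Finset V} {x : V → ℝ} {y : ℝ}

theorem rowTermArcs_some_apply (i : V) (e : E) (u v : V) :
    rowTermArcs k edge (i, some e) (u, v) = if u = i ∧ v ∈ edge e ∧ v ≠ u then 1 else 0 := by
  simp only [rowTermArcs, Finsupp.finsetSum_apply, Finsupp.single_apply, Prod.mk.injEq]
  by_cases h : i = u
  · subst h
    simp [and_comm]
  · simp [h, Ne.symm h]

variable [Fintype V] [Fintype E] {n : V × Option E → ℕ}

theorem configArcs_apply (n : V × Option E → ℕ) (u v : V) :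
    configArcs k edge n (u, v) = (if u = v then n (u, none) * (k - 1) else 0) +
      ∑ e, if v ∈ edge e ∧ v ≠ u then n (u, some e) else 0 := by
  simp only [configArcs, Finsupp.finsetSum_apply, Finsupp.smul_apply, smul_eq_mul]
  rw [Fintype.sum_prod_type, Finset.sum_eq_single u]
  · rw [Fintype.sum_option]
    congr 1
    · by_cases h : u = v
      · subst h
        simp [rowTermArcs]
      · simp [rowTermArcs, h]
    · refine Finset.sum_congr rfl fun e _ => ?_
      simp [rowTermArcs_some_apply]
  · intro i _ hi
    refine Finset.sum_eq_zero fun o _ => ?_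
    rcases o with _ | e
    · simp [rowTermArcs, hi]
    · simp [rowTermArcs_some_apply, hi.symm]
  · simp

theorem configCoeff_nonneg (n : V × Option E → ℕ) : 0 ≤ configCoeff k edge n := by
  rw [configCoeff]
  positivity

theorem configCoeff_pos {i : V} (h : EulerTrail i (configArcs k edge n) i)
    (hd : (configArcs k edge n).degree = (∑ p, n p) * (k - 1)) : 0 < configCoeff k edge n := by
  have hwalks := closedWalkCount_pos h hd
  have hexp := expFactorial_pos (configArcs k edge n)
  have hrows : 0 < ∏ i, ((∑ o, n (i, o)).factorial : ℝ) /
      (((∑ o, n (i, o)) * (k - 1)).factorial : ℝ) := Finset.prod_pos fun i _ => by positivity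
  have hterms : 0 < ∏ p, 1 / ((n p).factorial : ℝ) := Finset.prod_pos fun i _ => by positivity
  exact mul_pos (mul_pos hrows hterms) (by exact_mod_cast mul_pos hexp hwalks)

theorem closedWalkCount_ne_zero (h : configCoeff k edge n ≠ 0) :
    closedWalkCount ((∑ p, n p) * (k - 1)) (configArcs k edge n) ≠ 0 :=
  Nat.cast_ne_zero.mp (right_ne_zero_of_mul (right_ne_zero_of_mul h))

theorem mem_edge_of_configTerm_ne_zero (h : configTerm k edge x y n ≠ 0) {i : V} {e : E}
    (hn : n (i, some e) ≠ 0) : i ∈ edge e := by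
  by_contra hi
  refine right_ne_zero_of_mul h (Finset.prod_eq_zero (Finset.mem_univ (i, some e)) ?_)
  rw [rowTermWeight, if_neg hi, zero_pow hn]

theorem sum_configArcs_out (hcard : ∀ e, (edge e).card = k)
    (hn : ∀ i e, i ∉ edge e → n (i, some e) = 0) (v : V) :
    ∑ u, configArcs k edge n (v, u) = n (v, none) * (k - 1) + ∑ e, (k - 1) * n (v, some e) := by
  simp only [configArcs_apply, Finset.sum_add_distrib, Finset.sum_ite_eq, Finset.mem_univ, if_true]
  rw [Finset.sum_comm]
  congr 1
  refine Finset.sum_congr rfl fun e _ => ?_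
  by_cases hv : v ∈ edge e
  · have hfilter : Finset.univ.filter (fun u => u ∈ edge e ∧ u ≠ v) = (edge e).erase v := by
      ext
      simp [and_comm]
    rw [← Finset.sum_filter, hfilter, Finset.sum_const, smul_eq_mul, Finset.card_erase_of_mem hv,
      hcard]
  · simp [hn v e hv]

theorem sum_configArcs_in (n : V × Option E → ℕ) (v : V) :
    ∑ u, configArcs k edge n (u, v) = n (v, none) * (k - 1) +
      ∑ e, if v ∈ edge e then ∑ u ∈ Finset.univ.erase v, n (u, some e) else 0 := by
  simp only [configArcs_apply, Finset.sum_add_distrib, Finset.sum_ite_eq', Finset.mem_univ, if_true]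
  rw [Finset.sum_comm]
  congr 1
  refine Finset.sum_congr rfl fun e _ => ?_
  split_ifs with hv
  · simp only [hv, true_and]
    rw [← Finset.sum_filter, Finset.filter_ne]
  · simp [hv]

/-- The deviations of the multiplicities from their mean on an edge form a flow, because closed
walks enter and leave every vertex equally often. -/
theorem sum_eq_mul_of_configTerm_ne_zero (hcard : ∀ e, (edge e).card = k)
    (hflow : IsFlowFree edge) (h : configTerm k edge x y n ≠ 0) {v : V} {e : E}
    (hv : v ∈ edge e) : ∑ i, n (i, some e) = k * n (v, some e) := by
  have hk : 1 ≤ k := hcard e ▸ Finset.card_pos.mpr ⟨v, hv⟩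
  have hmem : ∀ i e, i ∉ edge e → n (i, some e) = 0 := fun i e =>
    not_imp_comm.mp (mem_edge_of_configTerm_ne_zero h)
  have hbalanced : ∀ v, ∑ e, (k - 1) * n (v, some e) =
      ∑ e, if v ∈ edge e then ∑ u ∈ Finset.univ.erase v, n (u, some e) else 0 := by
    intro v
    have hout := sum_out_eq_sum_in (closedWalkCount_ne_zero (left_ne_zero_of_mul h)) v
    rwa [sum_configArcs_out hcard hmem, sum_configArcs_in, add_right_inj] at hout
  have hzero := hflow (fun v e => if v ∈ edge e then
    (∑ i, n (i, some e) : ℤ) - k * n (v, some e) else 0)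
    (fun v e hv => if_neg hv) (fun e => ?_) (fun v => ?_) v e
  · simp only [if_pos hv] at hzero
    zify
    linarith
  · have hsum : ∑ i ∈ edge e, (n (i, some e) : ℤ) = ∑ i, (n (i, some e) : ℤ) :=
      Finset.sum_subset (Finset.subset_univ _) fun i _ hi => by rw [hmem i e hi, Nat.cast_zero]
    rw [← Finset.sum_filter, Finset.sum_sub_distrib, ← Finset.mul_sum, Finset.sum_const,
      Finset.filter_mem_eq_inter, Finset.univ_inter, hcard, nsmul_eq_mul, hsum, sub_self]
  · have hdiff : ∀ e, (if v ∈ edge e then (∑ i, n (i, some e) : ℤ) - k * n (v, some e) else 0) =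
        ((if v ∈ edge e then ∑ u ∈ Finset.univ.erase v, n (u, some e) else 0 : ℕ) : ℤ) -
          (((k - 1) * n (v, some e) : ℕ) : ℤ) := by
      intro e
      split_ifs with hv
      · rw [← Finset.add_sum_erase Finset.univ _ (Finset.mem_univ v), Nat.cast_mul,
          Nat.cast_sub hk]
        push_cast
        ring
      · simp [hmem v e hv]
    rw [Finset.sum_congr rfl fun e _ => hdiff e, Finset.sum_sub_distrib, ← Nat.cast_sum,
      ← Nat.cast_sum, hbalanced, sub_self]

theorem sum_loops_add_le (hcard : ∀ e, (edge e).card = k) (hflow : IsFlowFree edge)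
    (h : configTerm k edge x y n ≠ 0) :
    ∑ v, n (v, none) + k * (configEdges n).card ≤ ∑ p, n p := by
  rw [Fintype.sum_prod_type]
  simp only [Fintype.sum_option, Finset.sum_add_distrib]
  rw [Finset.sum_comm (γ := V)]
  refine Nat.add_le_add_left ?_ _
  rw [mul_comm, ← smul_eq_mul, ← Finset.sum_const]
  refine (Finset.sum_le_sum fun e he => ?_).trans
    (Finset.sum_le_univ_sum_of_nonneg fun _ => Nat.zero_le _)
  obtain ⟨i, hi⟩ := mem_configEdges.mp he
  rw [sum_eq_mul_of_configTerm_ne_zero hcard hflow h (mem_edge_of_configTerm_ne_zero h hi)]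
  exact Nat.le_mul_of_pos_right _ (Nat.pos_of_ne_zero hi)

theorem exists_configArcs_ne_zero (hk : 2 ≤ k) (hcard : ∀ e, (edge e).card = k)
    {p : V × Option E} (hp : n p ≠ 0) : ∃ u, configArcs k edge n (p.1, u) ≠ 0 := by
  obtain ⟨i, _ | e⟩ := p
  · refine ⟨i, ?_⟩
    have hloops : n (i, none) * (k - 1) ≠ 0 := Nat.mul_ne_zero hp (by omega)
    change configArcs k edge n (i, i) ≠ 0
    rw [configArcs_apply, if_pos rfl]
    omega
  · obtain ⟨u, hu, hui⟩ := Finset.exists_mem_ne (s := edge e) (by rw [hcard]; omega) i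
    refine ⟨u, ?_⟩
    have hle : n (i, some e) ≤ ∑ e, if u ∈ edge e ∧ u ≠ i then n (i, some e) else 0 := by
      refine le_trans ?_ (Finset.single_le_sum (f := fun e => if u ∈ edge e ∧ u ≠ i then
        n (i, some e) else 0) (fun _ _ => Nat.zero_le _) (Finset.mem_univ e))
      simp [hu, hui]
    change configArcs k edge n (i, u) ≠ 0
    rw [configArcs_apply]
    omega

theorem mem_iff_mem_of_configTerm_ne_zero (hk : 2 ≤ k) (hcard : ∀ e, (edge e).card = k)
    (h : configTerm k edge x y n ≠ 0) (S : Set V)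
    (hS : ∀ e ∈ configEdges n, ∀ u ∈ edge e, ∀ v ∈ edge e, u ∈ S → v ∈ S) {p q : V × Option E}
    (hp : n p ≠ 0) (hq : n q ≠ 0) : p.1 ∈ S ↔ q.1 ∈ S := by
  obtain ⟨u, hu⟩ := exists_configArcs_ne_zero hk hcard hp
  obtain ⟨v, hv⟩ := exists_configArcs_ne_zero hk hcard hq
  refine mem_iff_mem_of_closedWalkCount_ne_zero (closedWalkCount_ne_zero (left_ne_zero_of_mul h))
    (S := S) ?_ hu hv
  rintro ⟨i, j⟩ hij
  rw [configArcs_apply] at hij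
  by_cases hloop : i = j
  · rw [hloop]
  rw [if_neg hloop, zero_add] at hij
  obtain ⟨e, -, he⟩ := Finset.exists_ne_zero_of_sum_ne_zero hij
  obtain ⟨⟨hj, -⟩, hne⟩ : (j ∈ edge e ∧ j ≠ i) ∧ n (i, some e) ≠ 0 := by
    simpa only [ne_eq, ite_eq_right_iff, Classical.not_imp] using he
  have he' : e ∈ configEdges n := mem_configEdges.mpr ⟨i, hne⟩
  have hi := mem_edge_of_configTerm_ne_zero h hne
  exact ⟨hS e he' i hi j hj, hS e he' j hj i hi⟩

end Configurations

section Extend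

variable {V E V₀ E₀ : Type*} {f : V₀ → V} {g : E₀ → E}

/-- The configuration on `V` and `E` that an injection of a substructure on `V₀` and `E₀` makes out
of a configuration of the substructure. -/
noncomputable def configExtend (f : V₀ → V) (g : E₀ → E) (n : V₀ × Option E₀ → ℕ) :
    V × Option E → ℕ :=
  Function.extend (Prod.map f (Option.map g)) n 0

theorem injective_prodMap_optionMap (hf : Function.Injective f) (hg : Function.Injective g) :
    Function.Injective (Prod.map f (Option.map g)) :=
  hf.prodMap (Option.map_injective hg)

theorem configExtend_apply (hf : Function.Injective f) (hg : Function.Injective g)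
    (n : V₀ × Option E₀ → ℕ) (p : V₀ × Option E₀) :
    configExtend f g n (Prod.map f (Option.map g) p) = n p :=
  (injective_prodMap_optionMap hf hg).extend_apply _ _ _

theorem configExtend_apply_of_notMem (n : V₀ × Option E₀ → ℕ) {p : V × Option E}
    (hp : p ∉ Set.range (Prod.map f (Option.map g))) : configExtend f g n p = 0 :=
  Function.extend_apply' _ _ _ hp

theorem configExtend_comp (hf : Function.Injective f) (hg : Function.Injective g)
    {n : V × Option E → ℕ} (hn : ∀ p, n p ≠ 0 → p ∈ Set.range (Prod.map f (Option.map g))) :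
    configExtend f g (n ∘ Prod.map f (Option.map g)) = n := by
  funext p
  by_cases hp : p ∈ Set.range (Prod.map f (Option.map g))
  · obtain ⟨p, rfl⟩ := hp
    rw [configExtend_apply hf hg, Function.comp_apply]
  · rw [configExtend_apply_of_notMem _ hp]
    by_contra h
    exact hp (hn p (Ne.symm h))

variable {k : ℕ} {edge : E → Finset V} {edge₀ : E₀ → Finset V₀}

theorem rowTermArcs_map [DecidableEq V] [DecidableEq V₀] (hf : Function.Injective f)
    (hedge : ∀ e, edge (g e) = (edge₀ e).image f) (p : V₀ × Option E₀) :
    rowTermArcs k edge (Prod.map f (Option.map g) p) =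
      (rowTermArcs k edge₀ p).mapDomain (Prod.map f f) := by
  rcases p with ⟨i, _ | e⟩
  · simp only [rowTermArcs, Prod.map_apply, Option.map_none, Finsupp.mapDomain_single]
  · simp only [Prod.map_apply, Option.map_some, rowTermArcs, hedge]
    rw [← Finset.image_erase hf, Finset.sum_image hf.injOn, Finsupp.mapDomain_finsetSum]
    simp [Finsupp.mapDomain_single]

variable [Fintype E]

theorem sum_row_configExtend_of_notMem (n : V₀ × Option E₀ → ℕ) {i : V} (hi : i ∉ Set.range f) :
    ∑ o, configExtend f g n (i, o) = 0 :=
  Finset.sum_eq_zero fun _ _ => configExtend_apply_of_notMem _ fun ⟨p, hp⟩ =>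
    hi ⟨p.1, congrArg Prod.fst hp⟩

variable [Fintype E₀]

theorem sum_row_configExtend (hf : Function.Injective f) (hg : Function.Injective g)
    (n : V₀ × Option E₀ → ℕ) (i : V₀) :
    ∑ o, configExtend f g n (f i, o) = ∑ o, n (i, o) := by
  refine (Fintype.sum_of_injective _ (Option.map_injective hg) _ _ (fun o ho => ?_)
    fun o => (configExtend_apply hf hg n (i, o)).symm).symm
  exact configExtend_apply_of_notMem _ fun ⟨p, hp⟩ => ho ⟨p.2, congrArg Prod.snd hp⟩

theorem mem_range_of_configEdges_eq_image [Fintype V] [DecidableEq V] [DecidableEq E] (hk : 2 ≤ k)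
    (hcard : ∀ e, (edge e).card = k) (hedge : ∀ e, edge (g e) = (edge₀ e).image f) [Nonempty E₀]
    {x : V → ℝ} {y : ℝ} {n : V × Option E → ℕ} (h : configTerm k edge x y n ≠ 0)
    (hn : configEdges n = Finset.univ.image g) {p : V × Option E} (hp : n p ≠ 0) :
    p ∈ Set.range (Prod.map f (Option.map g)) := by
  obtain ⟨e₀⟩ := ‹Nonempty E₀›
  obtain ⟨i₀, hi₀⟩ := mem_configEdges.mp (hn ▸ Finset.mem_image_of_mem g (Finset.mem_univ e₀))
  have hmem : ∀ e ∈ configEdges n, ∀ v ∈ edge e, v ∈ Set.range f := by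
    intro e he v hv
    rw [hn, Finset.mem_image] at he
    obtain ⟨b, -, rfl⟩ := he
    rw [hedge, Finset.mem_image] at hv
    obtain ⟨a, -, rfl⟩ := hv
    exact ⟨a, rfl⟩
  have hrange : p.1 ∈ Set.range f ↔ i₀ ∈ Set.range f := mem_iff_mem_of_configTerm_ne_zero hk hcard
    h (Set.range f) (fun e he u _ v hv _ => hmem e he v hv) hp hi₀
  obtain ⟨a, ha⟩ := hrange.mpr
    (hmem _ (mem_configEdges.mpr ⟨i₀, hi₀⟩) _ (mem_edge_of_configTerm_ne_zero h hi₀))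
  rcases p with ⟨i, _ | e⟩
  · exact ⟨(a, none), by simpa using ha⟩
  · have he : e ∈ configEdges n := mem_configEdges.mpr ⟨i, hp⟩
    rw [hn, Finset.mem_image] at he
    obtain ⟨b, -, rfl⟩ := he
    exact ⟨(a, some b), by simpa using ha⟩

variable [Fintype V] [Fintype V₀]

theorem sum_configExtend (hf : Function.Injective f) (hg : Function.Injective g)
    (n : V₀ × Option E₀ → ℕ) : ∑ p, configExtend f g n p = ∑ p, n p :=
  (Fintype.sum_of_injective _ (injective_prodMap_optionMap hf hg) _ _
    (fun _ hp => configExtend_apply_of_notMem _ hp)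
    fun p => (configExtend_apply hf hg n p).symm).symm

theorem configEdges_extend [DecidableEq E] (hf : Function.Injective f)
    (hg : Function.Injective g) (n : V₀ × Option E₀ → ℕ) :
    configEdges (configExtend f g n) = (configEdges n).image g := by
  ext e
  simp only [mem_configEdges, Finset.mem_image]
  constructor
  · rintro ⟨i, hi⟩
    obtain ⟨⟨a, o⟩, h⟩ : (i, some e) ∈ Set.range (Prod.map f (Option.map g)) := by
      by_contra h
      exact hi (configExtend_apply_of_notMem _ h)
    rw [← h, configExtend_apply hf hg] at hi
    simp only [Prod.map_apply, Prod.mk.injEq, Option.map_eq_some_iff] at h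
    obtain ⟨-, b, rfl, rfl⟩ := h
    exact ⟨b, ⟨a, hi⟩, rfl⟩
  · rintro ⟨b, ⟨a, h⟩, rfl⟩
    exact ⟨f a, fun h' => h (by rw [← configExtend_apply hf hg n (a, some b)]; exact h')⟩

variable [DecidableEq V] [DecidableEq V₀]

theorem configArcs_extend (hf : Function.Injective f) (hg : Function.Injective g)
    (hedge : ∀ e, edge (g e) = (edge₀ e).image f) (n : V₀ × Option E₀ → ℕ) :
    configArcs k edge (configExtend f g n) =
      (configArcs k edge₀ n).mapDomain (Prod.map f f) := by
  rw [configArcs, configArcs, Finsupp.mapDomain_finsetSum]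
  refine (Fintype.sum_of_injective _ (injective_prodMap_optionMap hf hg) _ _ (fun p hp => ?_)
    fun p => ?_).symm
  · rw [configExtend_apply_of_notMem _ hp, zero_smul]
  · rw [configExtend_apply hf hg, rowTermArcs_map hf hedge, Finsupp.mapDomain_smul]

theorem configCoeff_extend (hk : 2 ≤ k) (hf : Function.Injective f) (hg : Function.Injective g)
    (hedge : ∀ e, edge (g e) = (edge₀ e).image f) {n : V₀ × Option E₀ → ℕ} (hn : ∑ p, n p ≠ 0) :
    configCoeff k edge (configExtend f g n) = configCoeff k edge₀ n := by
  have hrows : ∏ i, ((∑ o, configExtend f g n (i, o)).factorial : ℝ) /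
      (((∑ o, configExtend f g n (i, o)) * (k - 1)).factorial : ℝ) =
      ∏ i, ((∑ o, n (i, o)).factorial : ℝ) / (((∑ o, n (i, o)) * (k - 1)).factorial : ℝ) := by
    refine (Fintype.prod_of_injective f hf _ _ (fun i hi => ?_)
      fun i => by rw [sum_row_configExtend hf hg]).symm
    simp [sum_row_configExtend_of_notMem n hi]
  have hterms : ∏ p, 1 / ((configExtend f g n p).factorial : ℝ) =
      ∏ p, 1 / ((n p).factorial : ℝ) := by
    refine (Fintype.prod_of_injective _ (injective_prodMap_optionMap hf hg) _ _ (fun p hp => ?_)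
      fun p => by rw [configExtend_apply hf hg]).symm
    simp [configExtend_apply_of_notMem _ hp]
  rw [configCoeff, configCoeff, hrows, hterms, configArcs_extend hf hg hedge,
    sum_configExtend hf hg, expFactorial_mapDomain (hf.prodMap hf),
    closedWalkCount_mapDomain hf (Nat.mul_ne_zero hn (by omega))]

theorem configTerm_extend (hk : 2 ≤ k) (hf : Function.Injective f) (hg : Function.Injective g)
    (hedge : ∀ e, edge (g e) = (edge₀ e).image f) {n : V₀ × Option E₀ → ℕ} (hn : ∑ p, n p ≠ 0)
    (x : V → ℝ) (y : ℝ) :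
    configTerm k edge x y (configExtend f g n) = configTerm k edge₀ (x ∘ f) y n := by
  rw [configTerm, configTerm, configCoeff_extend hk hf hg hedge hn]
  congr 1
  refine (Fintype.prod_of_injective _ (injective_prodMap_optionMap hf hg) _ _ (fun p hp => ?_)
    fun p => ?_).symm
  · rw [configExtend_apply_of_notMem _ hp, pow_zero]
  · rw [configExtend_apply hf hg]
    congr 1
    rcases p with ⟨i, _ | e⟩
    · rfl
    · simp [rowTermWeight, hedge, hf.eq_iff]

variable [DecidableEq E₀]

/-- The part of the sum of the terms of the configurations with `d` rows in all that comes from the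
configurations in which exactly the hyperedges in `s` occur. -/
noncomputable def supportSum (k : ℕ) (edge₀ : E₀ → Finset V₀) (x : V₀ → ℝ) (y : ℝ) (d : ℕ)
    (s : Finset E₀) : ℝ :=
  ∑ n ∈ Finset.piAntidiag Finset.univ d with configEdges n = s, configTerm k edge₀ x y n

theorem supportSum_image [DecidableEq E] (hk : 2 ≤ k) (hcard : ∀ e, (edge e).card = k)
    (hf : Function.Injective f) (hg : Function.Injective g)
    (hedge : ∀ e, edge (g e) = (edge₀ e).image f) [Nonempty E₀] {d : ℕ} (hd : d ≠ 0)
    (x : V → ℝ) (y : ℝ) :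
    supportSum k edge x y d (Finset.univ.image g) =
      supportSum k edge₀ (x ∘ f) y d Finset.univ := by
  refine (Finset.sum_of_injOn (configExtend f g)
    (fun n _ n' _ h => funext fun p => by
      rw [← configExtend_apply hf hg n p, h, configExtend_apply hf hg])
    (fun n hn => ?_) (fun n hn hn' => ?_) (fun n hn => ?_)).symm
  · simp only [Finset.coe_filter, Finset.mem_piAntidiag, Set.mem_ofPred_eq] at hn ⊢
    rw [sum_configExtend hf hg, configEdges_extend hf hg, hn.2]
    simpa using hn.1
  · by_contra h
    simp only [Finset.mem_filter, Finset.mem_piAntidiag] at hn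
    have hext := configExtend_comp hf hg fun p =>
      mem_range_of_configEdges_eq_image hk hcard hedge h hn.2 (p := p)
    refine hn' ⟨_, ?_, hext⟩
    simp only [Finset.coe_filter, Finset.mem_piAntidiag, Set.mem_ofPred_eq]
    refine ⟨⟨?_, by simp⟩, ?_⟩
    · rw [← sum_configExtend hf hg, hext]
      exact hn.1.1
    · refine Finset.image_injective hg ?_
      rw [← configEdges_extend hf hg, hext, hn.2]
  · simp only [Finset.mem_filter, Finset.mem_piAntidiag] at hn
    exact (configTerm_extend hk hf hg hedge (by rw [hn.1.1]; exact hd) x y).symm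

end Extend

/-- The coefficient of the `d`-th power of the weight of a vertex in the trace of order `d`: the
coefficient of the configuration that uses the loop row of a single vertex `d` times. -/
noncomputable def vertexCoeff (k d : ℕ) : ℝ :=
  configCoeff k (fun _ : Empty => (∅ : Finset Unit)) fun _ => d

theorem vertexCoeff_pos (k d : ℕ) : 0 < vertexCoeff k d := by
  have harcs : configArcs k (fun _ : Empty => (∅ : Finset Unit)) (fun _ => d) =
      Finsupp.single ((), ()) (d * (k - 1)) := by
    rw [configArcs, Fintype.sum_subsingleton _ ((), none)]
    exact Finsupp.smul_single _ _ _
  refine configCoeff_pos (i := ()) ?_ ?_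
  · rw [harcs]
    exact EulerTrail.loops _ _
  · rw [harcs, Finsupp.degree_single]
    simp

theorem sum_finset_eq_of_card_le_two {E M : Type*} [Fintype E] [AddCommMonoid M]
    {F : Finset E → M} (hF : ∀ s, 3 ≤ s.card → F s = 0) :
    ∑ s, F s = F ∅ + ∑ e, F {e} + ∑ s ∈ Finset.powersetCard 2 Finset.univ, F s := by
  classical
  have hlarge : ∀ j ∈ Finset.range (Fintype.card E + 3), j ∉ Finset.range (Fintype.card E + 1) →
      ∑ s ∈ Finset.powersetCard j (Finset.univ : Finset E), F s = 0 := by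
    intro j _ hj
    rw [Finset.powersetCard_eq_empty.mpr (by simpa using hj), Finset.sum_empty]
  have hthree : ∀ j ∈ Finset.range (Fintype.card E + 3), j ∉ Finset.range 3 →
      ∑ s ∈ Finset.powersetCard j (Finset.univ : Finset E), F s = 0 := by
    intro j _ hj
    refine Finset.sum_eq_zero fun s hs => hF s ?_
    rw [(Finset.mem_powersetCard.mp hs).2]
    simpa using hj
  rw [← Finset.powerset_univ, Finset.sum_powerset, Finset.card_univ,
    Finset.sum_subset (Finset.range_subset_range.mpr (by omega)) hlarge,
    ← Finset.sum_subset (Finset.range_subset_range.mpr (by omega)) hthree,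
    Finset.sum_range_succ, Finset.sum_range_succ, Finset.sum_range_one]
  simp [Finset.powersetCard_one]

theorem sum_offDiag_pair {E : Type*} [Fintype E] [DecidableEq E] (F : Finset E → ℝ) :
    ∑ p ∈ (Finset.univ : Finset E).offDiag, F {p.1, p.2} =
      2 * ∑ s ∈ Finset.powersetCard 2 Finset.univ, F s := by
  rw [← Finset.sum_fiberwise_of_maps_to (g := fun p => ({p.1, p.2} : Finset E))
    (t := Finset.powersetCard 2 Finset.univ) fun p hp => ?_, Finset.mul_sum]
  · refine Finset.sum_congr rfl fun s hs => ?_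
    obtain ⟨e, e', hne, rfl⟩ := Finset.card_eq_two.mp (Finset.mem_powersetCard.mp hs).2
    have hfiber : (Finset.univ : Finset E).offDiag.filter
        (fun p => ({p.1, p.2} : Finset E) = {e, e'}) = {(e, e'), (e', e)} := by
      ext ⟨a, b⟩
      simp only [Finset.mem_filter, Finset.mem_offDiag, Finset.mem_univ, Finset.mem_insert,
        Finset.mem_singleton, Prod.mk.injEq, ← Finset.coe_inj, Finset.coe_pair,
        Set.pair_eq_pair_iff]
      grind
    rw [hfiber, Finset.sum_pair (by simp [hne]), Finset.pair_comm e' e, two_mul]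
  · rw [Finset.mem_powersetCard]
    exact ⟨Finset.subset_univ _, Finset.card_pair (Finset.mem_offDiag.mp hp).2.2⟩

section SmallSupports

variable {V E : Type*} [DecidableEq V] [DecidableEq E] {k : ℕ} {edge : E → Finset V}

theorem configExtend_elim_eq_single (v : V) (d : ℕ) :
    configExtend (fun _ : Unit => v) (Empty.elim : Empty → E) (fun _ => d) =
      Pi.single (v, none) d := by
  have hv : Function.Injective fun _ : Unit => v := Function.injective_of_subsingleton _
  have helim : Function.Injective (Empty.elim : Empty → E) := Function.injective_of_subsingleton _
  funext p
  by_cases hp : p = (v, none)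
  · subst hp
    rw [Pi.single_eq_same]
    exact configExtend_apply hv helim (fun _ => d) ((), none)
  · rw [Pi.single_eq_of_ne hp]
    refine configExtend_apply_of_notMem _ ?_
    rintro ⟨⟨a, _ | b⟩, h⟩
    · exact hp h.symm
    · exact b.elim

variable [Fintype V] [Fintype E]

theorem configTerm_single (hk : 2 ≤ k) {d : ℕ} (hd : d ≠ 0) (v : V) (x : V → ℝ) (y : ℝ) :
    configTerm k edge x y (Pi.single (v, none) d) = vertexCoeff k d * x v ^ d := by
  have hsum : ∑ _ : Unit × Option Empty, d ≠ 0 := by simpa [Fintype.sum_prod_type] using hd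
  rw [← configExtend_elim_eq_single, configTerm_extend hk (Function.injective_of_subsingleton _)
    (Function.injective_of_subsingleton _) (edge₀ := fun _ : Empty => (∅ : Finset Unit))
    (fun e => e.elim) hsum, configTerm, Fintype.prod_subsingleton _ ((), none)]
  rfl

theorem exists_eq_single_of_configEdges_eq_empty (hk : 2 ≤ k) (hcard : ∀ e, (edge e).card = k)
    {x : V → ℝ} {y : ℝ} {n : V × Option E → ℕ} (h : configTerm k edge x y n ≠ 0)
    (hn : configEdges n = ∅) (hsum : ∑ p, n p ≠ 0) :
    ∃ v, n = Pi.single (v, none) (∑ p, n p) := by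
  have hsome : ∀ i e, n (i, some e) = 0 := fun i e => by
    by_contra hne
    simpa [hn] using mem_configEdges.mpr ⟨i, hne⟩
  obtain ⟨⟨v, _ | e⟩, -, hv⟩ := Finset.exists_ne_zero_of_sum_ne_zero hsum
  swap
  · exact absurd (hsome v e) hv
  have hzero : ∀ p, p ≠ (v, none) → n p = 0 := by
    rintro ⟨w, _ | e⟩ hp
    · by_contra hw
      have hmem := mem_iff_mem_of_configTerm_ne_zero hk hcard h {v}
        (fun e he => by simp [hn] at he) hw hv
      simp only [Set.mem_singleton_iff, iff_true] at hmem
      exact hp (by rw [hmem])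
    · exact hsome w e
  refine ⟨v, funext fun p => ?_⟩
  rw [Fintype.sum_eq_single _ hzero]
  by_cases hp : p = (v, none)
  · rw [hp, Pi.single_eq_same]
  · rw [Pi.single_eq_of_ne hp, hzero p hp]

theorem supportSum_empty (hk : 2 ≤ k) (hcard : ∀ e, (edge e).card = k) {d : ℕ} (hd : d ≠ 0)
    (x : V → ℝ) (y : ℝ) :
    supportSum k edge x y d ∅ = ∑ v, vertexCoeff k d * x v ^ d := by
  refine (Finset.sum_of_injOn (fun v => (Pi.single (v, none) d : V × Option E → ℕ))
    (fun v _ w _ h => ?_) (fun v _ => ?_) (fun n hn hn' => ?_)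
    (fun v _ => (configTerm_single hk hd v x y).symm)).symm
  · by_contra hvw
    have hd' := congrFun h (v, none)
    simp only [Pi.single_eq_same] at hd'
    rw [Pi.single_eq_of_ne (by simpa using hvw)] at hd'
    exact hd hd'
  · simp only [Finset.coe_filter, Finset.mem_piAntidiag, Set.mem_ofPred_eq]
    refine ⟨⟨by simp, by simp⟩, ?_⟩
    ext
    simp [mem_configEdges]
  · by_contra h
    simp only [Finset.mem_filter, Finset.mem_piAntidiag] at hn
    obtain ⟨v, hv⟩ :=
      exists_eq_single_of_configEdges_eq_empty hk hcard h hn.2 (by rw [hn.1.1]; exact hd)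
    exact hn' ⟨v, Finset.mem_coe.mpr (Finset.mem_univ _), by rw [hv, hn.1.1]⟩

theorem supportSum_eq_zero_of_lt (hcard : ∀ e, (edge e).card = k) (hflow : IsFlowFree edge)
    {d : ℕ} {s : Finset E} (hd : d < k * s.card) (x : V → ℝ) (y : ℝ) :
    supportSum k edge x y d s = 0 := by
  refine Finset.sum_eq_zero fun n hn => ?_
  by_contra h
  simp only [Finset.mem_filter, Finset.mem_piAntidiag] at hn
  have hle := sum_loops_add_le hcard hflow h
  rw [hn.2, hn.1.1] at hle
  omega

theorem supportSum_pair_eq_zero_of_disjoint (hk : 2 ≤ k) (hcard : ∀ e, (edge e).card = k)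
    {e e' : E} (hdisj : Disjoint (edge e) (edge e')) (x : V → ℝ) (y : ℝ) (d : ℕ) :
    supportSum k edge x y d {e, e'} = 0 := by
  refine Finset.sum_eq_zero fun n hn => ?_
  by_contra h
  simp only [Finset.mem_filter, Finset.mem_piAntidiag] at hn
  obtain ⟨i, hi⟩ := mem_configEdges.mp (show e ∈ configEdges n by simp [hn.2])
  obtain ⟨j, hj⟩ := mem_configEdges.mp (show e' ∈ configEdges n by simp [hn.2])
  have hclosed : ∀ a ∈ configEdges n, ∀ u ∈ edge a, ∀ v ∈ edge a, u ∈ (edge e : Set V) →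
      v ∈ (edge e : Set V) := by
    intro a ha u hu v hv hue
    rw [hn.2, Finset.mem_insert, Finset.mem_singleton] at ha
    rcases ha with rfl | rfl
    · exact hv
    · exact absurd hu (Finset.disjoint_left.mp hdisj hue)
  exact Finset.disjoint_left.mp hdisj ((mem_iff_mem_of_configTerm_ne_zero hk hcard h _ hclosed
    hi hj).mp (mem_edge_of_configTerm_ne_zero h hi)) (mem_edge_of_configTerm_ne_zero h hj)

theorem sum_configTerm_eq_sum_supportSum (d : ℕ) (x : V → ℝ) (y : ℝ) :
    ∑ n ∈ Finset.piAntidiag Finset.univ d, configTerm k edge x y n =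
      ∑ s, supportSum k edge x y d s :=
  (Finset.sum_fiberwise _ _ _).symm

theorem sum_configTerm_of_lt (hk : 2 ≤ k) (hcard : ∀ e, (edge e).card = k)
    (hflow : IsFlowFree edge) {d : ℕ} (hd : d ≠ 0) (hdk : d < k) (x : V → ℝ) (y : ℝ) :
    ∑ n ∈ Finset.piAntidiag Finset.univ d, configTerm k edge x y n =
      ∑ v, vertexCoeff k d * x v ^ d := by
  rw [sum_configTerm_eq_sum_supportSum, Fintype.sum_eq_single ∅, supportSum_empty hk hcard hd]
  intro s hs
  refine supportSum_eq_zero_of_lt hcard hflow ?_ x y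
  exact hdk.trans_le (Nat.le_mul_of_pos_right _
    (Finset.card_pos.mpr (Finset.nonempty_iff_ne_empty.mpr hs)))

/-- The line graph of a family of finite sets: two different sets are adjacent if they meet. -/
def lineGraph (edge : E → Finset V) : SimpleGraph E where
  Adj e e' := e ≠ e' ∧ ∃ v, v ∈ edge e ∧ v ∈ edge e'
  symm := ⟨fun _ _ h => ⟨h.1.symm, h.2.imp fun _ => And.symm⟩⟩
  loopless := ⟨fun _ h => h.1 rfl⟩

instance : DecidableRel (lineGraph edge).Adj := fun e e' =>
  inferInstanceAs (Decidable (e ≠ e' ∧ ∃ v, v ∈ edge e ∧ v ∈ edge e'))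

theorem sum_configTerm_eq_of_lt_three_mul (hk : 2 ≤ k) (hcard : ∀ e, (edge e).card = k)
    (hflow : IsFlowFree edge) {d : ℕ} (hd : d ≠ 0) (hdk : d < 3 * k) (x : V → ℝ) (y : ℝ) :
    ∑ n ∈ Finset.piAntidiag Finset.univ d, configTerm k edge x y n =
      ∑ v, vertexCoeff k d * x v ^ d + ∑ e, supportSum k edge x y d {e} +
        (∑ e, ∑ e' ∈ (lineGraph edge).neighborFinset e, supportSum k edge x y d {e, e'}) / 2 := by
  have hlarge : ∀ s : Finset E, 3 ≤ s.card → supportSum k edge x y d s = 0 := fun s hs =>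
    supportSum_eq_zero_of_lt hcard hflow (by nlinarith) x y
  have hpairs : ∑ e, ∑ e' ∈ (lineGraph edge).neighborFinset e, supportSum k edge x y d {e, e'} =
      ∑ p ∈ (Finset.univ : Finset E).offDiag, supportSum k edge x y d {p.1, p.2} := by
    rw [← Finset.sum_finset_product'
      (Finset.univ.filter fun p : E × E => (lineGraph edge).Adj p.1 p.2) _ _ (by simp)]
    refine Finset.sum_subset (fun p hp => ?_) fun p hp hp' => ?_
    · simpa using (Finset.mem_filter.mp hp).2.ne
    · refine supportSum_pair_eq_zero_of_disjoint hk hcard ?_ x y d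
      refine Finset.disjoint_left.mpr fun v hv hv' => hp' ?_
      simpa using ⟨(Finset.mem_offDiag.mp hp).2.2, v, hv, hv'⟩
  rw [sum_configTerm_eq_sum_supportSum, sum_finset_eq_of_card_le_two hlarge,
    supportSum_empty hk hcard hd, hpairs, sum_offDiag_pair]
  ring

end SmallSupports

section OnceConfigurations

variable {V E : Type*} [DecidableEq V] {k : ℕ} {edge : E → Finset V} {x : V → ℝ} {y : ℝ}

/-- The configuration that uses every row of every hyperedge once, and the loop row of each vertex
`i` exactly `l i` times. -/
def onceConfig (edge : E → Finset V) (l : V → ℕ) : V × Option E → ℕ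
  | (i, none) => l i
  | (i, some e) => if i ∈ edge e then 1 else 0

variable [Fintype V] [Fintype E]

theorem configTerm_nonneg (hx : ∀ v, 0 ≤ x v) (hy : 0 ≤ y) (n : V × Option E → ℕ) :
    0 ≤ configTerm k edge x y n := by
  refine mul_nonneg (configCoeff_nonneg n) (Finset.prod_nonneg ?_)
  rintro ⟨i, _ | e⟩ _
  · exact pow_nonneg (hx i) _
  · refine pow_nonneg ?_ _
    simp only [rowTermWeight]
    split_ifs
    exacts [hy, le_rfl]

theorem configArcs_onceConfig (l : V → ℕ) : configArcs k edge (onceConfig edge l) =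
    ∑ e, completeArcs (edge e) + ∑ i, Finsupp.single (i, i) (l i * (k - 1)) := by
  rw [configArcs, Fintype.sum_prod_type]
  simp only [Fintype.sum_option, Finset.sum_add_distrib]
  rw [add_comm, Finset.sum_comm]
  congr 1
  · refine Finset.sum_congr rfl fun e _ => ?_
    simp only [onceConfig, ite_smul, one_smul, zero_smul]
    rw [← Finset.sum_filter, Finset.filter_mem_eq_inter, Finset.univ_inter]
    rfl
  · refine Finset.sum_congr rfl fun i _ => ?_
    simp [onceConfig, rowTermArcs, -Finsupp.single_tsub]

theorem sum_onceConfig (hcard : ∀ e, (edge e).card = k) (l : V → ℕ) :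
    ∑ p, onceConfig edge l p = ∑ v, l v + k * Fintype.card E := by
  rw [Fintype.sum_prod_type]
  simp only [Fintype.sum_option, Finset.sum_add_distrib, onceConfig]
  congr 1
  rw [Finset.sum_comm]
  simp [hcard, mul_comm]

theorem eulerTrail_configArcs_onceConfig {r : V} (hr : ∀ e, r ∈ edge e)
    (hcover : ∀ v, ∃ e, v ∈ edge e) (l : V → ℕ) :
    EulerTrail r (configArcs k edge (onceConfig edge l)) r := by
  have hedges : EulerTrail r (∑ e, completeArcs (edge e)) r := by
    rw [← zero_add (∑ e, completeArcs (edge e))]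
    exact EulerTrail.insert_closed_sum _ (fun _ => r) _ EulerTrail.nil (fun _ _ => Or.inl rfl)
      fun e _ => eulerTrail_completeArcs (hr e)
  rw [configArcs_onceConfig]
  refine EulerTrail.insert_closed_sum _ (fun v => v) _ hedges (fun v _ => ?_)
    fun v _ => EulerTrail.loops v _
  by_cases hv : v = r
  · exact Or.inl hv
  · obtain ⟨e, he⟩ := hcover v
    refine Or.inr ⟨r, ?_⟩
    rw [Finsupp.finsetSum_apply]
    exact (Finset.sum_pos' (fun _ _ => Nat.zero_le _) ⟨e, Finset.mem_univ _,
      Nat.pos_of_ne_zero (completeArcs_apply_ne_zero he (hr e) hv)⟩).ne'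

theorem configCoeff_onceConfig_pos (hcard : ∀ e, (edge e).card = k) {r : V}
    (hr : ∀ e, r ∈ edge e) (hcover : ∀ v, ∃ e, v ∈ edge e) (l : V → ℕ) :
    0 < configCoeff k edge (onceConfig edge l) := by
  refine configCoeff_pos (eulerTrail_configArcs_onceConfig hr hcover l) ?_
  rw [configArcs_onceConfig, sum_onceConfig hcard, map_add, map_sum, map_sum]
  simp only [degree_completeArcs, hcard, Finsupp.degree_single, Finset.sum_const,
    Finset.card_univ, smul_eq_mul]
  rw [← Finset.sum_mul]
  ring

theorem configTerm_onceConfig_pos (hcard : ∀ e, (edge e).card = k) {r : V}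
    (hr : ∀ e, r ∈ edge e) (hcover : ∀ v, ∃ e, v ∈ edge e) (hx : ∀ v, 0 < x v) (hy : 0 < y)
    (l : V → ℕ) : 0 < configTerm k edge x y (onceConfig edge l) := by
  refine mul_pos (configCoeff_onceConfig_pos hcard hr hcover _) (Finset.prod_pos ?_)
  rintro ⟨i, _ | e⟩ _
  · exact pow_pos (hx i) _
  · by_cases hi : i ∈ edge e
    · simp only [rowTermWeight, hi, if_true]
      exact pow_pos hy _
    · simp [onceConfig, hi]

end OnceConfigurations

section MixedDifferences

variable {V E : Type*} [Fintype V] [DecidableEq V] [Fintype E] {k : ℕ} {edge : E → Finset V}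
  {w w' : V}

theorem prod_rowTermWeight_update (hw : w ≠ w') (x : V → ℝ) (y s t : ℝ)
    (n : V × Option E → ℕ) :
    ∏ p, rowTermWeight edge (Function.update (Function.update x w s) w' t) y p ^ n p =
      s ^ n (w, none) * t ^ n (w', none) *
        (∏ i ∈ (Finset.univ.erase w).erase w', x i ^ n (i, none)) *
          ∏ i, ∏ e, rowTermWeight edge x y (i, some e) ^ n (i, some e) := by
  simp only [Fintype.prod_prod_type, Fintype.prod_option, Finset.prod_mul_distrib]
  refine congrArg₂ _ ?_ rfl
  rw [← Finset.mul_prod_erase Finset.univ _ (Finset.mem_univ w),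
    ← Finset.mul_prod_erase (Finset.univ.erase w) _
      (Finset.mem_erase.mpr ⟨hw.symm, Finset.mem_univ w'⟩), ← mul_assoc]
  congr 1
  · simp [rowTermWeight, Function.update_of_ne hw]
  · refine Finset.prod_congr rfl fun i hi => ?_
    simp only [Finset.mem_erase, ne_eq, Finset.mem_univ, and_true] at hi
    simp only [rowTermWeight]
    rw [Function.update_of_ne hi.1, Function.update_of_ne hi.2]

variable [DecidableEq E] {x : V → ℝ} {y a : ℝ} {d : ℕ}

/-- The mixed second difference of the contribution of the configurations in which every hyperedge
occurs, when the weights of the loops at `w` and `w'` change from `a` to `2a`. -/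
noncomputable def mixedDiff (k : ℕ) (edge : E → Finset V) (x : V → ℝ) (y : ℝ) (d : ℕ) (w w' : V)
    (a : ℝ) : ℝ :=
  supportSum k edge (Function.update (Function.update x w (2 * a)) w' (2 * a)) y d Finset.univ -
    supportSum k edge (Function.update (Function.update x w (2 * a)) w' a) y d Finset.univ -
    supportSum k edge (Function.update (Function.update x w a) w' (2 * a)) y d Finset.univ +
    supportSum k edge (Function.update (Function.update x w a) w' a) y d Finset.univ

theorem mixedDiff_eq_sum (hw : w ≠ w') (x : V → ℝ) (y : ℝ) (d : ℕ) (a : ℝ) :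
    mixedDiff k edge x y d w w' a =
      ∑ n ∈ Finset.piAntidiag Finset.univ d with configEdges n = Finset.univ,
        configTerm k edge (Function.update (Function.update x w a) w' a) y n *
          ((2 ^ n (w, none) - 1) * (2 ^ n (w', none) - 1)) := by
  simp only [mixedDiff, supportSum]
  rw [← Finset.sum_sub_distrib, ← Finset.sum_sub_distrib, ← Finset.sum_add_distrib]
  refine Finset.sum_congr rfl fun n _ => ?_
  simp only [configTerm, prod_rowTermWeight_update hw, mul_pow]
  ring

/-- A configuration contributes to the mixed difference only if it has loops at both `w` and `w'`,
besides the `k` rows of each hyperedge. -/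
theorem mixedDiff_eq_zero (hcard : ∀ e, (edge e).card = k) (hflow : IsFlowFree edge)
    (hw : w ≠ w') (hd : d < k * Fintype.card E + 2) (x : V → ℝ) (y a : ℝ) :
    mixedDiff k edge x y d w w' a = 0 := by
  rw [mixedDiff_eq_sum hw]
  refine Finset.sum_eq_zero fun n hn => ?_
  by_contra h
  simp only [Finset.mem_filter, Finset.mem_piAntidiag] at hn
  have hle := sum_loops_add_le hcard hflow (left_ne_zero_of_mul h)
  rw [hn.2, hn.1.1, Finset.card_univ] at hle
  have hne : n (w, none) ≠ 0 := fun h0 => h (by simp [h0])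
  have hne' : n (w', none) ≠ 0 := fun h0 => h (by simp [h0])
  have hpair : n (w, none) + n (w', none) ≤ ∑ v, n (v, none) := by
    rw [← Finset.sum_pair (f := fun v => n (v, none)) hw]
    exact Finset.sum_le_univ_sum_of_nonneg fun _ => Nat.zero_le _
  omega

theorem mixedDiff_pos (hcard : ∀ e, (edge e).card = k) {r : V} (hr : ∀ e, r ∈ edge e)
    (hcover : ∀ v, ∃ e, v ∈ edge e) (hw : w ≠ w') (hd : d = k * Fintype.card E + 2)
    (hx : ∀ v, 0 < x v) (hy : 0 < y) (ha : 0 < a) : 0 < mixedDiff k edge x y d w w' a := by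
  rw [mixedDiff_eq_sum hw]
  have hx' : ∀ v, 0 < Function.update (Function.update x w a) w' a v := by
    intro v
    simp only [Function.update_apply]
    split_ifs
    exacts [ha, ha, hx v]
  have hpow : ∀ l : ℕ, (0 : ℝ) ≤ 2 ^ l - 1 := fun l =>
    sub_nonneg.mpr (one_le_pow₀ one_le_two)
  refine Finset.sum_pos' (fun n _ => mul_nonneg (configTerm_nonneg (fun v => (hx' v).le) hy.le n)
    (mul_nonneg (hpow _) (hpow _))) ⟨onceConfig edge (Pi.single w 1 + Pi.single w' 1), ?_,
      mul_pos (configTerm_onceConfig_pos hcard hr hcover hx' hy _) ?_⟩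
  · simp only [Finset.mem_filter, Finset.mem_piAntidiag, Finset.mem_univ, implies_true, and_true]
    refine ⟨?_, ?_⟩
    · rw [sum_onceConfig hcard, hd]
      simp only [Pi.add_apply, Finset.sum_add_distrib, Finset.sum_pi_single', Finset.mem_univ,
        if_true]
      ring
    · ext e
      simp only [mem_configEdges, Finset.mem_univ, iff_true]
      exact ⟨r, by simp [onceConfig, hr e]⟩
  · simp [onceConfig, hw, hw.symm]

theorem supportSum_univ_comp_equiv {V₀ E₀ : Type*} [Fintype V₀] [DecidableEq V₀] [Fintype E₀]
    [DecidableEq E₀] {edge₀ : E₀ → Finset V₀} (hk : 2 ≤ k) (hcard : ∀ e, (edge e).card = k)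
    (f : V₀ ≃ V) (g : E₀ ≃ E) (hedge : ∀ e, edge (g e) = (edge₀ e).image f) [Nonempty E₀]
    (hd : d ≠ 0) (x : V → ℝ) (y : ℝ) :
    supportSum k edge₀ (x ∘ f) y d Finset.univ = supportSum k edge x y d Finset.univ := by
  rw [← supportSum_image hk hcard f.injective g.injective hedge hd x y,
    Finset.image_univ_of_surjective g.surjective]

end MixedDifferences

/-- A single set with `k` elements, the model in which `edgeSum` is evaluated. -/
def singleEdge (k : ℕ) : Unit → Finset (Fin k) := fun _ => Finset.univ

/-- Two sets with `k` elements that share the element `none`, the model in which `pairSum` is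
evaluated. -/
def twoEdges (k : ℕ) : Bool → Finset (Option (Bool × Fin (k - 1))) :=
  fun b => insert none (Finset.univ.image fun j => some (b, j))

/-- The weights of the loops in an edge with `δ` vertices of degree two, these vertices first. -/
def edgeProfile (k : ℕ) (a : ℝ) (δ : ℕ) : Fin k → ℝ := fun j => if (j : ℕ) < δ then 2 * a else a

/-- The contribution of the configurations supported on a single edge with `δ` vertices of degree
two. -/
noncomputable def edgeSum (k : ℕ) (a y : ℝ) (d δ : ℕ) : ℝ :=
  supportSum k (singleEdge k) (edgeProfile k a δ) y d Finset.univ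

/-- The weights of the loops in two adjacent edges with `δ` and `δ'` vertices of degree two, where
the common vertex `none` is counted in both. -/
def pairProfile (k : ℕ) (a : ℝ) (δ δ' : ℕ) : Option (Bool × Fin (k - 1)) → ℝ
  | none => 2 * a
  | some (true, j) => if (j : ℕ) + 1 < δ then 2 * a else a
  | some (false, j) => if (j : ℕ) + 1 < δ' then 2 * a else a

/-- The contribution of the configurations supported on exactly two adjacent edges with `δ` and
`δ'` vertices of degree two. -/
noncomputable def pairSum (k : ℕ) (a y : ℝ) (d δ δ' : ℕ) : ℝ :=
  supportSum k (twoEdges k) (pairProfile k a δ δ') y d Finset.univ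

section ModelEdges

variable {k : ℕ} {a y : ℝ} {d δ δ' : ℕ}

theorem card_singleEdge (k : ℕ) (e : Unit) : (singleEdge k e).card = k := by simp [singleEdge]

theorem isFlowFree_singleEdge (k : ℕ) : IsFlowFree (singleEdge k) := by
  intro x _ _ hvert v _
  simpa using hvert v

theorem card_twoEdges (hk : 1 ≤ k) (b : Bool) : (twoEdges k b).card = k := by
  rw [twoEdges, Finset.card_insert_of_notMem (by simp),
    Finset.card_image_of_injective _ fun i j h => by simpa using h, Finset.card_univ,
    Fintype.card_fin, Nat.sub_add_cancel hk]

theorem isFlowFree_twoEdges (k : ℕ) : IsFlowFree (twoEdges k) := by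
  intro x hmem hedge hvert
  have hsome : ∀ b j e, x (some (b, j)) e = 0 := by
    intro b j e
    by_cases hb : e = b
    · subst hb
      have hsum := hvert (some (e, j))
      rwa [Fintype.sum_eq_single e] at hsum
      intro e' he'
      exact hmem _ _ (by simp [twoEdges, he'])
    · exact hmem _ _ (by simp [twoEdges, hb])
  rintro (_ | ⟨b, j⟩) e
  · have hsum := hedge e
    rwa [Fintype.sum_option, Finset.sum_eq_zero fun p _ => hsome p.1 p.2 e, add_zero] at hsum
  · exact hsome b j e

theorem edgeSum_second_diff (hk : 2 ≤ k) (hd : d ≠ 0) (hδ : δ + 2 ≤ k) :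
    edgeSum k a y d (δ + 2) - 2 * edgeSum k a y d (δ + 1) + edgeSum k a y d δ =
      mixedDiff k (singleEdge k) (edgeProfile k a δ) y d ⟨δ, by omega⟩ ⟨δ + 1, by omega⟩ a := by
  let u : Fin k := ⟨δ, by omega⟩
  let v : Fin k := ⟨δ + 1, by omega⟩
  have hswap := supportSum_univ_comp_equiv hk (card_singleEdge k) (Equiv.swap u v)
    (Equiv.refl Unit) (edge₀ := singleEdge k) (by intro _; simp [singleEdge]) hd
    (edgeProfile k a (δ + 1)) y
  have hboth : Function.update (Function.update (edgeProfile k a δ) u (2 * a)) v (2 * a) =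
      edgeProfile k a (δ + 2) := by
    funext j
    simp only [Function.update_apply, edgeProfile, Fin.ext_iff, u, v]
    grind
  have hfirst : Function.update (Function.update (edgeProfile k a δ) u (2 * a)) v a =
      edgeProfile k a (δ + 1) := by
    funext j
    simp only [Function.update_apply, edgeProfile, Fin.ext_iff, u, v]
    grind
  have hsecond : Function.update (Function.update (edgeProfile k a δ) u a) v (2 * a) =
      edgeProfile k a (δ + 1) ∘ Equiv.swap u v := by
    funext j
    simp only [Function.update_apply, edgeProfile, Function.comp_apply, Equiv.swap_apply_def,
      Fin.ext_iff, u, v]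
    grind
  have hnone : Function.update (Function.update (edgeProfile k a δ) u a) v a =
      edgeProfile k a δ := by
    funext j
    simp only [Function.update_apply, edgeProfile, Fin.ext_iff, u, v]
    grind
  rw [mixedDiff, hboth, hfirst, hsecond, hnone, hswap]
  simp only [edgeSum]
  ring

theorem edgeSum_affine (hk : 2 ≤ k) (hd : d ≠ 0) (hdk : d < k + 2) (hδ : δ + 2 ≤ k) :
    edgeSum k a y d (δ + 2) - 2 * edgeSum k a y d (δ + 1) + edgeSum k a y d δ = 0 := by
  rw [edgeSum_second_diff hk hd hδ]
  exact mixedDiff_eq_zero (card_singleEdge k) (isFlowFree_singleEdge k) (by simp)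
    (by simpa using hdk) _ _ _

theorem edgeSum_convex (hk : 2 ≤ k) (ha : 0 < a) (hy : 0 < y) (hδ : δ + 2 ≤ k) :
    0 < edgeSum k a y (k + 2) (δ + 2) - 2 * edgeSum k a y (k + 2) (δ + 1) +
      edgeSum k a y (k + 2) δ := by
  rw [edgeSum_second_diff hk (by omega) hδ]
  refine mixedDiff_pos (card_singleEdge k) (r := ⟨δ, by omega⟩)
    (fun _ => Finset.mem_univ _) (fun _ => ⟨(), Finset.mem_univ _⟩) (by simp) (by simp)
    (fun j => ?_) hy ha
  simp only [edgeProfile]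
  split_ifs <;> linarith

theorem pairSum_eq_zero (hk : 1 ≤ k) (hd : d < 2 * k) : pairSum k a y d δ δ' = 0 :=
  supportSum_eq_zero_of_lt (card_twoEdges hk) (isFlowFree_twoEdges k)
    (by simpa [mul_comm] using hd) _ _

theorem pairSum_comm (hk : 2 ≤ k) (hd : d ≠ 0) :
    pairSum k a y d δ δ' = pairSum k a y d δ' δ := by
  have hswap := supportSum_univ_comp_equiv hk (card_twoEdges (by omega))
    (Equiv.optionCongr (Equiv.prodCongr Equiv.boolNot (Equiv.refl (Fin (k - 1))))) Equiv.boolNot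
    (edge₀ := twoEdges k) (fun e => by
      rw [twoEdges, twoEdges, Finset.image_insert, Finset.image_image]
      rfl) hd (pairProfile k a δ δ') y
  rw [pairSum, ← hswap, pairSum]
  congr 1
  funext p
  rcases p with _ | ⟨_ | _, j⟩ <;> rfl

theorem pairSum_mixed_diff (hδ : δ + 1 < k) (hδ' : δ' + 1 < k) :
    pairSum k a y d (δ + 2) (δ' + 2) - pairSum k a y d (δ + 2) (δ' + 1) -
        pairSum k a y d (δ + 1) (δ' + 2) + pairSum k a y d (δ + 1) (δ' + 1) =
      mixedDiff k (twoEdges k) (pairProfile k a (δ + 1) (δ' + 1)) y d (some (true, ⟨δ, by omega⟩))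
        (some (false, ⟨δ', by omega⟩)) a := by
  have hupdate : ∀ s t : ℕ, s ≤ 1 → t ≤ 1 →
      Function.update (Function.update (pairProfile k a (δ + 1) (δ' + 1))
        (some (true, ⟨δ, by omega⟩)) (if s = 1 then 2 * a else a)) (some (false, ⟨δ', by omega⟩))
        (if t = 1 then 2 * a else a) = pairProfile k a (δ + 1 + s) (δ' + 1 + t) := by
    intro s t hs ht
    funext p
    rcases p with _ | ⟨_ | _, j⟩
    · simp [pairProfile]
    · simp only [Function.update_apply, pairProfile, Option.some.injEq, Prod.mk.injEq, Fin.ext_iff]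
      grind
    · simp only [Function.update_apply, pairProfile, Option.some.injEq, Prod.mk.injEq, Fin.ext_iff]
      grind
  have hboth := hupdate 1 1 le_rfl le_rfl
  have hfirst := hupdate 1 0 le_rfl zero_le_one
  have hsecond := hupdate 0 1 zero_le_one le_rfl
  have hnone := hupdate 0 0 zero_le_one zero_le_one
  simp only [if_true, zero_ne_one, if_false] at hboth hfirst hsecond hnone
  rw [mixedDiff, hboth, hfirst, hsecond, hnone]
  rfl

theorem pairSum_additive (hk : 1 ≤ k) (hd : d < 2 * k + 2) (hδ : δ + 1 < k) (hδ' : δ' + 1 < k) :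
    pairSum k a y d (δ + 2) (δ' + 2) - pairSum k a y d (δ + 2) (δ' + 1) -
        pairSum k a y d (δ + 1) (δ' + 2) + pairSum k a y d (δ + 1) (δ' + 1) = 0 := by
  rw [pairSum_mixed_diff hδ hδ']
  exact mixedDiff_eq_zero (card_twoEdges hk) (isFlowFree_twoEdges k) (by simp)
    (by simpa [mul_comm] using hd) _ _ _

theorem pairSum_supermodular (ha : 0 < a) (hy : 0 < y) (hδ : δ + 1 < k) (hδ' : δ' + 1 < k) :
    0 < pairSum k a y (2 * k + 2) (δ + 2) (δ' + 2) - pairSum k a y (2 * k + 2) (δ + 2) (δ' + 1) -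
        pairSum k a y (2 * k + 2) (δ + 1) (δ' + 2) +
        pairSum k a y (2 * k + 2) (δ + 1) (δ' + 1) := by
  rw [pairSum_mixed_diff hδ hδ']
  refine mixedDiff_pos (card_twoEdges (by omega)) (r := none)
    (fun _ => by simp [twoEdges]) ?_ (by simp) (by simp [mul_comm]) ?_ hy ha
  · rintro (_ | ⟨b, j⟩)
    · exact ⟨true, by simp [twoEdges]⟩
    · exact ⟨b, by simp [twoEdges]⟩
  · rintro (_ | ⟨_ | _, j⟩)
    · simpa [pairProfile] using ha
    · simp only [pairProfile]
      split_ifs <;> linarith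
    · simp only [pairProfile]
      split_ifs <;> linarith

end ModelEdges

theorem exists_equiv_of_card_fiber {α β γ : Type*} [Fintype α] [Fintype β] [DecidableEq γ]
    {p : α → γ} {q : β → γ}
    (h : ∀ c, (Finset.univ.filter fun a => p a = c).card =
      (Finset.univ.filter fun b => q b = c).card) :
    ∃ e : α ≃ β, ∀ a, q (e a) = p a :=
  ⟨Equiv.ofFiberEquiv fun c => Fintype.equivOfCardEq (by
    rw [Fintype.card_subtype, Fintype.card_subtype, h]), Equiv.ofFiberEquiv_map _⟩

theorem exists_sorted_enumeration {V : Type*} [DecidableEq V] (s : Finset V) (P : V → Prop)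
    [DecidablePred P] {N δ : ℕ} (hN : s.card = N) (hδ : (s.filter P).card = δ) :
    ∃ f : Fin N → V, Function.Injective f ∧ s = Finset.univ.image f ∧
      ∀ j, P (f j) ↔ (j : ℕ) < δ := by
  have hle : δ ≤ N := hN ▸ hδ ▸ Finset.card_filter_le _ _
  have hinitial : (Finset.univ.filter fun j : Fin N => (j : ℕ) < δ).card = δ := by
    rw [Fin.card_filter_val_lt, min_eq_right hle]
  have hmarked : (Finset.univ.filter fun v : ↥s => P v).card = δ := by
    rw [← hδ, ← Finset.card_map (Function.Embedding.subtype (· ∈ s))]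
    congr 1
    ext v
    simp [and_comm]
  obtain ⟨e, he⟩ := exists_equiv_of_card_fiber (p := fun j : Fin N => decide ((j : ℕ) < δ))
    (q := fun v : ↥s => decide (P v)) (by
      have hsplit := Finset.card_filter_add_card_filter_not (s := Finset.univ)
        (fun j : Fin N => (j : ℕ) < δ)
      have hsplit' := Finset.card_filter_add_card_filter_not (s := Finset.univ)
        (fun v : ↥s => P v)
      simp only [Finset.card_univ, Fintype.card_fin, Fintype.card_coe] at hsplit hsplit'
      rintro (_ | _) <;> simp only [decide_eq_false_iff_not, decide_eq_true_eq] <;> omega)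
  refine ⟨fun j => e j, fun i j h => e.injective (Subtype.ext h), ?_, fun j => ?_⟩
  · ext v
    simp only [Finset.mem_image, Finset.mem_univ, true_and]
    exact ⟨fun hv => ⟨e.symm ⟨v, hv⟩, by simp⟩, fun ⟨j, hj⟩ => hj ▸ (e j).2⟩
  · simpa using he j

section EdgesAt

variable {V E : Type*} [DecidableEq V] [Fintype E] {k : ℕ} {edge : E → Finset V}

/-- The edges through a vertex. -/
def edgesAt (edge : E → Finset V) (v : V) : Finset E := Finset.univ.filter fun e => v ∈ edge e

theorem mem_edgesAt {v : V} {e : E} : e ∈ edgesAt edge v ↔ v ∈ edge e := by simp [edgesAt]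

theorem edgesAt_eq_pair [DecidableEq E] {v : V} (h2 : (edgesAt edge v).card ≤ 2) {e e' : E}
    (he : v ∈ edge e) (he' : v ∈ edge e') (hne : e ≠ e') : edgesAt edge v = {e, e'} := by
  refine (Finset.eq_of_subset_of_card_le ?_ (h2.trans (Finset.card_pair hne).ge)).symm
  simp [Finset.insert_subset_iff, mem_edgesAt, he, he']

variable [Fintype V]

theorem sum_card_edgesAt_eq_sum_card :
    ∑ v, (edgesAt edge v).card = ∑ e, (edge e).card := by
  simp only [edgesAt, Finset.card_filter]
  rw [Finset.sum_comm]
  simp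

/-- The numerical and connectivity properties of the hyperedges of a `k`-uniform hypertree. -/
structure IsEdgeTree (k : ℕ) (edge : E → Finset V) : Prop where
  card_edge : ∀ e, (edge e).card = k
  flowFree : IsFlowFree edge
  linear : ∀ e e', e ≠ e' → ∀ v w, v ∈ edge e → v ∈ edge e' → w ∈ edge e → w ∈ edge e' → v = w
  card_add : Fintype.card V + Fintype.card E = k * Fintype.card E + 1
  cover : ∀ v, ∃ e, v ∈ edge e
  connected : (lineGraph edge).Connected

namespace IsEdgeTree

theorem sum_card_edgesAt (h : IsEdgeTree k edge) :
    ∑ v, (edgesAt edge v).card = k * Fintype.card E := by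
  simp [sum_card_edgesAt_eq_sum_card, h.card_edge, mul_comm]

theorem card_edgesAt_pos (h : IsEdgeTree k edge) (v : V) : 0 < (edgesAt edge v).card := by
  obtain ⟨e, he⟩ := h.cover v
  exact Finset.card_pos.mpr ⟨e, mem_edgesAt.mpr he⟩

theorem card_edgesAt_eq_one_or_two (h : IsEdgeTree k edge) {v : V}
    (h2 : (edgesAt edge v).card ≤ 2) :
    (edgesAt edge v).card = 1 ∨ (edgesAt edge v).card = 2 := by
  have := h.card_edgesAt_pos v
  omega

theorem loopWeight_eq (h : IsEdgeTree k edge) {v : V} (h2 : (edgesAt edge v).card ≤ 2) (a : ℝ) :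
    a * (edgesAt edge v).card = if (edgesAt edge v).card = 2 then 2 * a else a := by
  rcases h.card_edgesAt_eq_one_or_two h2 with hv | hv <;> simp [hv, mul_comm]

theorem sum_comp_card_edgesAt (h : IsEdgeTree k edge) (h2 : ∀ v, (edgesAt edge v).card ≤ 2)
    (φ : ℕ → ℝ) : ∑ v, φ (edgesAt edge v).card =
      Fintype.card V * φ 1 + (Fintype.card E - 1) * (φ 2 - φ 1) := by
  have hinterp : ∀ v, φ (edgesAt edge v).card =
      φ 1 + ((edgesAt edge v).card - 1) * (φ 2 - φ 1) := by
    intro v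
    rcases h.card_edgesAt_eq_one_or_two (h2 v) with hv | hv <;> rw [hv] <;> push_cast <;> ring
  have hsum : ∑ v, ((edgesAt edge v).card : ℝ) = k * Fintype.card E := by
    exact_mod_cast h.sum_card_edgesAt
  have hcard : (Fintype.card V : ℝ) + Fintype.card E = k * Fintype.card E + 1 := by
    exact_mod_cast h.card_add
  rw [Finset.sum_congr rfl fun v _ => hinterp v, Finset.sum_add_distrib, ← Finset.sum_mul,
    Finset.sum_sub_distrib, hsum]
  simp only [Finset.sum_const, Finset.card_univ, nsmul_eq_mul, mul_one]
  linear_combination (φ 1 - φ 2) * hcard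

variable [DecidableEq E]

theorem card_filter_eq_degree (h : IsEdgeTree k edge) (h2 : ∀ v, (edgesAt edge v).card ≤ 2)
    (e : E) :
    ((edge e).filter fun v => (edgesAt edge v).card = 2).card = (lineGraph edge).degree e := by
  rw [← SimpleGraph.card_neighborFinset_eq_degree]
  refine mul_right_cancel₀ one_ne_zero
    (Finset.card_mul_eq_card_mul (fun v e' => v ∈ edge e') (fun v hv => ?_) fun e' he' => ?_)
  · obtain ⟨hve, hcard⟩ := Finset.mem_filter.mp hv
    have habove : Finset.bipartiteAbove (fun v e' => v ∈ edge e')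
        ((lineGraph edge).neighborFinset e) v = (edgesAt edge v).erase e := by
      ext e'
      simp only [Finset.mem_bipartiteAbove, SimpleGraph.mem_neighborFinset, Finset.mem_erase,
        mem_edgesAt]
      exact ⟨fun hadj => ⟨hadj.1.1.symm, hadj.2⟩, fun hadj =>
        ⟨⟨hadj.1.symm, v, hve, hadj.2⟩, hadj.2⟩⟩
    rw [habove, Finset.card_erase_of_mem (mem_edgesAt.mpr hve), hcard, Nat.add_one_sub_one]
  · obtain ⟨hne, v, hve, hve'⟩ := (SimpleGraph.mem_neighborFinset _ _ _).mp he'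
    refine Finset.card_eq_one.mpr ⟨v, Finset.eq_singleton_iff_unique_mem.mpr ⟨?_, fun w hw => ?_⟩⟩
    · simp only [Finset.mem_bipartiteBelow, Finset.mem_filter]
      exact ⟨⟨hve, edgesAt_eq_pair (h2 v) hve hve' hne ▸ Finset.card_pair hne⟩, hve'⟩
    · simp only [Finset.mem_bipartiteBelow, Finset.mem_filter] at hw
      exact h.linear e e' hne w v hw.1.1 hw.2 hve hve'

theorem sum_degree_lineGraph (h : IsEdgeTree k edge) (h2 : ∀ v, (edgesAt edge v).card ≤ 2) :
    ∑ e, (lineGraph edge).degree e + 2 = 2 * Fintype.card E := by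
  have hcount : ∑ e, (lineGraph edge).degree e =
      ∑ v, if (edgesAt edge v).card = 2 then (edgesAt edge v).card else 0 := by
    rw [← Finset.sum_filter]
    simp only [← h.card_filter_eq_degree h2]
    refine (Finset.sum_congr rfl fun e _ => congrArg Finset.card ?_).trans
      (Finset.sum_card_bipartiteAbove_eq_sum_card_bipartiteBelow fun e v => v ∈ edge e)
    ext v
    simp [and_comm]
  have hsum := h.sum_comp_card_edgesAt h2 fun i => ((if i = 2 then i else 0 : ℕ) : ℝ)
  rw [← Nat.cast_sum, ← hcount] at hsum
  norm_num at hsum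
  rw [← Nat.cast_inj (R := ℝ)]
  push_cast
  linarith

theorem supportSum_singleton (h : IsEdgeTree k edge) (hk : 2 ≤ k)
    (h2 : ∀ v, (edgesAt edge v).card ≤ 2) {d : ℕ} (hd : d ≠ 0) (a y : ℝ) (e : E) :
    supportSum k edge (fun v => a * (edgesAt edge v).card) y d {e} =
      edgeSum k a y d ((lineGraph edge).degree e) := by
  obtain ⟨f, hf, himage, hdeg⟩ := exists_sorted_enumeration (edge e)
    (fun v => (edgesAt edge v).card = 2) (h.card_edge e) (h.card_filter_eq_degree h2 e)
  have hmodel := supportSum_image hk h.card_edge hf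
    (Function.injective_of_subsingleton fun _ : Unit => e) (edge₀ := singleEdge k)
    (fun _ => himage) hd (fun v => a * (edgesAt edge v).card) y
  rw [Finset.univ_unique, Finset.image_singleton] at hmodel
  rw [hmodel, edgeSum]
  congr 1
  funext j
  simp only [Function.comp_apply, h.loopWeight_eq (h2 _), hdeg, edgeProfile]

theorem exists_twoEdges_enumeration (h : IsEdgeTree k edge)
    (h2 : ∀ v, (edgesAt edge v).card ≤ 2) {g : Bool → E} (hg : Function.Injective g) {v : V}
    (hv : ∀ b, v ∈ edge (g b)) :
    ∃ f : Option (Bool × Fin (k - 1)) → V, Function.Injective f ∧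
      (∀ b, edge (g b) = (twoEdges k b).image f) ∧ (edgesAt edge (f none)).card = 2 ∧
      ∀ b j, (edgesAt edge (f (some (b, j)))).card = 2 ↔
        (j : ℕ) + 1 < (lineGraph edge).degree (g b) := by
  have htwo : (edgesAt edge v).card = 2 := by
    rw [edgesAt_eq_pair (h2 v) (hv true) (hv false) (hg.ne (by simp))]
    exact Finset.card_pair (hg.ne (by simp))
  choose f hf himage hdeg using fun b => exists_sorted_enumeration ((edge (g b)).erase v)
    (fun v => (edgesAt edge v).card = 2) (N := k - 1) (δ := (lineGraph edge).degree (g b) - 1)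
    (by rw [Finset.card_erase_of_mem (hv b), h.card_edge])
    (by rw [Finset.filter_erase, Finset.card_erase_of_mem (by simp [hv b, htwo]),
      h.card_filter_eq_degree h2])
  have hmem : ∀ b j, f b j ≠ v ∧ f b j ∈ edge (g b) := fun b j => by
    rw [← Finset.mem_erase, himage]
    exact Finset.mem_image_of_mem _ (Finset.mem_univ _)
  refine ⟨fun o => o.elim v fun p => f p.1 p.2, ?_, fun b => ?_, htwo, fun b j => ?_⟩
  · rintro (_ | ⟨b, j⟩) (_ | ⟨b', j'⟩) heq
    · rfl
    · exact absurd heq.symm (hmem b' j').1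
    · exact absurd heq (hmem b j).1
    · replace heq : f b j = f b' j' := heq
      by_cases hb : b = b'
      · subst hb
        rw [hf b heq]
      · exact absurd (h.linear _ _ (hg.ne hb) _ _ (hmem b j).2 (heq ▸ (hmem b' j').2) (hv b)
          (hv b')) (hmem b j).1
  · rw [twoEdges, Finset.image_insert, Finset.image_image]
    change edge (g b) = insert v (Finset.univ.image (f b))
    rw [← himage, Finset.insert_erase (hv b)]
  · exact (hdeg b j).trans Nat.lt_sub_iff_add_lt

theorem supportSum_pair (h : IsEdgeTree k edge) (hk : 2 ≤ k)
    (h2 : ∀ v, (edgesAt edge v).card ≤ 2) {d : ℕ} (hd : d ≠ 0) (a y : ℝ) {e e' : E}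
    (hadj : (lineGraph edge).Adj e e') :
    supportSum k edge (fun v => a * (edgesAt edge v).card) y d {e, e'} =
      pairSum k a y d ((lineGraph edge).degree e) ((lineGraph edge).degree e') := by
  obtain ⟨hne, v, hve, hve'⟩ := hadj
  let g : Bool → E := fun b => if b then e else e'
  have hg : Function.Injective g := by
    rintro (_ | _) (_ | _) hgg <;> simp [g, hne, hne.symm] at hgg ⊢
  obtain ⟨f, hf, himage, hnone, hsome⟩ := h.exists_twoEdges_enumeration h2 hg (v := v)
    (by rintro (_ | _) <;> simpa [g])
  have hmodel := supportSum_image hk h.card_edge hf hg himage hd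
    (fun v => a * (edgesAt edge v).card) y
  have hrange : Finset.univ.image g = {e, e'} := by
    ext x
    simp [g, eq_comm]
  rw [← hrange, hmodel, pairSum]
  congr 1
  funext p
  rcases p with _ | ⟨_ | _, j⟩
  all_goals simp only [Function.comp_apply, h.loopWeight_eq (h2 _), hnone, hsome, pairProfile]
  all_goals rfl

theorem sum_configTerm (h : IsEdgeTree k edge) (hk : 2 ≤ k) (h2 : ∀ v, (edgesAt edge v).card ≤ 2)
    {d : ℕ} (hd : d ≠ 0) (hdk : d < 3 * k) (a y : ℝ) :
    ∑ n ∈ Finset.piAntidiag Finset.univ d,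
        configTerm k edge (fun v => a * (edgesAt edge v).card) y n =
      Fintype.card V * (vertexCoeff k d * a ^ d) +
        (Fintype.card E - 1) * (vertexCoeff k d * ((2 * a) ^ d - a ^ d)) +
      ∑ e, edgeSum k a y d ((lineGraph edge).degree e) +
      (∑ e, ∑ e' ∈ (lineGraph edge).neighborFinset e,
        pairSum k a y d ((lineGraph edge).degree e) ((lineGraph edge).degree e')) / 2 := by
  rw [sum_configTerm_eq_of_lt_three_mul hk h.card_edge h.flowFree hd hdk,
    h.sum_comp_card_edgesAt h2 fun i => vertexCoeff k d * (a * i) ^ d]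
  have hpairs := Finset.sum_congr rfl fun e (_ : e ∈ Finset.univ) =>
    Finset.sum_congr rfl fun e' (he' : e' ∈ (lineGraph edge).neighborFinset e) =>
      h.supportSum_pair hk h2 hd a y ((SimpleGraph.mem_neighborFinset _ _ _).mp he')
  rw [hpairs]
  simp only [h.supportSum_singleton hk h2 hd]
  push_cast
  ring

end IsEdgeTree

end EdgesAt

section DegreesOfTrees

variable {V : Type*} [Fintype V] {G : SimpleGraph V} [DecidableRel G.Adj]

theorem sum_degree_add_two_of_isTree (hG : G.IsTree) :
    ∑ v, G.degree v + 2 = 2 * Fintype.card V := by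
  classical
  rw [G.sum_degrees_eq_twice_card_edges, ← hG.card_edgeFinset]
  ring

theorem isTree_of_sum_degree_add_two (hG : G.Connected)
    (hsum : ∑ v, G.degree v + 2 = 2 * Fintype.card V) : G.IsTree := by
  classical
  rw [G.sum_degrees_eq_twice_card_edges] at hsum
  rw [SimpleGraph.isTree_iff_connected_and_card, Nat.card_eq_fintype_card,
    Nat.card_eq_fintype_card, ← SimpleGraph.edgeFinset_card]
  exact ⟨hG, by omega⟩

/-- The total amount by which the degrees of the vertices exceed two. -/
def excess (G : SimpleGraph V) [DecidableRel G.Adj] : ℕ := ∑ v, (G.degree v - 2)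

theorem degree_le_excess_add_two (v : V) : G.degree v ≤ excess G + 2 :=
  Nat.sub_le_iff_le_add.mp
    (Finset.single_le_sum (f := fun v => G.degree v - 2) (fun _ _ => Nat.zero_le _)
      (Finset.mem_univ v))

theorem exists_degree_eq_three_of_excess_eq_one (hX : excess G = 1) :
    ∃ c, G.degree c = 3 ∧ ∀ v, v ≠ c → G.degree v ≤ 2 := by
  classical
  obtain ⟨c, -, hc⟩ := Finset.exists_ne_zero_of_sum_ne_zero (hX.trans_ne one_ne_zero)
  rw [excess, ← Finset.add_sum_erase _ _ (Finset.mem_univ c)] at hX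
  refine ⟨c, by omega, fun v hv => ?_⟩
  have hrest : ∑ v ∈ Finset.univ.erase c, (G.degree v - 2) = 0 := by omega
  exact Nat.sub_eq_zero_iff_le.mp (Finset.sum_eq_zero_iff.mp hrest v (by simp [hv]))

theorem sum_comp_degree_eq_interpolation (hG : G.IsTree) (φ : ℕ → ℝ) :
    ∑ v, φ (G.degree v) = Fintype.card V * φ 2 - 2 * (φ 2 - φ 1) +
      ∑ v, (φ (G.degree v) - φ 2 - ((G.degree v : ℝ) - 2) * (φ 2 - φ 1)) := by
  have hsum : ∑ v, (G.degree v : ℝ) + 2 = 2 * Fintype.card V := by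
    exact_mod_cast sum_degree_add_two_of_isTree hG
  rw [Finset.sum_sub_distrib, Finset.sum_sub_distrib, ← Finset.sum_mul, Finset.sum_sub_distrib]
  simp only [Finset.sum_const, Finset.card_univ, nsmul_eq_mul]
  linear_combination (φ 2 - φ 1) * hsum

variable [Nontrivial V]

theorem sum_comp_degree_of_le_three (hG : G.IsTree) (h3 : ∀ v, G.degree v ≤ 3) (φ : ℕ → ℝ) :
    ∑ v, φ (G.degree v) = Fintype.card V * φ 2 - 2 * (φ 2 - φ 1) +
      excess G * (φ 3 - 2 * φ 2 + φ 1) := by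
  rw [sum_comp_degree_eq_interpolation hG, excess, Nat.cast_sum, Finset.sum_mul]
  refine congrArg _ (Finset.sum_congr rfl fun v _ => ?_)
  have hpos := hG.connected.preconnected.degree_pos_of_nontrivial v
  have hle := h3 v
  interval_cases G.degree v <;> norm_num
  ring

theorem le_sum_comp_degree_of_convex {k : ℕ} (hG : G.IsTree) (hk : ∀ v, G.degree v ≤ k)
    {φ : ℕ → ℝ} (hφ : ∀ δ, δ + 2 ≤ k → 0 ≤ φ (δ + 2) - 2 * φ (δ + 1) + φ δ) :
    Fintype.card V * φ 2 - 2 * (φ 2 - φ 1) + excess G * (φ 3 - 2 * φ 2 + φ 1) ≤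
      ∑ v, φ (G.degree v) := by
  have hslope : ∀ δ, δ + 3 ≤ k →
      φ 3 - φ 2 ≤ φ (δ + 3) - φ (δ + 2) ∧ (δ + 1) * (φ 3 - φ 2) ≤ φ (δ + 3) - φ 2 := by
    intro δ
    induction δ with
    | zero => exact fun _ => ⟨le_rfl, by norm_num⟩
    | succ δ ih =>
      intro hδ
      obtain ⟨hlast, htotal⟩ := ih (by omega)
      have hconvex : 0 ≤ φ (δ + 1 + 3) - 2 * φ (δ + 3) + φ (δ + 2) := hφ (δ + 2) (by omega)
      have hlast' : φ 3 - φ 2 ≤ φ (δ + 1 + 3) - φ (δ + 3) := by linarith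
      refine ⟨hlast', ?_⟩
      push_cast
      linarith
  rw [sum_comp_degree_eq_interpolation hG, excess, Nat.cast_sum, Finset.sum_mul]
  refine add_le_add_right (Finset.sum_le_sum fun v _ => ?_) _
  have hpos := hG.connected.preconnected.degree_pos_of_nontrivial v
  have hle := hk v
  rcases Nat.lt_or_ge (G.degree v) 3 with h | h
  · interval_cases G.degree v <;> norm_num
  · obtain ⟨δ, hδ⟩ := Nat.exists_eq_add_of_le' h
    rw [hδ] at hle ⊢
    rw [show δ + 3 - 2 = δ + 1 by omega]
    push_cast
    linarith [(hslope δ hle).2]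

theorem sum_comp_degree_of_affine {k : ℕ} (hG : G.IsTree) (hk : ∀ v, G.degree v ≤ k) {φ : ℕ → ℝ}
    (hφ : ∀ δ, δ + 2 ≤ k → φ (δ + 2) - 2 * φ (δ + 1) + φ δ = 0) :
    ∑ v, φ (G.degree v) = Fintype.card V * φ 2 - 2 * (φ 2 - φ 1) := by
  rcases Nat.lt_or_ge k 3 with hk3 | hk3
  · have hX : excess G = 0 := Finset.sum_eq_zero fun v _ => by have := hk v; omega
    rw [sum_comp_degree_of_le_three hG fun v => (hk v).trans hk3.le, hX, Nat.cast_zero, zero_mul,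
      add_zero]
  · have hsecond := hφ 1 hk3
    have hle := le_sum_comp_degree_of_convex hG hk fun δ hδ => (hφ δ hδ).ge
    have hge := le_sum_comp_degree_of_convex hG hk (φ := fun δ => -φ δ) fun δ hδ => by
      linarith [hφ δ hδ]
    norm_num only [hsecond, mul_zero, Finset.sum_neg_distrib] at hle hge
    rw [show -φ 3 - 2 * -φ 2 + -φ 1 = 0 by linarith] at hge
    linarith

end DegreesOfTrees

section CentralLeaves

variable {V : Type*} [Fintype V] {G : SimpleGraph V} [DecidableRel G.Adj]

theorem not_adj_of_degree_eq_one (hG : G.Connected) (hV : 3 ≤ Fintype.card V) {v w : V}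
    (hv : G.degree v = 1) (hw : G.degree w = 1) : ¬ G.Adj v w := by
  classical
  intro hadj
  have hclosed : ∀ x, G.Reachable v x → x = v ∨ x = w := by
    intro x hx
    rw [SimpleGraph.reachable_iff_reflTransGen] at hx
    induction hx with
    | refl => exact Or.inl rfl
    | tail _ hbc ih =>
      rcases ih with rfl | rfl
      · exact Or.inr ((SimpleGraph.degree_eq_one_iff_existsUnique_adj.mp hv).unique hbc hadj)
      · exact Or.inl ((SimpleGraph.degree_eq_one_iff_existsUnique_adj.mp hw).unique hbc hadj.symm)
  have hsub : (Finset.univ : Finset V) ⊆ {v, w} := fun x _ => by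
    simpa using hclosed x (hG.preconnected v x)
  have := (Finset.card_le_card hsub).trans Finset.card_le_two
  rw [Finset.card_univ] at this
  omega

/-- The leaves that are adjacent to a vertex of degree three. -/
def centralLeaves (G : SimpleGraph V) [DecidableRel G.Adj] : Finset V :=
  Finset.univ.filter fun v => G.degree v = 1 ∧ ∃ w, G.Adj v w ∧ G.degree w = 3

theorem card_centralLeaves_eq_sum : (centralLeaves G).card =
    ∑ v, ∑ w ∈ G.neighborFinset v, if G.degree v = 1 ∧ G.degree w = 3 then 1 else 0 := by
  rw [centralLeaves, Finset.card_filter]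
  refine Finset.sum_congr rfl fun v _ => ?_
  by_cases hv : G.degree v = 1
  · obtain ⟨w, hw⟩ := Finset.card_eq_one.mp ((G.card_neighborFinset_eq_degree v).trans hv)
    have hadj : ∀ x, G.Adj v x ↔ x = w := fun x => by
      rw [← G.mem_neighborFinset, hw, Finset.mem_singleton]
    rw [hw, Finset.sum_singleton]
    simp [hv, hadj]
  · simp [hv]

theorem comp_degree_of_adj (hG : G.Connected) (hV : 3 ≤ Fintype.card V) (hX : excess G = 1)
    {φ : ℕ → ℕ → ℝ} (hφ : ∀ i j, φ i j = φ j i) {v w : V} (hvw : G.Adj v w) :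
    φ (G.degree v) (G.degree w) =
      (φ (G.degree v) 2 - φ 2 2 / 2) + (φ (G.degree w) 2 - φ 2 2 / 2) +
        ((if G.degree v = 1 ∧ G.degree w = 3 then 1 else 0) +
          (if G.degree w = 1 ∧ G.degree v = 3 then 1 else 0)) *
            (φ 3 1 - φ 3 2 - φ 2 1 + φ 2 2) := by
  obtain ⟨c, -, hle⟩ := exists_degree_eq_three_of_excess_eq_one hX
  have : Nontrivial V := Fintype.one_lt_card_iff_nontrivial.mp (by omega)
  have hX3 : ∀ v, G.degree v ≤ 3 := fun v => (degree_le_excess_add_two v).trans_eq (by rw [hX])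
  have hv := hG.preconnected.degree_pos_of_nontrivial v
  have hw := hG.preconnected.degree_pos_of_nontrivial w
  have hv3 := hX3 v
  have hw3 := hX3 w
  have hleaves : ¬ (G.degree v = 1 ∧ G.degree w = 1) := fun h =>
    not_adj_of_degree_eq_one hG hV h.1 h.2 hvw
  have hcentres : ¬ (G.degree v = 3 ∧ G.degree w = 3) := by
    rintro ⟨hv, hw⟩
    have hvc := not_imp_comm.mp (hle v) (by omega)
    have hwc := not_imp_comm.mp (hle w) (by omega)
    exact hvw.ne (hvc.trans hwc.symm)
  interval_cases G.degree v <;> interval_cases G.degree w <;> simp at hleaves hcentres ⊢ <;>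
    linarith [hφ 1 2, hφ 1 3, hφ 2 3]

theorem sum_adj_comp_degree (hG : G.Connected) (hV : 3 ≤ Fintype.card V) (hX : excess G = 1)
    {φ : ℕ → ℕ → ℝ} (hφ : ∀ i j, φ i j = φ j i) :
    ∑ v, ∑ w ∈ G.neighborFinset v, φ (G.degree v) (G.degree w) =
      2 * ∑ v, (G.degree v : ℝ) * (φ (G.degree v) 2 - φ 2 2 / 2) +
        2 * ((centralLeaves G).card * (φ 3 1 - φ 3 2 - φ 2 1 + φ 2 2)) := by
  let ψ : V → ℝ := fun v => φ (G.degree v) 2 - φ 2 2 / 2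
  let χ : V → V → ℝ := fun v w => if G.degree v = 1 ∧ G.degree w = 3 then 1 else 0
  have hsplit : ∀ v, ∀ w ∈ G.neighborFinset v, φ (G.degree v) (G.degree w) =
      ψ v + ψ w + (χ v w + χ w v) * (φ 3 1 - φ 3 2 - φ 2 1 + φ 2 2) := fun v w hvw =>
    comp_degree_of_adj hG hV hX hφ ((G.mem_neighborFinset v w).mp hvw)
  have hswap : ∀ F : V → V → ℝ, ∑ v, ∑ w ∈ G.neighborFinset v, F w v =
      ∑ v, ∑ w ∈ G.neighborFinset v, F v w := fun F =>
    Finset.sum_comm' fun v w => by simp [G.adj_comm]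
  have hψ : ∑ v, ∑ _ ∈ G.neighborFinset v, ψ v = ∑ v, (G.degree v : ℝ) * ψ v := by simp
  have hχ : ∑ v, ∑ w ∈ G.neighborFinset v, χ v w = (centralLeaves G).card := by
    rw [card_centralLeaves_eq_sum]
    push_cast
    rfl
  rw [Finset.sum_congr rfl fun v _ => Finset.sum_congr rfl (hsplit v)]
  simp only [Finset.sum_add_distrib, ← Finset.sum_mul]
  rw [hswap fun v _ => ψ v, hswap χ, hψ, hχ]
  ring

end CentralLeaves

namespace IsEdgeTree

variable {V E V' E' : Type*} [Fintype V] [Fintype E] [Fintype V'] [Fintype E'] {k : ℕ}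
  {edge : E → Finset V} {edge' : E' → Finset V'}

theorem card_vertices_eq (h : IsEdgeTree k edge) (h' : IsEdgeTree k edge')
    (hE : Fintype.card E = Fintype.card E') : Fintype.card V = Fintype.card V' := by
  have hcard := h.card_add
  have hcard' := h'.card_add
  rw [← hE] at hcard'
  omega

variable [DecidableEq V] [DecidableEq V']

/-- Subtracting `3n - 2`, whose sum is determined by the numbers of vertices and edges, from `n²`
leaves `(n - 1) (n - 2)`, which vanishes exactly for `n = 1, 2`. -/
theorem sum_card_edgesAt_sq_lt (h : IsEdgeTree k edge) (h' : IsEdgeTree k edge')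
    (hE : Fintype.card E = Fintype.card E') (h2 : ∀ v, (edgesAt edge v).card ≤ 2)
    (h3 : ∃ v, 2 < (edgesAt edge' v).card) :
    ∑ v, ((edgesAt edge v).card : ℝ) ^ 2 < ∑ v, ((edgesAt edge' v).card : ℝ) ^ 2 := by
  have hV := h.card_vertices_eq h' hE
  have hsum : ∑ v, ((edgesAt edge' v).card : ℝ) = ∑ v, ((edgesAt edge v).card : ℝ) := by
    exact_mod_cast h'.sum_card_edgesAt.trans (hE ▸ h.sum_card_edgesAt.symm)
  have hdefect : ∑ v, (((edgesAt edge v).card : ℝ) - 1) * ((edgesAt edge v).card - 2) = 0 :=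
    Finset.sum_eq_zero fun v _ => by
      rcases h.card_edgesAt_eq_one_or_two (h2 v) with hv | hv <;> norm_num [hv]
  have hdefect' : 0 < ∑ v, (((edgesAt edge' v).card : ℝ) - 1) * ((edgesAt edge' v).card - 2) := by
    refine Finset.sum_pos' (fun v _ => ?_) (h3.imp fun v hv => ⟨Finset.mem_univ v, ?_⟩)
    · rcases Nat.lt_or_ge 2 (edgesAt edge' v).card with hv | hv
      · have : (2 : ℝ) < (edgesAt edge' v).card := by exact_mod_cast hv
        exact mul_nonneg (by linarith) (by linarith)
      · rcases h'.card_edgesAt_eq_one_or_two hv with hv | hv <;> norm_num [hv]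
    · have : (2 : ℝ) < (edgesAt edge' v).card := by exact_mod_cast hv
      exact mul_pos (by linarith) (by linarith)
  have hsq : ∀ n : ℕ, (n : ℝ) ^ 2 = ((n : ℝ) - 1) * (n - 2) + (3 * n - 2) := fun n => by ring
  rw [Finset.sum_congr rfl fun v _ => hsq _, Finset.sum_congr rfl fun v _ => hsq _,
    Finset.sum_add_distrib, Finset.sum_add_distrib, hdefect]
  simp only [Finset.sum_sub_distrib, ← Finset.mul_sum, hsum, Finset.sum_const, Finset.card_univ,
    hV]
  linarith

end IsEdgeTree

section MomentSum

variable {V E : Type*} [Fintype V] [DecidableEq V] [Fintype E] {k : ℕ} {edge : E → Finset V}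

theorem IsEdgeTree.isTree_lineGraph (h : IsEdgeTree k edge)
    (h2 : ∀ v, (edgesAt edge v).card ≤ 2) : (lineGraph edge).IsTree := by
  classical
  exact isTree_of_sum_degree_add_two h.connected (h.sum_degree_lineGraph h2)

variable [DecidableEq E]

/-- The `d`-th trace of `𝒜_a`, up to its normalising power of `k - 1`, for the `k`-uniform
hypergraph with the hyperedges `edge e`. -/
noncomputable def momentSum (k : ℕ) (edge : E → Finset V) (a : ℝ) (d : ℕ) : ℝ :=
  ∑ n ∈ Finset.piAntidiag Finset.univ d,
    configTerm k edge (fun v => a * (edgesAt edge v).card) (1 - a) n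

theorem momentSum_zero (k : ℕ) (edge : E → Finset V) (a : ℝ) :
    momentSum k edge a 0 = Fintype.card V := by
  rw [momentSum, Finset.piAntidiag_zero, Finset.sum_singleton]
  simp [configTerm, configCoeff, configArcs, expFactorial, closedWalkCount, walkCount_zero]

variable {V' E' : Type*} [Fintype V'] [DecidableEq V'] [Fintype E'] [DecidableEq E']
  {edge' : E' → Finset V'}

/-- The traces of `𝒜_a` for `edge` and `edge'` first differ at the order `d`, where that of `edge`
is smaller. Order `0` is left out, since there the trace only counts the vertices. -/
def MomentLTAt (k : ℕ) (a : ℝ) (d : ℕ) (edge : E → Finset V) (edge' : E' → Finset V') : Prop :=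
  (∀ t, t ≠ 0 → t < d → momentSum k edge a t = momentSum k edge' a t) ∧
    momentSum k edge a d < momentSum k edge' a d

namespace IsEdgeTree

theorem degree_lineGraph_le (h : IsEdgeTree k edge) (h2 : ∀ v, (edgesAt edge v).card ≤ 2) (e : E) :
    (lineGraph edge).degree e ≤ k := by
  rw [← h.card_filter_eq_degree h2, ← h.card_edge e]
  exact Finset.card_filter_le _ _

theorem momentSum_eq_of_lt_two_mul (h : IsEdgeTree k edge) (hk : 2 ≤ k)
    (h2 : ∀ v, (edgesAt edge v).card ≤ 2) {d : ℕ} (hd : d ≠ 0) (hdk : d < 2 * k) (a : ℝ) :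
    momentSum k edge a d = Fintype.card V * (vertexCoeff k d * a ^ d) +
        (Fintype.card E - 1) * (vertexCoeff k d * ((2 * a) ^ d - a ^ d)) +
      ∑ e, edgeSum k a (1 - a) d ((lineGraph edge).degree e) := by
  rw [momentSum, h.sum_configTerm hk h2 hd (by omega)]
  simp only [pairSum_eq_zero (by omega : 1 ≤ k) hdk, Finset.sum_const_zero, zero_div, add_zero]

theorem momentLTAt_two (h : IsEdgeTree k edge) (h' : IsEdgeTree k edge') (hk : 3 ≤ k)
    (hE : Fintype.card E = Fintype.card E') (h2 : ∀ v, (edgesAt edge v).card ≤ 2)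
    (h3 : ∃ v, 2 < (edgesAt edge' v).card) {a : ℝ} (ha : 0 < a) :
    MomentLTAt k a 2 edge edge' := by
  constructor
  · intro t ht ht2
    obtain rfl : t = 1 := by omega
    rw [momentSum, momentSum, sum_configTerm_of_lt (by omega) h.card_edge h.flowFree ht (by omega),
      sum_configTerm_of_lt (by omega) h'.card_edge h'.flowFree ht (by omega)]
    simp only [pow_one, ← Finset.mul_sum]
    rw [← Nat.cast_sum, ← Nat.cast_sum, h.sum_card_edgesAt, h'.sum_card_edgesAt, hE]
  · rw [momentSum, momentSum, sum_configTerm_of_lt (by omega) h.card_edge h.flowFree (by omega) hk,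
      sum_configTerm_of_lt (by omega) h'.card_edge h'.flowFree (by omega) hk]
    simp only [mul_pow, ← Finset.mul_sum]
    exact mul_lt_mul_of_pos_left (mul_lt_mul_of_pos_left (h.sum_card_edgesAt_sq_lt h' hE h2 h3)
      (by positivity)) (vertexCoeff_pos k 2)

theorem momentLTAt_of_excess_lt [Nontrivial E] (h : IsEdgeTree k edge) (h' : IsEdgeTree k edge')
    (hk : 3 ≤ k) (hE : Fintype.card E = Fintype.card E')
    (h2 : ∀ v, (edgesAt edge v).card ≤ 2) (h2' : ∀ v, (edgesAt edge' v).card ≤ 2)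
    (hX : excess (lineGraph edge) ≤ 1) (hlt : excess (lineGraph edge) < excess (lineGraph edge'))
    {a : ℝ} (ha : 0 < a) (ha1 : a < 1) : MomentLTAt k a (k + 2) edge edge' := by
  have : Nontrivial E' := (Fintype.equivOfCardEq hE).nontrivial_congr.mp inferInstance
  have hdegree := h.degree_lineGraph_le h2
  have hdegree' := h'.degree_lineGraph_le h2'
  refine ⟨fun t ht htk => ?_, ?_⟩
  · have haffine := fun δ => edgeSum_affine (a := a) (y := 1 - a) (δ := δ) (by omega) ht htk
    rw [h.momentSum_eq_of_lt_two_mul (by omega) h2 ht (by omega),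
      h'.momentSum_eq_of_lt_two_mul (by omega) h2' ht (by omega),
      sum_comp_degree_of_affine (h.isTree_lineGraph h2) hdegree haffine,
      sum_comp_degree_of_affine (h'.isTree_lineGraph h2') hdegree' haffine,
      h.card_vertices_eq h' hE, hE]
  · have hconvex := fun δ => edgeSum_convex (a := a) (y := 1 - a) (δ := δ) (k := k) (by omega) ha
      (sub_pos.mpr ha1)
    rw [h.momentSum_eq_of_lt_two_mul (by omega) h2 (by omega) (by omega),
      h'.momentSum_eq_of_lt_two_mul (by omega) h2' (by omega) (by omega),
      h.card_vertices_eq h' hE, hE,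
      sum_comp_degree_of_le_three (h.isTree_lineGraph h2) fun e =>
        (degree_le_excess_add_two e).trans (by omega), hE]
    refine add_lt_add_right (lt_of_lt_of_le (add_lt_add_right ?_ _)
      (le_sum_comp_degree_of_convex (h'.isTree_lineGraph h2') hdegree' fun δ hδ =>
        (hconvex δ hδ).le)) _
    exact mul_lt_mul_of_pos_right (by exact_mod_cast hlt) (hconvex 1 hk)

theorem momentSum_sub_of_excess_eq_one (h : IsEdgeTree k edge) (h' : IsEdgeTree k edge')
    (hk : 2 ≤ k) (hE : Fintype.card E = Fintype.card E') (hm : 3 ≤ Fintype.card E)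
    (h2 : ∀ v, (edgesAt edge v).card ≤ 2) (h2' : ∀ v, (edgesAt edge' v).card ≤ 2)
    (hX : excess (lineGraph edge) = 1) (hX' : excess (lineGraph edge') = 1)
    {d : ℕ} (hd : d ≠ 0) (hdk : d < 3 * k) (a : ℝ) :
    momentSum k edge a d - momentSum k edge' a d =
      ((centralLeaves (lineGraph edge)).card - (centralLeaves (lineGraph edge')).card) *
        (pairSum k a (1 - a) d 3 1 - pairSum k a (1 - a) d 3 2 -
          pairSum k a (1 - a) d 2 1 + pairSum k a (1 - a) d 2 2) := by
  have : Nontrivial E := Fintype.one_lt_card_iff_nontrivial.mp (by omega)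
  have : Nontrivial E' := (Fintype.equivOfCardEq hE).nontrivial_congr.mp inferInstance
  have hcomm : ∀ i j, pairSum k a (1 - a) d i j = pairSum k a (1 - a) d j i := fun _ _ =>
    pairSum_comm hk hd
  have hsum : ∀ φ : ℕ → ℝ, ∑ e, φ ((lineGraph edge).degree e) =
      ∑ e, φ ((lineGraph edge').degree e) := fun φ => by
    rw [sum_comp_degree_of_le_three (h.isTree_lineGraph h2) (fun e =>
        (degree_le_excess_add_two e).trans_eq (by rw [hX])),
      sum_comp_degree_of_le_three (h'.isTree_lineGraph h2') (fun e =>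
        (degree_le_excess_add_two e).trans_eq (by rw [hX'])), hX, hX', hE]
  rw [momentSum, momentSum, h.sum_configTerm hk h2 hd hdk, h'.sum_configTerm hk h2' hd hdk,
    sum_adj_comp_degree h.connected hm hX hcomm,
    sum_adj_comp_degree h'.connected (hE ▸ hm) hX' hcomm, h.card_vertices_eq h' hE, hE, hsum,
    hsum fun δ => δ * (pairSum k a (1 - a) d δ 2 - pairSum k a (1 - a) d 2 2 / 2)]
  ring

theorem momentLTAt_of_card_centralLeaves_lt (h : IsEdgeTree k edge) (h' : IsEdgeTree k edge')
    (hk : 3 ≤ k) (hE : Fintype.card E = Fintype.card E') (hm : 3 ≤ Fintype.card E)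
    (h2 : ∀ v, (edgesAt edge v).card ≤ 2) (h2' : ∀ v, (edgesAt edge' v).card ≤ 2)
    (hX : excess (lineGraph edge) = 1) (hX' : excess (lineGraph edge') = 1)
    (hlt : (centralLeaves (lineGraph edge')).card < (centralLeaves (lineGraph edge)).card)
    {a : ℝ} (ha : 0 < a) (ha1 : a < 1) : MomentLTAt k a (2 * k + 2) edge edge' := by
  have hsub := fun d hd hdk => h.momentSum_sub_of_excess_eq_one h' (d := d) (by omega) hE hm h2 h2'
    hX hX' hd hdk a
  refine ⟨fun t ht htk => sub_eq_zero.mp ?_, sub_neg.mp ?_⟩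
  · rw [hsub t ht (by omega)]
    have hadd := pairSum_additive (a := a) (y := 1 - a) (δ := 1) (δ' := 0) (by omega) htk
      (by omega) (by omega)
    exact mul_eq_zero_of_right _ (by linarith)
  · rw [hsub _ (by omega) (by omega)]
    have hsuper := pairSum_supermodular (k := k) (δ := 1) (δ' := 0) ha (sub_pos.mpr ha1)
      (by omega) (by omega)
    exact mul_neg_of_pos_of_neg (sub_pos.mpr (by exact_mod_cast hlt)) (by linarith)

end IsEdgeTree

end MomentSum

/-- Pairing a flow `x` with the potential differences `p v - q e` gives `0`, and only the incidence
`(v₀, e₀)` contributes. -/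
theorem isFlowFree_of_potentials {V E : Type*} [Fintype V] [Fintype E] {edge : E → Finset V}
    (h : ∀ v₀ e₀, v₀ ∈ edge e₀ → ∃ (p : V → ℤ) (q : E → ℤ), p v₀ ≠ q e₀ ∧
      ∀ v e, v ∈ edge e → (v, e) ≠ (v₀, e₀) → p v = q e) : IsFlowFree edge := by
  intro x hsupp he hv v₀ e₀
  by_cases hmem : v₀ ∈ edge e₀
  swap
  · exact hsupp _ _ hmem
  obtain ⟨p, q, hne, hpq⟩ := h v₀ e₀ hmem
  have hpairing : ∑ v, ∑ e, x v e * (p v - q e) = 0 := by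
    simp only [mul_sub, Finset.sum_sub_distrib]
    rw [Finset.sum_comm (f := fun v e => x v e * q e)]
    simp only [← Finset.sum_mul, hv, he, zero_mul, Finset.sum_const_zero, sub_zero]
  have hterm : ∀ v e, (v, e) ≠ (v₀, e₀) → x v e * (p v - q e) = 0 := by
    intro v e hve
    by_cases hm : v ∈ edge e
    · rw [hpq v e hm hve, sub_self, mul_zero]
    · rw [hsupp v e hm, zero_mul]
  rw [Fintype.sum_eq_single v₀ fun v hv => Finset.sum_eq_zero fun e _ =>
      hterm v e fun h => hv (congrArg Prod.fst h),
    Fintype.sum_eq_single e₀ fun e he => hterm v₀ e fun h => he (congrArg Prod.snd h)] at hpairing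
  exact (mul_eq_zero.mp hpairing).resolve_right (sub_ne_zero.mpr hne)

section Incidence

variable {U : Type*} {H : Hypergraph U}

theorem not_incidenceGraph_adj_inl_inl {v w : ↥H.vertexSet} :
    ¬ H.incidenceGraph.Adj (.inl v) (.inl w) := id

theorem not_incidenceGraph_adj_inr_inr {e f : ↥H.edgeSet} :
    ¬ H.incidenceGraph.Adj (.inr e) (.inr f) := id

variable [Finite U]

theorem incidenceGraph_adj_inl_inr {v : ↥H.vertexSet} {e : ↥H.edgeSet} :
    H.incidenceGraph.Adj (.inl v) (.inr e) ↔ v ∈ edgeVerts H e := by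
  rw [mem_edgeVerts]; rfl

theorem incidenceGraph_adj_inr_inl {v : ↥H.vertexSet} {e : ↥H.edgeSet} :
    H.incidenceGraph.Adj (.inr e) (.inl v) ↔ v ∈ edgeVerts H e := by
  rw [mem_edgeVerts]; rfl

theorem incidenceGraph_deleteEdges_adj {v v₀ : ↥H.vertexSet} {e e₀ : ↥H.edgeSet}
    (hve : v ∈ edgeVerts H e) (hne : (v, e) ≠ (v₀, e₀)) :
    (H.incidenceGraph.deleteEdges {s(.inl v₀, .inr e₀)}).Adj (.inl v) (.inr e) := by
  rw [SimpleGraph.deleteEdges_adj]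
  exact ⟨incidenceGraph_adj_inl_inr.mpr hve, by simpa using hne⟩

theorem not_reachable_incidenceGraph_deleteEdges (hH : H.incidenceGraph.IsAcyclic)
    {v : ↥H.vertexSet} {e : ↥H.edgeSet} (hve : v ∈ edgeVerts H e) :
    ¬ (H.incidenceGraph.deleteEdges {s(.inl v, .inr e)}).Reachable (.inl v) (.inr e) :=
  SimpleGraph.isBridge_iff.mp
    (SimpleGraph.isAcyclic_iff_forall_adj_isBridge.mp hH (incidenceGraph_adj_inl_inr.mpr hve))

theorem eq_of_mem_edgeVerts (hH : H.incidenceGraph.IsAcyclic) {e e' : ↥H.edgeSet} (hne : e ≠ e')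
    {v w : ↥H.vertexSet} (hv : v ∈ edgeVerts H e) (hv' : v ∈ edgeVerts H e')
    (hw : w ∈ edgeVerts H e) (hw' : w ∈ edgeVerts H e') : v = w := by
  by_contra hvw
  refine not_reachable_incidenceGraph_deleteEdges hH hv ?_
  have hve' := incidenceGraph_deleteEdges_adj (v₀ := v) (e₀ := e) hv' (by simp [hne.symm])
  have hwe' := incidenceGraph_deleteEdges_adj (v₀ := v) (e₀ := e) hw' (by simp [hne.symm])
  have hwe := incidenceGraph_deleteEdges_adj (v₀ := v) (e₀ := e) hw (by simp [Ne.symm hvw])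
  exact (hve'.reachable.trans hwe'.symm.reachable).trans hwe.reachable

theorem isFlowFree_edgeVerts [Fintype ↥H.vertexSet] [Fintype ↥H.edgeSet]
    (hH : H.incidenceGraph.IsAcyclic) : IsFlowFree (edgeVerts H) := by
  classical
  refine isFlowFree_of_potentials fun v₀ e₀ hmem => ?_
  let G := H.incidenceGraph.deleteEdges {s(.inl v₀, .inr e₀)}
  refine ⟨fun v => if G.Reachable (.inl v₀) (.inl v) then 1 else 0,
    fun e => if G.Reachable (.inl v₀) (.inr e) then 1 else 0, ?_, fun v e hve hne => ?_⟩
  · have hcut : ¬ G.Reachable (.inl v₀) (.inr e₀) :=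
      not_reachable_incidenceGraph_deleteEdges hH hmem
    simp [hcut]
  · have hadj : G.Adj (.inl v) (.inr e) := incidenceGraph_deleteEdges_adj hve hne
    have hiff : G.Reachable (.inl v₀) (.inl v) ↔ G.Reachable (.inl v₀) (.inr e) :=
      ⟨fun h => h.trans hadj.reachable, fun h => h.trans hadj.symm.reachable⟩
    simp only [hiff]

theorem exists_mem_edgeVerts [Nonempty ↥H.edgeSet] (hH : H.incidenceGraph.Connected)
    (v : ↥H.vertexSet) : ∃ e, v ∈ edgeVerts H e := by
  have e₀ : ↥H.edgeSet := Classical.arbitrary _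
  have : Nontrivial (↥H.vertexSet ⊕ ↥H.edgeSet) := ⟨.inl v, .inr e₀, by simp⟩
  obtain ⟨w | e, hw⟩ := hH.preconnected.exists_adj_of_nontrivial (.inl v)
  · exact absurd hw not_incidenceGraph_adj_inl_inl
  · exact ⟨e, incidenceGraph_adj_inl_inr.mp hw⟩

theorem connected_lineGraph_edgeVerts [Nonempty ↥H.edgeSet] (hH : H.incidenceGraph.Connected) :
    (lineGraph (edgeVerts H)).Connected := by
  refine ⟨fun e e' => ?_⟩
  let reached : ↥H.vertexSet ⊕ ↥H.edgeSet → Prop :=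
    Sum.elim (fun v => ∀ f, v ∈ edgeVerts H f → (lineGraph (edgeVerts H)).Reachable e f)
      fun f => (lineGraph (edgeVerts H)).Reachable e f
  have hstep : ∀ p q, H.incidenceGraph.Adj p q → reached p → reached q := by
    rintro (v | f) (w | f') hadj hp
    · exact absurd hadj not_incidenceGraph_adj_inl_inl
    · exact hp f' (incidenceGraph_adj_inl_inr.mp hadj)
    · intro f' hf'
      by_cases hff : f = f'
      · exact hff ▸ hp
      · exact hp.trans
          (SimpleGraph.Adj.reachable ⟨hff, w, incidenceGraph_adj_inr_inl.mp hadj, hf'⟩)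
    · exact absurd hadj not_incidenceGraph_adj_inr_inr
  have hall : ∀ q, H.incidenceGraph.Reachable (.inr e) q → reached q := by
    intro q hq
    rw [SimpleGraph.reachable_iff_reflTransGen] at hq
    induction hq with
    | refl => exact SimpleGraph.Reachable.refl _
    | tail _ hadj ih => exact hstep _ _ hadj ih
  exact hall _ (hH.preconnected (.inr e) (.inr e'))

theorem degree_incidenceGraph_inr (e : ↥H.edgeSet)
    [Fintype (H.incidenceGraph.neighborSet (.inr e))] :
    H.incidenceGraph.degree (.inr e) = (edgeVerts H e).card := by
  rw [← SimpleGraph.card_neighborFinset_eq_degree,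
    ← Finset.card_map (Function.Embedding.inl (β := ↥H.edgeSet)) (s := edgeVerts H e)]
  refine congrArg Finset.card (Finset.ext ?_)
  rintro (w | f)
  · simp [incidenceGraph_adj_inr_inl]
  · simp [not_incidenceGraph_adj_inr_inr]

variable [Fintype ↥H.edgeSet]

theorem card_edgesAt_edgeVerts [DecidableEq ↥H.vertexSet] (v : ↥H.vertexSet) :
    (edgesAt (edgeVerts H) v).card = H.degree v := by
  rw [degree, ← Set.ncard_coe_finset, ← Set.ncard_image_of_injective _ Subtype.val_injective]
  congr 1
  ext e
  simp [mem_edgesAt, and_comm]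

theorem degree_incidenceGraph_inl [DecidableEq ↥H.vertexSet] (v : ↥H.vertexSet)
    [Fintype (H.incidenceGraph.neighborSet (.inl v))] :
    H.incidenceGraph.degree (.inl v) = (edgesAt (edgeVerts H) v).card := by
  rw [← SimpleGraph.card_neighborFinset_eq_degree,
    ← Finset.card_map (Function.Embedding.inr (α := ↥H.vertexSet)) (s := edgesAt _ v)]
  refine congrArg Finset.card (Finset.ext ?_)
  rintro (w | e)
  · simp [not_incidenceGraph_adj_inl_inl]
  · simp [incidenceGraph_adj_inl_inr, mem_edgesAt]

theorem sum_degree_incidenceGraph [Fintype ↥H.vertexSet] [DecidableRel H.incidenceGraph.Adj] :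
    ∑ x, H.incidenceGraph.degree x = 2 * ∑ e, (edgeVerts H e).card := by
  classical
  rw [Fintype.sum_sum_type]
  simp only [degree_incidenceGraph_inl, degree_incidenceGraph_inr]
  rw [sum_card_edgesAt_eq_sum_card, two_mul]

end Incidence

theorem not_alphaEq_of_alphaLT {U W : Type*} [Finite U] [Finite W] {H : Hypergraph U}
    {K : Hypergraph W} {k : ℕ} {a : ℝ} (h : AlphaLT k a H K) : ¬ AlphaEq k a H K := by
  rintro ⟨-, heq⟩
  obtain ⟨-, d, hd, hle, -, hlt⟩ := h
  exact hlt.ne (heq d (by omega))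

section IsUniformHypertree

variable {U W : Type*} {H : Hypergraph U} {K : Hypergraph W} {k m : ℕ}

theorem card_edgeSet [Fintype ↥H.edgeSet] (h : H.IsUniformHypertree k m) :
    Fintype.card ↥H.edgeSet = m := by
  have hcard := h.card_edges
  rw [Set.encard_eq_coe_toFinset_card, Set.toFinset_card] at hcard
  exact_mod_cast hcard

theorem isEdgeTree [Finite U] [Fintype ↥H.vertexSet] [Fintype ↥H.edgeSet]
    (h : H.IsUniformHypertree k m) (hm : 1 ≤ m) : IsEdgeTree k (edgeVerts H) := by
  classical
  have : Nonempty ↥H.edgeSet := Fintype.card_pos_iff.mp (by rw [card_edgeSet h]; omega)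
  refine ⟨card_edgeVerts h.uniform, isFlowFree_edgeVerts h.isTree.isAcyclic,
    fun _ _ hne _ _ => eq_of_mem_edgeVerts h.isTree.isAcyclic hne, ?_,
    exists_mem_edgeVerts h.isTree.connected, connected_lineGraph_edgeVerts h.isTree.connected⟩
  have hsum := sum_degree_add_two_of_isTree h.isTree
  rw [sum_degree_incidenceGraph, Fintype.card_sum,
    Finset.sum_congr rfl fun e _ => card_edgeVerts h.uniform e, Finset.sum_const, smul_eq_mul,
    Finset.card_univ, mul_comm _ k] at hsum
  omega

theorem two_mul_add_two_lt_ncard_vertexSet [Finite U] (hk : 3 ≤ k) (hm : 4 ≤ m)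
    (h : H.IsUniformHypertree k m) : 2 * k + 2 < H.vertexSet.ncard := by
  have := Fintype.ofFinite ↥H.vertexSet
  have := Fintype.ofFinite ↥H.edgeSet
  have hcard := (isEdgeTree h (by omega)).card_add
  rw [card_edgeSet h] at hcard
  rw [Set.ncard_eq_toFinset_card', Set.toFinset_card]
  nlinarith [Nat.mul_le_mul hk hm]

variable [Finite U] [Finite W] [Fintype ↥H.vertexSet] [Fintype ↥H.edgeSet] [Fintype ↥K.vertexSet]
  [Fintype ↥K.edgeSet]

theorem alphaMoment_eq_momentSum [DecidableEq ↥H.vertexSet] [DecidableEq ↥H.edgeSet]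
    (h : H.IsUniform k) (a : ℝ) (d : ℕ) :
    H.alphaMoment k a d =
      ((k : ℝ) - 1) ^ (Fintype.card ↥H.vertexSet - 1) * momentSum k (edgeVerts H) a d := by
  rw [alphaMoment_eq_sum_configTerm h, momentSum]
  simp only [card_edgesAt_edgeVerts]

theorem alphaLT_of_momentLTAt [DecidableEq ↥H.vertexSet] [DecidableEq ↥H.edgeSet]
    [DecidableEq ↥K.vertexSet] [DecidableEq ↥K.edgeSet] (hk : 3 ≤ k) (hm : 4 ≤ m)
    (hH : H.IsUniformHypertree k m) (hK : K.IsUniformHypertree k m) {a : ℝ} {d : ℕ} (hd : 1 ≤ d)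
    (hd' : d ≤ 2 * k + 2) (h : MomentLTAt k a d (edgeVerts H) (edgeVerts K)) :
    AlphaLT k a H K := by
  have hV := (isEdgeTree hH (by omega)).card_vertices_eq (isEdgeTree hK (by omega))
    (by rw [card_edgeSet hH, card_edgeSet hK])
  have hncard : H.vertexSet.ncard = Fintype.card ↥H.vertexSet := by
    rw [Set.ncard_eq_toFinset_card', Set.toFinset_card]
  have hncard' : K.vertexSet.ncard = Fintype.card ↥K.vertexSet := by
    rw [Set.ncard_eq_toFinset_card', Set.toFinset_card]
  refine ⟨by rw [hncard, hncard', hV], d, hd, ?_, fun t ht => ?_, ?_⟩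
  · have hlarge := two_mul_add_two_lt_ncard_vertexSet hk hm hH
    have := Nat.le_mul_of_pos_right H.vertexSet.ncard
      (Nat.one_le_pow (H.vertexSet.ncard - 1) (k - 1) (by omega))
    omega
  · rw [alphaMoment_eq_momentSum hH.uniform, alphaMoment_eq_momentSum hK.uniform, hV]
    rcases eq_or_ne t 0 with rfl | ht'
    · rw [momentSum_zero, momentSum_zero, hV]
    · rw [h.1 t ht' ht]
  · rw [alphaMoment_eq_momentSum hH.uniform, alphaMoment_eq_momentSum hK.uniform, hV]
    refine mul_lt_mul_of_pos_left h.2 (pow_pos ?_ _)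
    have : (3 : ℝ) ≤ k := by exact_mod_cast hk
    linarith

end IsUniformHypertree

section MaxDegreeTwo

variable {V : Type*} {G : SimpleGraph V}

theorem eq_or_eq_or_eq_of_degree_le_two {v : V} [Fintype (G.neighborSet v)] (h : G.degree v ≤ 2)
    {x y z : V} (hx : G.Adj v x) (hy : G.Adj v y) (hz : G.Adj v z) : x = y ∨ x = z ∨ y = z := by
  by_contra! hne
  have := Finset.two_lt_card_iff.mpr ⟨x, y, z, (G.mem_neighborFinset v x).mpr hx,
    (G.mem_neighborFinset v y).mpr hy, (G.mem_neighborFinset v z).mpr hz, hne⟩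
  rw [G.card_neighborFinset_eq_degree] at this
  omega

theorem eq_of_degree_le_one {v : V} [Fintype (G.neighborSet v)] (h : G.degree v ≤ 1) {x y : V}
    (hx : G.Adj v x) (hy : G.Adj v y) : x = y :=
  Finset.card_le_one.mp ((G.card_neighborFinset_eq_degree v).trans_le h) x (by simpa) y (by simpa)

theorem exists_adj_dist_eq (hG : G.Connected) {l v : V} {n : ℕ} (hv : G.dist l v = n + 1) :
    ∃ w, G.Adj v w ∧ G.dist l w = n := by
  obtain ⟨p, hp⟩ := hG.exists_walk_length_eq_dist v l
  cases p with
  | nil => simp at hv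
  | @cons _ w _ hadj q =>
    refine ⟨w, hadj, ?_⟩
    rw [SimpleGraph.dist_comm, hv, SimpleGraph.Walk.length_cons] at hp
    have hle : G.dist l w ≤ n := by
      rw [SimpleGraph.dist_comm]
      exact (SimpleGraph.dist_le q).trans (by omega)
    have htriangle := hG.dist_triangle (u := l) (v := w) (w := v)
    rw [hv, SimpleGraph.dist_eq_one_iff_adj.mpr hadj.symm] at htriangle
    omega

theorem adj_iff_of_dist_injective (hG : G.Connected) {l : V} (hinj : Function.Injective (G.dist l))
    {v w : V} : G.Adj v w ↔ G.dist l v + 1 = G.dist l w ∨ G.dist l w + 1 = G.dist l v := by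
  have hadj : ∀ v w, G.dist l v + 1 = G.dist l w → G.Adj v w := by
    intro v w hvw
    obtain ⟨u, hu, hu'⟩ := exists_adj_dist_eq hG hvw.symm
    exact hinj hu' ▸ hu.symm
  refine ⟨fun h => ?_, fun h => h.elim (hadj v w) fun h => (hadj w v h).symm⟩
  have hne : G.dist l v ≠ G.dist l w := hinj.ne h.ne
  have := h.diff_dist_adj (u := l)
  omega

variable [G.LocallyFinite]

theorem dist_injective_of_degree_le_two (hG : G.Connected) {l : V} (hl : G.degree l ≤ 1)
    (h2 : ∀ v, G.degree v ≤ 2) : Function.Injective (G.dist l) := by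
  have key : ∀ n v w, G.dist l v = n → G.dist l w = n → v = w := by
    intro n
    induction n with
    | zero =>
      intro v w hv hw
      rw [← hG.dist_eq_zero_iff.mp hv, ← hG.dist_eq_zero_iff.mp hw]
    | succ n ih =>
      intro v w hv hw
      obtain ⟨v', hvv, hv'⟩ := exists_adj_dist_eq hG hv
      obtain ⟨w', hww, hw'⟩ := exists_adj_dist_eq hG hw
      obtain rfl := ih v' w' hv' hw'
      cases n with
      | zero =>
        obtain rfl := hG.dist_eq_zero_iff.mp hv'
        exact eq_of_degree_le_one hl hvv.symm hww.symm
      | succ n =>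
        obtain ⟨u, hu, hu'⟩ := exists_adj_dist_eq hG hv'
        rcases eq_or_eq_or_eq_of_degree_le_two (h2 v') hvv.symm hww.symm hu with h | rfl | rfl
        · exact h
        · omega
        · omega
  exact fun v w h => key _ v w h rfl

theorem exists_iso_pathGraph_of_degree_le_two [Fintype V] (hG : G.Connected) {l : V}
    (hl : G.degree l ≤ 1) (h2 : ∀ v, G.degree v ≤ 2) {n : ℕ} (hn : Fintype.card V = n) :
    ∃ f : G ≃g SimpleGraph.pathGraph n, ∀ v, (f v : ℕ) = G.dist l v := by
  subst hn
  have hinj := dist_injective_of_degree_le_two hG hl h2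
  have hlt : ∀ v, G.dist l v < Fintype.card V := by
    intro v
    obtain ⟨p, hp, hlength⟩ := hG.exists_path_of_dist l v
    exact hlength ▸ hp.length_lt
  let g : V → Fin (Fintype.card V) := fun v => ⟨G.dist l v, hlt v⟩
  have hg : Function.Bijective g := (Fintype.bijective_iff_injective_and_card g).mpr
    ⟨fun v w h => hinj (congrArg Fin.val h), by rw [Fintype.card_fin]⟩
  refine ⟨⟨Equiv.ofBijective g hg, fun {v w} => ?_⟩, fun v => rfl⟩
  rw [SimpleGraph.pathGraph_adj, adj_iff_of_dist_injective hG hinj]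
  rfl

end MaxDegreeTwo

section ForkGraph

/-- The path with `n` vertices, and one more vertex that is joined to its second vertex; this is
the line graph of `F_{n+1,k}`. -/
def forkGraph (n : ℕ) : SimpleGraph (Option (Fin n)) where
  Adj
    | some i, some j => (i : ℕ) + 1 = j ∨ (j : ℕ) + 1 = i
    | some i, none => (i : ℕ) = 1
    | none, some j => (j : ℕ) = 1
    | none, none => False
  symm := ⟨by rintro (_ | i) (_ | j) h <;> first | exact h | exact h.symm⟩
  loopless := ⟨by
    rintro (_ | i) h
    · exact h
    · change (i : ℕ) + 1 = i ∨ (i : ℕ) + 1 = i at h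
      omega⟩

variable {n : ℕ}

theorem forkGraph_adj_some_some {i j : Fin n} :
    (forkGraph n).Adj (some i) (some j) ↔ (i : ℕ) + 1 = j ∨ (j : ℕ) + 1 = i := Iff.rfl

theorem forkGraph_adj_none_some {i : Fin n} : (forkGraph n).Adj none (some i) ↔ (i : ℕ) = 1 :=
  Iff.rfl

theorem forkGraph_adj_some_none {i : Fin n} : (forkGraph n).Adj (some i) none ↔ (i : ℕ) = 1 :=
  Iff.rfl

theorem connected_forkGraph (hn : 2 ≤ n) : (forkGraph n).Connected := by
  obtain ⟨n, rfl⟩ := Nat.exists_eq_add_of_le' hn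
  let f : SimpleGraph.pathGraph (n + 2) →g forkGraph (n + 2) :=
    ⟨some, fun h => SimpleGraph.pathGraph_adj.mp h⟩
  have hreach : ∀ o, (forkGraph (n + 2)).Reachable (some 1) o := by
    rintro (_ | i)
    · exact SimpleGraph.Adj.reachable (forkGraph_adj_some_none.mpr rfl)
    · exact (SimpleGraph.pathGraph_preconnected _ 1 i).map f
  exact (SimpleGraph.connected_iff _).mpr ⟨fun o o' => (hreach o).symm.trans (hreach o'), ⟨none⟩⟩

section Degree

variable [(forkGraph n).LocallyFinite]

theorem degree_forkGraph_none (hn : 2 ≤ n) : (forkGraph n).degree none = 1 := by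
  rw [SimpleGraph.degree_eq_one_iff_existsUnique_adj]
  refine ⟨some ⟨1, hn⟩, rfl, ?_⟩
  rintro (_ | i) h
  · exact h.elim
  · exact congrArg some (Fin.ext h)

theorem degree_forkGraph_zero (hn : 2 ≤ n) :
    (forkGraph n).degree (some ⟨0, by omega⟩) = 1 := by
  rw [SimpleGraph.degree_eq_one_iff_existsUnique_adj]
  refine ⟨some ⟨1, hn⟩, Or.inl rfl, ?_⟩
  rintro (_ | i) h
  · exact absurd (forkGraph_adj_some_none.mp h) (by simp)
  · change 0 + 1 = (i : ℕ) ∨ (i : ℕ) + 1 = 0 at h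
    exact congrArg some (Fin.ext (show (i : ℕ) = 1 by omega))

theorem degree_forkGraph_one (hn : 3 ≤ n) : (forkGraph n).degree (some ⟨1, by omega⟩) = 3 := by
  have hneighbors : (forkGraph n).neighborFinset (some ⟨1, by omega⟩) =
      {none, some ⟨0, by omega⟩, some ⟨2, by omega⟩} := by
    ext (_ | i)
    · simp [forkGraph_adj_some_none]
    · simp only [SimpleGraph.mem_neighborFinset, Finset.mem_insert, Finset.mem_singleton,
        Option.some.injEq, Fin.ext_iff, reduceCtorEq, false_or]
      change 1 + 1 = (i : ℕ) ∨ (i : ℕ) + 1 = 1 ↔ (i : ℕ) = 0 ∨ (i : ℕ) = 2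
      omega
  rw [← SimpleGraph.card_neighborFinset_eq_degree, hneighbors]
  rfl

theorem degree_forkGraph_le_two {o : Option (Fin n)} (ho : ∀ i, o = some i → (i : ℕ) ≠ 1) :
    (forkGraph n).degree o ≤ 2 := by
  rw [← SimpleGraph.card_neighborFinset_eq_degree]
  by_contra! h
  obtain ⟨x, y, z, hx, hy, hz, hxy, hxz, hyz⟩ := Finset.two_lt_card_iff.mp h
  rw [SimpleGraph.mem_neighborFinset] at hx hy hz
  rcases o with _ | i
  · rcases x with _ | x
    · exact hx
    rcases y with _ | y
    · exact hy
    rw [forkGraph_adj_none_some] at hx hy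
    exact hxy (congrArg some (Fin.ext (hx.trans hy.symm)))
  · have hi := ho i rfl
    rcases x with _ | x
    · exact hi hx
    rcases y with _ | y
    · exact hi hy
    rcases z with _ | z
    · exact hi hz
    rw [ne_eq, Option.some.injEq, Fin.ext_iff] at hxy hxz hyz
    rw [forkGraph_adj_some_some] at hx hy hz
    omega

end Degree

variable {V : Type*} {G : SimpleGraph V}

theorem nonempty_forkGraph_iso {l : V} (f : SimpleGraph.pathGraph n ≃g G.induce {l}ᶜ)
    (hadj : ∀ i, G.Adj l (f i) ↔ (i : ℕ) = 1) : Nonempty (forkGraph n ≃g G) := by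
  classical
  refine ⟨⟨(Equiv.optionCongr f.toEquiv).trans (Equiv.optionSubtypeNe l), ?_⟩⟩
  rintro (_ | i) (_ | j)
  · exact iff_of_false (G.irrefl) ((forkGraph n).irrefl)
  · exact hadj j
  · exact (G.adj_comm _ _).trans (hadj i)
  · exact (f.map_adj_iff (v := i) (w := j)).trans SimpleGraph.pathGraph_adj

theorem degree_induce_compl_singleton [DecidableEq V] [G.LocallyFinite] {l : V}
    [(G.induce {l}ᶜ).LocallyFinite] (v : ({l}ᶜ : Set V)) :
    (G.induce {l}ᶜ).degree v = ((G.neighborFinset v).erase l).card := by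
  rw [← SimpleGraph.card_neighborFinset_eq_degree, ← Finset.card_map (.subtype _)]
  congr 1
  ext w
  simp [and_comm]

theorem nonempty_forkGraph_iso_of_degree [Fintype V] [DecidableRel G.Adj] (hG : G.Connected)
    {c l l' : V} (hl : G.degree l = 1) (hl' : G.degree l' = 1) (hne : l ≠ l')
    (hc : G.degree c = 3) (hlc : G.Adj c l) (hlc' : G.Adj c l') (h2 : ∀ v, v ≠ c → G.degree v ≤ 2)
    (hn : Fintype.card V = n + 1) : Nonempty (forkGraph n ≃g G) := by
  classical
  have hcl : c ≠ l' := hlc'.ne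
  have hdegree : ∀ v : ({l'}ᶜ : Set V), (G.induce {l'}ᶜ).degree v ≤ 2 := by
    intro v
    rw [degree_induce_compl_singleton]
    rcases eq_or_ne (v : V) c with hv | hv
    · rw [hv, Finset.card_erase_of_mem ((G.mem_neighborFinset _ _).mpr hlc'),
        G.card_neighborFinset_eq_degree, hc]
    · exact (Finset.card_erase_le.trans_eq (G.card_neighborFinset_eq_degree _)).trans (h2 v hv)
  have hdegree_l : (G.induce {l'}ᶜ).degree ⟨l, hne⟩ ≤ 1 := by
    rw [degree_induce_compl_singleton]
    exact (Finset.card_erase_le.trans_eq (G.card_neighborFinset_eq_degree _)).trans hl.le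
  have hcard : Fintype.card ({l'}ᶜ : Set V) = n := by
    rw [Fintype.card_compl_set, hn, Fintype.card_unique, Nat.add_sub_cancel]
  obtain ⟨f, hf⟩ := exists_iso_pathGraph_of_degree_le_two
    (hG.induce_compl_singleton_of_degree_eq_one hl') hdegree_l hdegree hcard
  have hfc : (f ⟨c, hcl⟩ : ℕ) = 1 := by
    rw [hf, SimpleGraph.dist_eq_one_iff_adj]
    exact hlc.symm
  refine nonempty_forkGraph_iso f.symm fun i => ⟨fun h => ?_, fun h => ?_⟩
  · have hi : f.symm i = ⟨c, hcl⟩ := Subtype.ext (eq_of_degree_le_one hl'.le h hlc'.symm)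
    rw [← hfc, ← hi, f.apply_symm_apply]
  · have hi : f.symm i = ⟨c, hcl⟩ := f.injective <| by
      rw [f.apply_symm_apply]
      exact Fin.ext (h.trans hfc.symm)
    rw [hi]
    exact hlc'.symm

end ForkGraph

section Invariants

theorem degree_pathGraph_le_two {n : ℕ} [(SimpleGraph.pathGraph n).LocallyFinite] (i : Fin n) :
    (SimpleGraph.pathGraph n).degree i ≤ 2 := by
  rw [← SimpleGraph.card_neighborFinset_eq_degree]
  by_contra! h
  obtain ⟨x, y, z, hx, hy, hz, hxy, hxz, hyz⟩ := Finset.two_lt_card_iff.mp h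
  rw [SimpleGraph.mem_neighborFinset, SimpleGraph.pathGraph_adj] at hx hy hz
  rw [ne_eq, Fin.ext_iff] at hxy hxz hyz
  omega

variable {V V' : Type*} [Fintype V] [Fintype V'] {G : SimpleGraph V} {G' : SimpleGraph V'}
  [DecidableRel G.Adj] [DecidableRel G'.Adj]

theorem excess_eq_of_iso (f : G ≃g G') : excess G = excess G' :=
  Fintype.sum_equiv f.toEquiv _ _ fun v => congrArg (· - 2) (f.degree_eq v).symm

theorem card_centralLeaves_eq_of_iso (f : G ≃g G') :
    (centralLeaves G).card = (centralLeaves G').card := by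
  refine Finset.card_equiv f.toEquiv fun v => ?_
  simp only [centralLeaves, Finset.mem_filter, Finset.mem_univ, true_and]
  refine and_congr (by rw [← f.degree_eq v]; rfl) (f.toEquiv.exists_congr fun w => ?_)
  exact and_congr f.map_adj_iff.symm (by rw [← f.degree_eq w]; rfl)

theorem excess_pathGraph (n : ℕ) [DecidableRel (SimpleGraph.pathGraph n).Adj] :
    excess (SimpleGraph.pathGraph n) = 0 :=
  Finset.sum_eq_zero fun i _ => Nat.sub_eq_zero_of_le (degree_pathGraph_le_two i)

theorem nonempty_iso_pathGraph_of_excess_eq_zero (hG : G.IsTree) (hX : excess G = 0) :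
    Nonempty (G ≃g SimpleGraph.pathGraph (Fintype.card V)) := by
  have h2 : ∀ v, G.degree v ≤ 2 := fun v => by
    simpa [hX] using degree_le_excess_add_two (G := G) v
  have hleaf : ∃ l, G.degree l ≤ 1 := by
    by_contra! h
    have hsum := sum_degree_add_two_of_isTree hG
    have hle : ∑ _v : V, 2 ≤ ∑ v, G.degree v := Finset.sum_le_sum fun v _ => h v
    rw [Finset.sum_const, Finset.card_univ, smul_eq_mul] at hle
    omega
  obtain ⟨l, hl⟩ := hleaf
  exact ⟨(exists_iso_pathGraph_of_degree_le_two hG.connected hl h2 rfl).choose⟩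

variable {n : ℕ}

theorem nonempty_forkGraph_iso_of_excess_eq_one (hG : G.Connected) (hX : excess G = 1)
    (hleaves : 2 ≤ (centralLeaves G).card) (hn : Fintype.card V = n + 1) :
    Nonempty (forkGraph n ≃g G) := by
  obtain ⟨c, hc, h2⟩ := exists_degree_eq_three_of_excess_eq_one hX
  have hcentral : ∀ l ∈ centralLeaves G, G.degree l = 1 ∧ G.Adj c l := by
    intro l hl
    obtain ⟨-, hdegree, w, hadj, hw⟩ := Finset.mem_filter.mp hl
    obtain rfl : w = c := by
      by_contra hne
      have := h2 w hne
      omega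
    exact ⟨hdegree, hadj.symm⟩
  obtain ⟨l, hl, l', hl', hne⟩ := Finset.one_lt_card.mp hleaves
  exact nonempty_forkGraph_iso_of_degree hG (hcentral l hl).1 (hcentral l' hl').1 hne hc
    (hcentral l hl).2 (hcentral l' hl').2 h2 hn

variable [DecidableRel (forkGraph n).Adj]

theorem excess_forkGraph (hn : 3 ≤ n) : excess (forkGraph n) = 1 := by
  rw [excess, Finset.sum_eq_single (some ⟨1, by omega⟩), degree_forkGraph_one hn]
  · refine fun o _ ho => Nat.sub_eq_zero_of_le (degree_forkGraph_le_two ?_)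
    rintro i rfl hi
    exact ho (congrArg some (Fin.ext hi))
  · exact fun h => absurd (Finset.mem_univ _) h

theorem two_le_card_centralLeaves_forkGraph (hn : 3 ≤ n) :
    2 ≤ (centralLeaves (forkGraph n)).card := by
  refine Finset.one_lt_card.mpr ⟨none, ?_, some ⟨0, by omega⟩, ?_, by simp⟩
  · exact Finset.mem_filter.mpr ⟨Finset.mem_univ _, degree_forkGraph_none (by omega),
      some ⟨1, by omega⟩, rfl, degree_forkGraph_one hn⟩
  · exact Finset.mem_filter.mpr ⟨Finset.mem_univ _, degree_forkGraph_zero (by omega),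
      some ⟨1, by omega⟩, Or.inl rfl, degree_forkGraph_one hn⟩

end Invariants

section VertexEquiv

variable {V V' E E' : Type*} [Fintype V] [DecidableEq V] [Fintype V'] [DecidableEq V']
  [Fintype E] [Fintype E'] {k : ℕ} {edge : E → Finset V} {edge' : E' → Finset V'}

namespace IsEdgeTree

section

variable [DecidableEq E] [DecidableEq E']

theorem card_filter_edgesAt_eq_singleton (h : IsEdgeTree k edge)
    (h2 : ∀ v, (edgesAt edge v).card ≤ 2) (e : E) :
    (Finset.univ.filter fun v => edgesAt edge v = {e}).card + (lineGraph edge).degree e = k := by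
  have hprivate : (Finset.univ.filter fun v => edgesAt edge v = {e}) =
      (edge e).filter fun v => ¬ (edgesAt edge v).card = 2 := by
    ext v
    simp only [Finset.mem_filter, Finset.mem_univ, true_and]
    constructor
    · intro hv
      exact ⟨mem_edgesAt.mp (by simp [hv]), by simp [hv]⟩
    · rintro ⟨hve, hv⟩
      obtain ⟨e', he'⟩ := Finset.card_eq_one.mp
        ((h.card_edgesAt_eq_one_or_two (h2 v)).resolve_right hv)
      have hmem := mem_edgesAt.mpr hve
      rw [he', Finset.mem_singleton] at hmem
      rw [he', hmem]
  rw [hprivate, ← h.card_filter_eq_degree h2, ← h.card_edge e, add_comm,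
    Finset.card_filter_add_card_filter_not]

theorem card_filter_edgesAt_eq_pair (h : IsEdgeTree k edge)
    (h2 : ∀ v, (edgesAt edge v).card ≤ 2) {e e' : E} (hne : e ≠ e') :
    (Finset.univ.filter fun v => edgesAt edge v = {e, e'}).card =
      if (lineGraph edge).Adj e e' then 1 else 0 := by
  split_ifs with hadj
  · obtain ⟨-, v, hv, hv'⟩ := hadj
    refine Finset.card_eq_one.mpr ⟨v, ?_⟩
    ext w
    simp only [Finset.mem_filter, Finset.mem_univ, true_and, Finset.mem_singleton]
    constructor
    · intro hw
      exact h.linear e e' hne w v (mem_edgesAt.mp (by simp [hw])) (mem_edgesAt.mp (by simp [hw]))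
        hv hv'
    · rintro rfl
      exact edgesAt_eq_pair (h2 w) hv hv' hne
  · rw [Finset.card_eq_zero, Finset.filter_eq_empty_iff]
    intro v _ hv
    exact hadj ⟨hne, v, mem_edgesAt.mp (by simp [hv]), mem_edgesAt.mp (by simp [hv])⟩

theorem card_filter_edgesAt_eq_zero (h : IsEdgeTree k edge)
    (h2 : ∀ v, (edgesAt edge v).card ≤ 2) {s : Finset E} (hs : s.card ≠ 1) (hs' : s.card ≠ 2) :
    (Finset.univ.filter fun v => edgesAt edge v = s).card = 0 := by
  rw [Finset.card_eq_zero, Finset.filter_eq_empty_iff]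
  rintro v - rfl
  exact (h.card_edgesAt_eq_one_or_two (h2 v)).elim hs hs'

theorem card_filter_edgesAt_eq_map (h : IsEdgeTree k edge) (h' : IsEdgeTree k edge')
    (h2 : ∀ v, (edgesAt edge v).card ≤ 2) (h2' : ∀ v, (edgesAt edge' v).card ≤ 2)
    (ψ : lineGraph edge ≃g lineGraph edge') (s : Finset E) :
    (Finset.univ.filter fun v => edgesAt edge' v = s.map ψ.toEquiv.toEmbedding).card =
      (Finset.univ.filter fun v => edgesAt edge v = s).card := by
  rcases eq_or_ne s.card 1 with hs | hs
  · obtain ⟨e, rfl⟩ := Finset.card_eq_one.mp hs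
    have hcard := h.card_filter_edgesAt_eq_singleton h2 e
    rw [← ψ.degree_eq e] at hcard
    rw [Finset.map_singleton]
    exact Nat.add_right_cancel
      ((h'.card_filter_edgesAt_eq_singleton h2' (ψ e)).trans hcard.symm)
  rcases eq_or_ne s.card 2 with hs' | hs'
  · obtain ⟨e, e', hne, rfl⟩ := Finset.card_eq_two.mp hs'
    rw [Finset.map_insert, Finset.map_singleton, h.card_filter_edgesAt_eq_pair h2 hne]
    refine (h'.card_filter_edgesAt_eq_pair h2' (ψ.injective.ne hne)).trans ?_
    simp only [ψ.map_adj_iff]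
  · rw [h.card_filter_edgesAt_eq_zero h2 hs hs',
      h'.card_filter_edgesAt_eq_zero h2' (by rwa [Finset.card_map]) (by rwa [Finset.card_map])]

end

theorem exists_vertex_equiv (h : IsEdgeTree k edge) (h' : IsEdgeTree k edge')
    (h2 : ∀ v, (edgesAt edge v).card ≤ 2) (h2' : ∀ v, (edgesAt edge' v).card ≤ 2)
    (ψ : lineGraph edge ≃g lineGraph edge') :
    ∃ φ : V ≃ V', ∀ v e, φ v ∈ edge' (ψ e) ↔ v ∈ edge e := by
  classical
  obtain ⟨φ, hφ⟩ := exists_equiv_of_card_fiber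
    (p := fun v => (edgesAt edge v).map ψ.toEquiv.toEmbedding) (q := edgesAt edge') (by
      intro s
      obtain ⟨s, rfl⟩ := ψ.toEquiv.finsetCongr.surjective s
      simp only [Equiv.finsetCongr_apply, Finset.map_inj]
      exact (h.card_filter_edgesAt_eq_map h' h2 h2' ψ s).symm)
  refine ⟨φ, fun v e => ?_⟩
  rw [← mem_edgesAt, hφ v, ← mem_edgesAt (edge := edge)]
  exact Finset.mem_map' _

end IsEdgeTree

end VertexEquiv

section MomentInvariance

variable {V V' E E' : Type*} [Fintype V] [DecidableEq V] [Fintype V'] [DecidableEq V']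
  [Fintype E] [DecidableEq E] [Fintype E'] [DecidableEq E'] {k : ℕ}
  {edge : E → Finset V} {edge' : E' → Finset V'}

theorem sum_configTerm_eq_of_equiv (hk : 2 ≤ k) (φ : V ≃ V') (ψ : E ≃ E')
    (hedge : ∀ e, edge' (ψ e) = (edge e).image φ) {d : ℕ} (hd : d ≠ 0) (x : V' → ℝ) (y : ℝ) :
    ∑ n ∈ Finset.piAntidiag Finset.univ d, configTerm k edge (x ∘ φ) y n =
      ∑ n ∈ Finset.piAntidiag Finset.univ d, configTerm k edge' x y n := by
  have hcomp : ∀ n : V' × Option E' → ℕ,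
      configExtend φ ψ (n ∘ Prod.map φ (Option.map ψ)) = n := fun n =>
    configExtend_comp φ.injective ψ.injective fun p _ =>
      (φ.prodCongr ψ.optionCongr).surjective p
  refine Finset.sum_bij' (fun n _ => configExtend φ ψ n)
    (fun n _ => n ∘ Prod.map φ (Option.map ψ)) ?_ ?_ ?_ ?_ ?_
  · intro n hn
    rw [Finset.mem_piAntidiag] at hn ⊢
    exact ⟨by rw [sum_configExtend φ.injective ψ.injective, hn.1], fun p _ => Finset.mem_univ p⟩
  · intro n hn
    rw [Finset.mem_piAntidiag] at hn ⊢
    exact ⟨by rw [← sum_configExtend φ.injective ψ.injective, hcomp, hn.1],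
      fun p _ => Finset.mem_univ p⟩
  · intro n _
    exact funext fun p => configExtend_apply φ.injective ψ.injective n p
  · intro n _
    exact hcomp n
  · intro n hn
    have hsum : ∑ p, n p ≠ 0 := by rwa [(Finset.mem_piAntidiag.mp hn).1]
    rw [configTerm_extend hk φ.injective ψ.injective hedge hsum]

theorem momentSum_eq_of_equiv (hk : 2 ≤ k) (φ : V ≃ V') (ψ : E ≃ E')
    (hφ : ∀ v e, φ v ∈ edge' (ψ e) ↔ v ∈ edge e) (a : ℝ) (d : ℕ) :
    momentSum k edge a d = momentSum k edge' a d := by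
  rcases eq_or_ne d 0 with rfl | hd
  · rw [momentSum_zero, momentSum_zero, Fintype.card_congr φ]
  have hedge : ∀ e, edge' (ψ e) = (edge e).image φ := fun e => by
    ext v
    obtain ⟨v, rfl⟩ := φ.surjective v
    rw [hφ, φ.injective.mem_finset_image]
  have hdegree : ∀ v, (edgesAt edge' (φ v)).card = (edgesAt edge v).card := fun v => by
    rw [← Finset.card_map ψ.toEmbedding]
    congr 1
    ext e
    rw [mem_edgesAt, Finset.mem_map_equiv, mem_edgesAt, ← hφ, ψ.apply_symm_apply]
  have hloop : (fun v => a * (edgesAt edge v).card) =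
      (fun v => a * ((edgesAt edge' v).card : ℝ)) ∘ φ :=
    funext fun v => by rw [Function.comp_apply, hdegree]
  rw [momentSum, hloop]
  exact sum_configTerm_eq_of_equiv hk φ ψ hedge hd _ _

end MomentInvariance

section Isomorphism

variable {U W : Type*} [Finite U] [Finite W] {H : Hypergraph U} {K : Hypergraph W}

theorem isIsomorphic_of_equiv (φ : ↥H.vertexSet ≃ ↥K.vertexSet) (ψ : ↥H.edgeSet ≃ ↥K.edgeSet)
    (hφ : ∀ v e, φ v ∈ edgeVerts K (ψ e) ↔ v ∈ edgeVerts H e) : H.IsIsomorphic K := by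
  have himage : ∀ e, φ '' (edgeVerts H e : Set ↥H.vertexSet) = edgeVerts K (ψ e) := fun e => by
    ext v
    obtain ⟨v, rfl⟩ := φ.surjective v
    rw [φ.injective.mem_set_image, Finset.mem_coe, Finset.mem_coe, hφ]
  have hval := Subtype.val_injective (p := (· ∈ K.vertexSet)).image_injective
  refine ⟨φ, fun s => ⟨fun hs => ?_, fun hs => ?_⟩⟩
  · have hs' : s = edgeVerts H ⟨_, hs⟩ :=
      Subtype.val_injective.image_injective (image_edgeVerts ⟨_, hs⟩).symm
    rw [hs', himage, image_edgeVerts]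
    exact (ψ _).2
  · obtain ⟨e, he⟩ := ψ.surjective ⟨_, hs⟩
    have hs' : φ '' s = φ '' (edgeVerts H e) := by
      rw [himage, he]
      exact hval (image_edgeVerts ⟨_, hs⟩).symm
    rw [φ.injective.image_injective hs', image_edgeVerts]
    exact e.2

theorem exists_equiv_of_isIsomorphic (h : H.IsIsomorphic K) :
    ∃ (φ : ↥H.vertexSet ≃ ↥K.vertexSet) (ψ : ↥H.edgeSet ≃ ↥K.edgeSet),
      ∀ v e, φ v ∈ edgeVerts K (ψ e) ↔ v ∈ edgeVerts H e := by
  obtain ⟨φ, hφ⟩ := h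
  have hvalH := Subtype.val_injective (p := (· ∈ H.vertexSet)).image_injective
  have hvalK := Subtype.val_injective (p := (· ∈ K.vertexSet)).image_injective
  let g : ↥H.edgeSet → ↥K.edgeSet := fun e =>
    ⟨Subtype.val '' (φ '' (edgeVerts H e : Set ↥H.vertexSet)),
      (hφ _).mp (by rw [image_edgeVerts]; exact e.2)⟩
  have hg : ∀ e, (edgeVerts K (g e) : Set ↥K.vertexSet) = φ '' (edgeVerts H e) :=
    fun e => hvalK (image_edgeVerts (g e))
  have hinj : Function.Injective g := fun e e' hee =>
    edgeVerts_injective (Finset.coe_injective (φ.injective.image_injective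
      (by rw [← hg, ← hg, hee])))
  have hsurj : Function.Surjective g := fun f => by
    have hpreimage : φ '' (φ ⁻¹' (edgeVerts K f : Set ↥K.vertexSet)) = edgeVerts K f :=
      Set.image_preimage_eq _ φ.surjective
    have hmem : Subtype.val '' (φ ⁻¹' (edgeVerts K f : Set ↥K.vertexSet)) ∈ H.edgeSet := by
      rw [hφ, hpreimage, image_edgeVerts]
      exact f.2
    refine ⟨⟨_, hmem⟩, edgeVerts_injective (Finset.coe_injective ?_)⟩
    rw [hg, hvalH (image_edgeVerts ⟨_, hmem⟩), hpreimage]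
  refine ⟨φ, Equiv.ofBijective g ⟨hinj, hsurj⟩, fun v e => ?_⟩
  change φ v ∈ edgeVerts K (g e) ↔ _
  rw [← Finset.mem_coe, hg, φ.injective.mem_set_image, Finset.mem_coe]

theorem isIsomorphic_symm (h : H.IsIsomorphic K) : K.IsIsomorphic H := by
  obtain ⟨φ, ψ, hφ⟩ := exists_equiv_of_isIsomorphic h
  refine isIsomorphic_of_equiv φ.symm ψ.symm fun v e => ?_
  rw [← hφ, φ.apply_symm_apply, ψ.apply_symm_apply]

variable {k : ℕ}

theorem alphaEq_of_isIsomorphic (hk : 2 ≤ k) (hH : H.IsUniform k) (hK : K.IsUniform k)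
    (h : H.IsIsomorphic K) (a : ℝ) : AlphaEq k a H K := by
  classical
  have : Fintype ↥H.vertexSet := Fintype.ofFinite _
  have : Fintype ↥K.vertexSet := Fintype.ofFinite _
  have : Fintype ↥H.edgeSet := Fintype.ofFinite _
  have : Fintype ↥K.edgeSet := Fintype.ofFinite _
  obtain ⟨φ, ψ, hφ⟩ := exists_equiv_of_isIsomorphic h
  refine ⟨by rw [← Nat.card_coe_set_eq, ← Nat.card_coe_set_eq, Nat.card_congr φ], fun t _ => ?_⟩
  rw [alphaMoment_eq_momentSum hH, alphaMoment_eq_momentSum hK, momentSum_eq_of_equiv hk φ ψ hφ,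
    Fintype.card_congr φ]

theorem isIsomorphic_of_iso_lineGraph [DecidableEq ↥H.vertexSet] [Fintype ↥H.edgeSet]
    [DecidableEq ↥K.vertexSet] [Fintype ↥K.edgeSet] {m : ℕ} (hm : 1 ≤ m)
    (hH : H.IsUniformHypertree k m) (hK : K.IsUniformHypertree k m)
    (h2 : ∀ v, (edgesAt (edgeVerts H) v).card ≤ 2) (h2' : ∀ v, (edgesAt (edgeVerts K) v).card ≤ 2)
    (ψ : lineGraph (edgeVerts H) ≃g lineGraph (edgeVerts K)) : H.IsIsomorphic K := by
  have : Fintype ↥H.vertexSet := Fintype.ofFinite _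
  have : Fintype ↥K.vertexSet := Fintype.ofFinite _
  obtain ⟨φ, hφ⟩ := (isEdgeTree hH hm).exists_vertex_equiv (isEdgeTree hK hm) h2 h2' ψ
  exact isIsomorphic_of_equiv φ ψ.toEquiv hφ

end Isomorphism

theorem encard_range_eq_card {α β : Type*} [Fintype α] {f : α → β} (hf : Function.Injective f) :
    (Set.range f).encard = Fintype.card α := by
  rw [← Set.image_univ, hf.encard_image, Set.encard_univ, ENat.card_eq_coe_fintype_card]

section ConnectedLineGraph

variable {U : Type*} [Finite U] {H : Hypergraph U}

theorem connected_incidenceGraph (hH : (lineGraph (edgeVerts H)).Connected)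
    (hcover : ∀ v, ∃ e, v ∈ edgeVerts H e) : H.incidenceGraph.Connected := by
  have hedges : ∀ e e', H.incidenceGraph.Reachable (.inr e) (.inr e') := by
    intro e e'
    have hreach := hH.preconnected e e'
    rw [SimpleGraph.reachable_iff_reflTransGen] at hreach
    induction hreach with
    | refl => exact SimpleGraph.Reachable.refl _
    | tail _ hadj ih =>
      obtain ⟨-, v, hv, hv'⟩ := hadj
      exact (ih.trans (incidenceGraph_adj_inr_inl.mpr hv).reachable).trans
        (incidenceGraph_adj_inl_inr.mpr hv').reachable
  have hedge : ∀ p, ∃ e, H.incidenceGraph.Reachable p (.inr e) := by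
    rintro (v | e)
    · obtain ⟨e, he⟩ := hcover v
      exact ⟨e, (incidenceGraph_adj_inl_inr.mpr he).reachable⟩
    · exact ⟨e, SimpleGraph.Reachable.refl _⟩
  refine (SimpleGraph.connected_iff _).mpr ⟨fun p q => ?_, ⟨.inr hH.nonempty.some⟩⟩
  obtain ⟨e, he⟩ := hedge p
  obtain ⟨e', he'⟩ := hedge q
  exact (he.trans (hedges e e')).trans he'.symm

theorem isUniformHypertree_of_connected_lineGraph [Fintype ↥H.vertexSet] {k m : ℕ}
    (hunif : H.IsUniform k) (hm : H.edgeSet.encard = m)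
    (hconn : (lineGraph (edgeVerts H)).Connected) (hcover : ∀ v, ∃ e, v ∈ edgeVerts H e)
    (hcard : Fintype.card ↥H.vertexSet + m = k * m + 1) : H.IsUniformHypertree k m := by
  classical
  have : Fintype ↥H.edgeSet := Fintype.ofFinite _
  have hm' : Fintype.card ↥H.edgeSet = m := by
    rw [Set.encard_eq_coe_toFinset_card, Set.toFinset_card] at hm
    exact_mod_cast hm
  refine ⟨hunif, hm, isTree_of_sum_degree_add_two (connected_incidenceGraph hconn hcover) ?_⟩
  rw [sum_degree_incidenceGraph, Fintype.card_sum,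
    Finset.sum_congr rfl fun e _ => card_edgeVerts hunif e, Finset.sum_const, smul_eq_mul,
    Finset.card_univ, hm', mul_comm m]
  omega

end ConnectedLineGraph

section Enumeration

variable {U I : Type*} [Finite U] {H : Hypergraph U} {edge : I → Set U}

theorem nonempty_iso_lineGraph (hinj : Function.Injective edge)
    (hrange : H.edgeSet = Set.range edge) {G : SimpleGraph I}
    (hG : ∀ i j, G.Adj i j ↔ i ≠ j ∧ ∃ v, v ∈ edge i ∧ v ∈ edge j) :
    Nonempty (G ≃g lineGraph (edgeVerts H)) := by
  let g : I ≃ ↥H.edgeSet := (Equiv.ofInjective edge hinj).trans (Equiv.setCongr hrange.symm)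
  refine ⟨⟨g, fun {i j} => ?_⟩⟩
  rw [hG]
  refine and_congr g.injective.ne_iff ⟨?_, ?_⟩
  · rintro ⟨v, hv, hv'⟩
    exact ⟨v, mem_edgeVerts.mp hv, mem_edgeVerts.mp hv'⟩
  · rintro ⟨v, hv, hv'⟩
    exact ⟨⟨v, H.subset_vertexSet_of_mem_edgeSet (g i).2 hv⟩, mem_edgeVerts.mpr hv,
      mem_edgeVerts.mpr hv'⟩

theorem exists_mem_edgeVerts_of_range (hrange : H.edgeSet = Set.range edge)
    (hcover : ∀ u, ∃ i, u ∈ edge i) (v : ↥H.vertexSet) : ∃ e, v ∈ edgeVerts H e := by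
  obtain ⟨i, hi⟩ := hcover v
  exact ⟨⟨edge i, hrange ▸ ⟨i, rfl⟩⟩, mem_edgeVerts.mpr hi⟩

theorem card_edgesAt_le_two [DecidableEq ↥H.vertexSet] [Fintype ↥H.edgeSet]
    (hrange : H.edgeSet = Set.range edge)
    (h : ∀ u i j l, u ∈ edge i → u ∈ edge j → u ∈ edge l → i = j ∨ i = l ∨ j = l)
    (v : ↥H.vertexSet) : (edgesAt (edgeVerts H) v).card ≤ 2 := by
  have hindex : ∀ e : ↥H.edgeSet, ∃ i, edge i = e := fun e => by
    have he : (e : Set U) ∈ Set.range edge := hrange ▸ e.2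
    exact he
  choose index hindex using hindex
  have hindex_inj : Function.Injective index := fun e e' hee =>
    Subtype.ext ((hindex e).symm.trans (hee ▸ hindex e'))
  by_contra! hcard
  obtain ⟨x, y, z, hx, hy, hz, hxy, hxz, hyz⟩ := Finset.two_lt_card_iff.mp hcard
  rw [mem_edgesAt, mem_edgeVerts, ← hindex] at hx hy hz
  rcases h v _ _ _ hx hy hz with heq | heq | heq
  · exact hxy (hindex_inj heq)
  · exact hxz (hindex_inj heq)
  · exact hyz (hindex_inj heq)

end Enumeration

section Hyperpath

variable {k m : ℕ}

theorem inl_mem_hyperpathEdge {i : Fin m} {x : Fin (m + 1)} :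
    Sum.inl x ∈ hyperpathEdge k m i ↔ (x : ℕ) = i ∨ (x : ℕ) = i + 1 := by
  simp [hyperpathEdge, Fin.ext_iff]

theorem inr_mem_hyperpathEdge {i : Fin m} {p : Fin m × Fin (k - 2)} :
    Sum.inr p ∈ hyperpathEdge k m i ↔ p.1 = i := by
  obtain ⟨j, t⟩ := p
  simp [hyperpathEdge, eq_comm]

theorem hyperpathEdge_injective : Function.Injective (hyperpathEdge k m) := by
  intro i j h
  have hi : Sum.inl i.castSucc ∈ hyperpathEdge k m j :=
    h ▸ inl_mem_hyperpathEdge.mpr (Or.inl rfl)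
  have hj : Sum.inl j.castSucc ∈ hyperpathEdge k m i :=
    h ▸ inl_mem_hyperpathEdge.mpr (Or.inl rfl)
  rw [inl_mem_hyperpathEdge, Fin.val_castSucc] at hi hj
  exact Fin.ext (by omega)

theorem encard_hyperpathEdge (hk : 2 ≤ k) (i : Fin m) : (hyperpathEdge k m i).encard = k := by
  have hinj : Function.Injective fun t : Fin (k - 2) =>
      (Sum.inr (i, t) : Fin (m + 1) ⊕ Fin m × Fin (k - 2)) := fun t t' h =>
    (Prod.ext_iff.mp (Sum.inr_injective h)).2
  have hdisjoint : Disjoint ({Sum.inl i.castSucc, Sum.inl i.succ} : Set _)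
      (Set.range fun t : Fin (k - 2) => (Sum.inr (i, t) : Fin (m + 1) ⊕ Fin m × Fin (k - 2))) := by
    rw [Set.disjoint_left]
    rintro _ (rfl | rfl) ⟨t, ht⟩ <;> exact Sum.inr_ne_inl ht
  rw [hyperpathEdge, Set.encard_union_eq hdisjoint, Set.encard_pair (by simp [Fin.ext_iff]),
    encard_range_eq_card hinj, Fintype.card_fin]
  exact_mod_cast Nat.add_sub_of_le hk

theorem pathGraph_adj_iff_hyperpathEdge {i j : Fin m} : (SimpleGraph.pathGraph m).Adj i j ↔
    i ≠ j ∧ ∃ v, v ∈ hyperpathEdge k m i ∧ v ∈ hyperpathEdge k m j := by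
  rw [SimpleGraph.pathGraph_adj]
  constructor
  · intro h
    refine ⟨fun heq => by subst heq; omega, ?_⟩
    rcases h with h | h
    · exact ⟨Sum.inl i.succ, inl_mem_hyperpathEdge.mpr (Or.inr rfl),
        inl_mem_hyperpathEdge.mpr (Or.inl h)⟩
    · exact ⟨Sum.inl j.succ, inl_mem_hyperpathEdge.mpr (Or.inl h),
        inl_mem_hyperpathEdge.mpr (Or.inr rfl)⟩
  · rintro ⟨hne, x | p, hi, hj⟩
    · rw [inl_mem_hyperpathEdge] at hi hj
      rw [ne_eq, Fin.ext_iff] at hne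
      omega
    · rw [inr_mem_hyperpathEdge] at hi hj
      exact absurd (hi.symm.trans hj) hne

theorem eq_or_eq_or_eq_of_mem_hyperpathEdge {u : Fin (m + 1) ⊕ Fin m × Fin (k - 2)}
    {i j l : Fin m} (hi : u ∈ hyperpathEdge k m i) (hj : u ∈ hyperpathEdge k m j)
    (hl : u ∈ hyperpathEdge k m l) : i = j ∨ i = l ∨ j = l := by
  rcases u with x | p
  · rw [inl_mem_hyperpathEdge] at hi hj hl
    simp only [Fin.ext_iff]
    omega
  · rw [inr_mem_hyperpathEdge] at hi hj
    exact Or.inl (hi.symm.trans hj)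

theorem exists_mem_hyperpathEdge (hm : 1 ≤ m) (u : Fin (m + 1) ⊕ Fin m × Fin (k - 2)) :
    ∃ i, u ∈ hyperpathEdge k m i := by
  obtain ⟨m, rfl⟩ := Nat.exists_eq_add_of_le' hm
  rcases u with x | p
  · rcases x.eq_castSucc_or_eq_last with ⟨i, rfl⟩ | rfl
    · exact ⟨i, inl_mem_hyperpathEdge.mpr (Or.inl rfl)⟩
    · exact ⟨Fin.last m, inl_mem_hyperpathEdge.mpr (Or.inr rfl)⟩
  · exact ⟨p.1, inr_mem_hyperpathEdge.mpr rfl⟩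

theorem card_hyperpath_vertices (hk : 2 ≤ k) :
    Fintype.card (Fin (m + 1) ⊕ Fin m × Fin (k - 2)) + m = k * m + 1 := by
  obtain ⟨k, rfl⟩ := Nat.exists_eq_add_of_le' hk
  simp only [Fintype.card_sum, Fintype.card_prod, Fintype.card_fin, Nat.add_sub_cancel]
  ring

theorem nonempty_iso_lineGraph_hyperpath :
    Nonempty (SimpleGraph.pathGraph m ≃g lineGraph (edgeVerts (hyperpath k m))) :=
  nonempty_iso_lineGraph hyperpathEdge_injective rfl fun _ _ => pathGraph_adj_iff_hyperpathEdge

theorem isUniformHypertree_hyperpath (hk : 2 ≤ k) (hm : 1 ≤ m) :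
    (hyperpath k m).IsUniformHypertree k m := by
  have : Fintype ↥(hyperpath k m).vertexSet := Fintype.ofFinite _
  obtain ⟨g⟩ := nonempty_iso_lineGraph_hyperpath (k := k) (m := m)
  refine isUniformHypertree_of_connected_lineGraph ?_ ?_ ?_
    (exists_mem_edgeVerts_of_range rfl (exists_mem_hyperpathEdge hm)) ?_
  · rintro _ ⟨i, rfl⟩
    exact encard_hyperpathEdge hk i
  · exact (encard_range_eq_card hyperpathEdge_injective).trans (by rw [Fintype.card_fin])
  · obtain ⟨m, rfl⟩ := Nat.exists_eq_add_of_le' hm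
    exact g.connected_iff.mp (SimpleGraph.pathGraph_connected m)
  · rw [← card_hyperpath_vertices hk]
    congr 1
    exact Fintype.card_congr (Equiv.Set.univ _)

theorem card_edgesAt_hyperpath_le_two [DecidableEq ↥(hyperpath k m).vertexSet]
    [Fintype ↥(hyperpath k m).edgeSet] (v : ↥(hyperpath k m).vertexSet) :
    (edgesAt (edgeVerts (hyperpath k m)) v).card ≤ 2 :=
  card_edgesAt_le_two rfl (fun _ _ _ _ => eq_or_eq_or_eq_of_mem_hyperpathEdge) v

end Hyperpath

section AttachPendant

variable {U I : Type*} {k : ℕ}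

/-- The hyperedges of a hypergraph with a pendant hyperedge attached at `v`. The pendant hyperedge
has index `none`. -/
def attachPendantEdge (k : ℕ) (edge : I → Set U) (v : U) : Option I → Set (U ⊕ Fin (k - 1))
  | none => insert (Sum.inl v) (Set.range Sum.inr)
  | some i => Sum.inl '' edge i

variable {edge : I → Set U} {v : U}

theorem edgeSet_attachPendant {H : Hypergraph U} (hv : v ∈ H.vertexSet)
    (hrange : H.edgeSet = Set.range edge) :
    (attachPendant k H v hv).edgeSet = Set.range (attachPendantEdge k edge v) := by
  change insert _ _ = _
  rw [hrange]
  ext s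
  constructor
  · rintro (rfl | ⟨_, ⟨i, rfl⟩, rfl⟩)
    · exact ⟨none, rfl⟩
    · exact ⟨some i, rfl⟩
  · rintro ⟨_ | i, rfl⟩
    · exact Or.inl rfl
    · exact Or.inr ⟨_, ⟨i, rfl⟩, rfl⟩

theorem inl_mem_attachPendantEdge_none {u : U} :
    Sum.inl u ∈ attachPendantEdge k edge v none ↔ u = v := by
  simp [attachPendantEdge]

theorem inr_mem_attachPendantEdge_none (t : Fin (k - 1)) :
    Sum.inr t ∈ attachPendantEdge k edge v none := Or.inr ⟨t, rfl⟩

theorem inl_mem_attachPendantEdge_some {u : U} {i : I} :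
    Sum.inl u ∈ attachPendantEdge k edge v (some i) ↔ u ∈ edge i := by
  simp [attachPendantEdge]

theorem inr_notMem_attachPendantEdge_some {t : Fin (k - 1)} {i : I} :
    Sum.inr t ∉ attachPendantEdge k edge v (some i) := by
  simp [attachPendantEdge]

theorem attachPendantEdge_injective (hk : 2 ≤ k) (h : Function.Injective edge) :
    Function.Injective (attachPendantEdge k edge v) := by
  have hpendant : ∀ i, attachPendantEdge k edge v none ≠ attachPendantEdge k edge v (some i) :=
    fun i hi => inr_notMem_attachPendantEdge_some
      (hi ▸ inr_mem_attachPendantEdge_none ⟨0, by omega⟩)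
  rintro (_ | i) (_ | j) hij
  · rfl
  · exact absurd hij (hpendant j)
  · exact absurd hij.symm (hpendant i)
  · exact congrArg some (h (Sum.inl_injective.image_injective hij))

theorem encard_attachPendantEdge (hk : 1 ≤ k) (h : ∀ i, (edge i).encard = k) (o : Option I) :
    (attachPendantEdge k edge v o).encard = k := by
  rcases o with _ | i
  · rw [attachPendantEdge, Set.encard_insert_of_notMem (by simp),
      encard_range_eq_card Sum.inr_injective, Fintype.card_fin]
    exact_mod_cast Nat.sub_add_cancel hk
  · rw [attachPendantEdge, Sum.inl_injective.encard_image, h]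

theorem exists_mem_attachPendantEdge (h : ∀ u, ∃ i, u ∈ edge i) (w : U ⊕ Fin (k - 1)) :
    ∃ o, w ∈ attachPendantEdge k edge v o := by
  rcases w with u | t
  · obtain ⟨i, hi⟩ := h u
    exact ⟨some i, inl_mem_attachPendantEdge_some.mpr hi⟩
  · exact ⟨none, inr_mem_attachPendantEdge_none t⟩

theorem exists_mem_attachPendantEdge_some_some {i j : I} :
    (∃ w, w ∈ attachPendantEdge k edge v (some i) ∧ w ∈ attachPendantEdge k edge v (some j)) ↔
      ∃ u, u ∈ edge i ∧ u ∈ edge j := by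
  simp only [Sum.exists, inl_mem_attachPendantEdge_some, inr_notMem_attachPendantEdge_some,
    false_and, exists_false, or_false]

theorem exists_mem_attachPendantEdge_none_some {i : I} :
    (∃ w, w ∈ attachPendantEdge k edge v none ∧ w ∈ attachPendantEdge k edge v (some i)) ↔
      v ∈ edge i := by
  simp only [Sum.exists, inl_mem_attachPendantEdge_none, inl_mem_attachPendantEdge_some,
    inr_notMem_attachPendantEdge_some, and_false, exists_false, or_false, exists_eq_left]

theorem eq_or_eq_or_eq_of_mem_attachPendantEdge
    (h : ∀ u i j l, u ∈ edge i → u ∈ edge j → u ∈ edge l → i = j ∨ i = l ∨ j = l)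
    (hv : ∀ i j, v ∈ edge i → v ∈ edge j → i = j) {w : U ⊕ Fin (k - 1)} {o p q : Option I}
    (ho : w ∈ attachPendantEdge k edge v o) (hp : w ∈ attachPendantEdge k edge v p)
    (hq : w ∈ attachPendantEdge k edge v q) : o = p ∨ o = q ∨ p = q := by
  rcases w with u | t
  · rcases o with _ | i <;> rcases p with _ | j <;> rcases q with _ | l <;>
      simp only [inl_mem_attachPendantEdge_none, inl_mem_attachPendantEdge_some] at ho hp hq <;>
      simp only [Option.some.injEq, reduceCtorEq, or_true, false_or, or_false]
    · exact hv j l (ho ▸ hp) (ho ▸ hq)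
    · exact hv i l (hp ▸ ho) (hp ▸ hq)
    · exact hv i j (hq ▸ ho) (hq ▸ hp)
    · exact h u i j l ho hp hq
  · rcases o with _ | i
    · rcases p with _ | j
      · exact Or.inl rfl
      · exact absurd hp inr_notMem_attachPendantEdge_some
    · exact absurd ho inr_notMem_attachPendantEdge_some

end AttachPendant

section HypertreeF

variable {k m : ℕ}

/-- The hyperedges of `hypertreeF`. The pendant hyperedge has index `none`. -/
def hypertreeFEdge (k m : ℕ) (hk : 3 ≤ k) (hm : 4 ≤ m) : Option (Fin (m - 1)) →
    Set ((Fin (m - 1 + 1) ⊕ Fin (m - 1) × Fin (k - 2)) ⊕ Fin (k - 1)) :=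
  attachPendantEdge k (hyperpathEdge k (m - 1)) (Sum.inr (⟨1, by omega⟩, ⟨0, by omega⟩))

variable (hk : 3 ≤ k) (hm : 4 ≤ m)

theorem hypertreeFEdge_injective : Function.Injective (hypertreeFEdge k m hk hm) :=
  attachPendantEdge_injective (by omega) hyperpathEdge_injective

theorem edgeSet_hypertreeF :
    (hypertreeF k m hk hm).edgeSet = Set.range (hypertreeFEdge k m hk hm) :=
  edgeSet_attachPendant _ rfl

theorem vertexSet_hypertreeF : (hypertreeF k m hk hm).vertexSet = Set.univ := by
  refine Set.eq_univ_of_forall ?_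
  rintro (u | t)
  · exact Or.inl ⟨u, Set.mem_univ u, rfl⟩
  · exact Or.inr ⟨t, rfl⟩

theorem card_vertexSet_hypertreeF [Fintype ↥(hypertreeF k m hk hm).vertexSet] :
    Fintype.card ↥(hypertreeF k m hk hm).vertexSet + m = k * m + 1 := by
  have hpath := card_hyperpath_vertices (k := k) (m := m - 1) (by omega)
  rw [Fintype.card_congr ((Equiv.setCongr (vertexSet_hypertreeF hk hm)).trans (Equiv.Set.univ _)),
    Fintype.card_sum, Fintype.card_fin]
  obtain ⟨m, rfl⟩ := Nat.exists_eq_add_of_le' (show 1 ≤ m by omega)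
  rw [Nat.add_sub_cancel] at hpath ⊢
  rw [Nat.mul_succ]
  omega

theorem forkGraph_adj_iff_hypertreeFEdge {o o' : Option (Fin (m - 1))} :
    (forkGraph (m - 1)).Adj o o' ↔
      o ≠ o' ∧ ∃ v, v ∈ hypertreeFEdge k m hk hm o ∧ v ∈ hypertreeFEdge k m hk hm o' := by
  have hpendant : ∀ i : Fin (m - 1), (i : ℕ) = 1 ↔
      ∃ v, v ∈ hypertreeFEdge k m hk hm none ∧ v ∈ hypertreeFEdge k m hk hm (some i) := fun i => by
    rw [hypertreeFEdge, exists_mem_attachPendantEdge_none_some, inr_mem_hyperpathEdge, Fin.ext_iff,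
      eq_comm]
  rcases o with _ | i <;> rcases o' with _ | j
  · exact iff_of_false id fun h => h.1 rfl
  · exact (hpendant j).trans (by simp only [ne_eq, reduceCtorEq, not_false_eq_true, true_and])
  · refine (hpendant i).trans ?_
    simp only [ne_eq, reduceCtorEq, not_false_eq_true, true_and, and_comm]
  · rw [forkGraph_adj_some_some, ← SimpleGraph.pathGraph_adj,
      pathGraph_adj_iff_hyperpathEdge (k := k), hypertreeFEdge,
      exists_mem_attachPendantEdge_some_some, (Option.some_injective _).ne_iff]

theorem nonempty_iso_lineGraph_hypertreeF :
    Nonempty (forkGraph (m - 1) ≃g lineGraph (edgeVerts (hypertreeF k m hk hm))) :=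
  nonempty_iso_lineGraph (hypertreeFEdge_injective hk hm) (edgeSet_hypertreeF hk hm)
    fun _ _ => forkGraph_adj_iff_hypertreeFEdge hk hm

theorem isUniformHypertree_hypertreeF : (hypertreeF k m hk hm).IsUniformHypertree k m := by
  have : Fintype ↥(hypertreeF k m hk hm).vertexSet := Fintype.ofFinite _
  obtain ⟨g⟩ := nonempty_iso_lineGraph_hypertreeF hk hm
  refine isUniformHypertree_of_connected_lineGraph ?_ ?_
    (g.connected_iff.mp (connected_forkGraph (by omega)))
    (exists_mem_edgeVerts_of_range (edgeSet_hypertreeF hk hm)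
      (exists_mem_attachPendantEdge (exists_mem_hyperpathEdge (by omega))))
    (card_vertexSet_hypertreeF hk hm)
  · intro e he
    rw [edgeSet_hypertreeF] at he
    obtain ⟨o, rfl⟩ := he
    exact encard_attachPendantEdge (by omega) (encard_hyperpathEdge (by omega)) o
  · rw [edgeSet_hypertreeF, encard_range_eq_card (hypertreeFEdge_injective hk hm),
      Fintype.card_option, Fintype.card_fin, Nat.sub_add_cancel (by omega)]

theorem card_edgesAt_hypertreeF_le_two [DecidableEq ↥(hypertreeF k m hk hm).vertexSet]
    [Fintype ↥(hypertreeF k m hk hm).edgeSet] (v : ↥(hypertreeF k m hk hm).vertexSet) :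
    (edgesAt (edgeVerts (hypertreeF k m hk hm)) v).card ≤ 2 :=
  card_edgesAt_le_two (edgeSet_hypertreeF hk hm) (fun _ _ _ _ =>
    eq_or_eq_or_eq_of_mem_attachPendantEdge
      (fun _ _ _ _ => eq_or_eq_or_eq_of_mem_hyperpathEdge) fun _ _ hi hj =>
      (inr_mem_hyperpathEdge.mp hi).symm.trans (inr_mem_hyperpathEdge.mp hj)) v

end HypertreeF

section Invariants

theorem excess_lineGraph_hyperpath {k m : ℕ} [DecidableEq ↥(hyperpath k m).vertexSet]
    [Fintype ↥(hyperpath k m).edgeSet] : excess (lineGraph (edgeVerts (hyperpath k m))) = 0 := by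
  classical
  obtain ⟨f⟩ := nonempty_iso_lineGraph_hyperpath (k := k) (m := m)
  rw [← excess_eq_of_iso f, excess_pathGraph]

variable {k m : ℕ} (hk : 3 ≤ k) (hm : 4 ≤ m) [DecidableEq ↥(hypertreeF k m hk hm).vertexSet]
  [Fintype ↥(hypertreeF k m hk hm).edgeSet]

theorem excess_lineGraph_hypertreeF :
    excess (lineGraph (edgeVerts (hypertreeF k m hk hm))) = 1 := by
  classical
  obtain ⟨f⟩ := nonempty_iso_lineGraph_hypertreeF hk hm
  rw [← excess_eq_of_iso f, excess_forkGraph (by omega)]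

theorem two_le_card_centralLeaves_lineGraph_hypertreeF :
    2 ≤ (centralLeaves (lineGraph (edgeVerts (hypertreeF k m hk hm)))).card := by
  classical
  obtain ⟨f⟩ := nonempty_iso_lineGraph_hypertreeF hk hm
  rw [← card_centralLeaves_eq_of_iso f]
  exact two_le_card_centralLeaves_forkGraph (by omega)

end Invariants

section IsIsomorphic

variable {k m : ℕ} {U : Type*} [Finite U] {T : Hypergraph U}
  [DecidableEq ↥T.vertexSet] [Fintype ↥T.edgeSet]

theorem isIsomorphic_hyperpath_of_excess_eq_zero (hk : 2 ≤ k) (hm : 1 ≤ m)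
    (hT : T.IsUniformHypertree k m) (h2 : ∀ v, (edgesAt (edgeVerts T) v).card ≤ 2)
    (hX : excess (lineGraph (edgeVerts T)) = 0) : T.IsIsomorphic (hyperpath k m) := by
  classical
  have : Fintype ↥T.vertexSet := Fintype.ofFinite _
  have : Fintype ↥(hyperpath k m).edgeSet := Fintype.ofFinite _
  obtain ⟨f⟩ :=
    nonempty_iso_pathGraph_of_excess_eq_zero ((isEdgeTree hT hm).isTree_lineGraph h2) hX
  rw [card_edgeSet hT] at f
  obtain ⟨g⟩ := nonempty_iso_lineGraph_hyperpath (k := k) (m := m)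
  exact isIsomorphic_of_iso_lineGraph hm hT (isUniformHypertree_hyperpath hk hm) h2
    card_edgesAt_hyperpath_le_two (f.trans g)

theorem isIsomorphic_hypertreeF_of_excess_eq_one (hk : 3 ≤ k) (hm : 4 ≤ m)
    (hT : T.IsUniformHypertree k m) (h2 : ∀ v, (edgesAt (edgeVerts T) v).card ≤ 2)
    (hX : excess (lineGraph (edgeVerts T)) = 1)
    (hleaves : 2 ≤ (centralLeaves (lineGraph (edgeVerts T))).card) :
    T.IsIsomorphic (hypertreeF k m hk hm) := by
  classical
  have : Fintype ↥T.vertexSet := Fintype.ofFinite _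
  have : Fintype ↥(hypertreeF k m hk hm).edgeSet := Fintype.ofFinite _
  obtain ⟨f⟩ := nonempty_forkGraph_iso_of_excess_eq_one (n := m - 1)
    (isEdgeTree hT (by omega)).connected hX hleaves (by rw [card_edgeSet hT]; omega)
  obtain ⟨g⟩ := nonempty_iso_lineGraph_hypertreeF hk hm
  exact isIsomorphic_of_iso_lineGraph (by omega) hT (isUniformHypertree_hypertreeF hk hm) h2
    (card_edgesAt_hypertreeF_le_two hk hm) (f.symm.trans g)

end IsIsomorphic

section Comparison

variable {k m : ℕ} {a : ℝ} {U : Type*} [Finite U] {T : Hypergraph U}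

theorem alphaLT_hyperpath_hypertreeF (hk : 3 ≤ k) (hm : 4 ≤ m) (ha : 0 < a) (ha1 : a < 1) :
    AlphaLT k a (hyperpath k m) (hypertreeF k m hk hm) := by
  classical
  have : Fintype ↥(hyperpath k m).vertexSet := Fintype.ofFinite _
  have : Fintype ↥(hyperpath k m).edgeSet := Fintype.ofFinite _
  have : Fintype ↥(hypertreeF k m hk hm).vertexSet := Fintype.ofFinite _
  have : Fintype ↥(hypertreeF k m hk hm).edgeSet := Fintype.ofFinite _
  have hP := isUniformHypertree_hyperpath (k := k) (m := m) (by omega) (by omega)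
  have hF := isUniformHypertree_hypertreeF hk hm
  have : Nontrivial ↥(hyperpath k m).edgeSet :=
    Fintype.one_lt_card_iff_nontrivial.mp (by rw [card_edgeSet hP]; omega)
  have hPX := excess_lineGraph_hyperpath (k := k) (m := m)
  have hFX := excess_lineGraph_hypertreeF hk hm
  exact alphaLT_of_momentLTAt hk hm hP hF (d := k + 2) (by omega) (by omega)
    ((isEdgeTree hP (by omega)).momentLTAt_of_excess_lt (isEdgeTree hF (by omega)) hk
      (by rw [card_edgeSet hP, card_edgeSet hF]) card_edgesAt_hyperpath_le_two
      (card_edgesAt_hypertreeF_le_two hk hm) (by omega) (by omega) ha ha1)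

theorem alphaLT_or_isIsomorphic_hypertreeF (hk : 3 ≤ k) (hm : 4 ≤ m) (ha : 0 < a) (ha1 : a < 1)
    (hT : T.IsUniformHypertree k m) (hTP : ¬ T.IsIsomorphic (hyperpath k m)) :
    AlphaLT k a (hypertreeF k m hk hm) T ∨ T.IsIsomorphic (hypertreeF k m hk hm) := by
  classical
  have : Fintype ↥(hypertreeF k m hk hm).vertexSet := Fintype.ofFinite _
  have : Fintype ↥(hypertreeF k m hk hm).edgeSet := Fintype.ofFinite _
  have : Fintype ↥T.vertexSet := Fintype.ofFinite _
  have : Fintype ↥T.edgeSet := Fintype.ofFinite _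
  have hF := isUniformHypertree_hypertreeF hk hm
  have hFt := isEdgeTree hF (by omega)
  have hTt := isEdgeTree hT (by omega)
  have hF2 := card_edgesAt_hypertreeF_le_two hk hm
  have hFX := excess_lineGraph_hypertreeF hk hm
  have hE : Fintype.card ↥(hypertreeF k m hk hm).edgeSet = Fintype.card ↥T.edgeSet := by
    rw [card_edgeSet hF, card_edgeSet hT]
  have hFm := card_edgeSet hF
  have : Nontrivial ↥(hypertreeF k m hk hm).edgeSet :=
    Fintype.one_lt_card_iff_nontrivial.mp (by omega)
  rcases em' (∀ v, (edgesAt (edgeVerts T) v).card ≤ 2) with h3 | hT2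
  · push Not at h3
    exact Or.inl (alphaLT_of_momentLTAt hk hm hF hT (by omega) (by omega)
      (hFt.momentLTAt_two hTt hk hE hF2 h3 ha))
  rcases Nat.lt_trichotomy (excess (lineGraph (edgeVerts T))) 1 with hX | hX | hX
  · exact absurd (isIsomorphic_hyperpath_of_excess_eq_zero (by omega) (by omega) hT hT2
      (by omega)) hTP
  · rcases lt_or_ge (centralLeaves (lineGraph (edgeVerts T))).card
      (centralLeaves (lineGraph (edgeVerts (hypertreeF k m hk hm)))).card with hlt | hle
    · exact Or.inl (alphaLT_of_momentLTAt hk hm hF hT (by omega) le_rfl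
        (hFt.momentLTAt_of_card_centralLeaves_lt hTt hk hE (by omega) hF2 hT2 hFX hX hlt ha ha1))
    · exact Or.inr (isIsomorphic_hypertreeF_of_excess_eq_one hk hm hT hT2 hX
        ((two_le_card_centralLeaves_lineGraph_hypertreeF hk hm).trans hle))
  · exact Or.inl (alphaLT_of_momentLTAt hk hm hF hT (by omega) (by omega)
      (hFt.momentLTAt_of_excess_lt hTt hk hE hF2 hT2 hFX.le (by omega) ha ha1))

end Comparison

end HypertreeOrder

theorem mainTheorem5 (k m : ℕ) (hk : 3 ≤ k) (hm : 4 ≤ m) (a : ℝ) (ha0 : 0 < a) (ha1 : a < 1) :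
    (Hypergraph.hyperpath k m).IsUniformHypertree k m ∧
    (Hypergraph.hypertreeF k m hk hm).IsUniformHypertree k m ∧
    Hypergraph.AlphaLT k a (Hypergraph.hyperpath k m) (Hypergraph.hypertreeF k m hk hm) ∧
    ∀ (U : Type*) [Finite U] (T : Hypergraph U), T.IsUniformHypertree k m →
      ¬ T.IsIsomorphic (Hypergraph.hyperpath k m) →
        Hypergraph.AlphaLE k a (Hypergraph.hypertreeF k m hk hm) T ∧
        (Hypergraph.AlphaEq k a (Hypergraph.hypertreeF k m hk hm) T ↔
          T.IsIsomorphic (Hypergraph.hypertreeF k m hk hm)) := by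
  have hF := HypertreeOrder.isUniformHypertree_hypertreeF hk hm
  refine ⟨HypertreeOrder.isUniformHypertree_hyperpath (by omega) (by omega), hF,
    HypertreeOrder.alphaLT_hyperpath_hypertreeF hk hm ha0 ha1, fun U _ T hT hTP => ?_⟩
  have hcases := HypertreeOrder.alphaLT_or_isIsomorphic_hypertreeF hk hm ha0 ha1 hT hTP
  have heq (h : T.IsIsomorphic (Hypergraph.hypertreeF k m hk hm)) :
      Hypergraph.AlphaEq k a (Hypergraph.hypertreeF k m hk hm) T :=
    HypertreeOrder.alphaEq_of_isIsomorphic (by omega) hF.uniform hT.uniform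
      (HypertreeOrder.isIsomorphic_symm h) a
  exact ⟨hcases.imp_right heq, fun h => hcases.resolve_left fun hlt =>
    HypertreeOrder.not_alphaEq_of_alphaLT hlt h, heq⟩
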